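/- Let $M$ be either the Euclidean plane $\mathbb{R}^2$ with Lebesgue measure $\mu$, or the unit sphere $\mathbb{S}^2\subset\mathbb{R}^3$ with the chordal metric and the $2$-dimensional Hausdorff measure $\mu$. Let $\Omega\subset M$ be a countably connected circle domain, that is, a non-empty connected open set such that every connected component of $\partial\Omega$ is a point or a circle and $M\setminus\Omega$ has at most countably many connected components. Let $\partial_0\Omega$ be the set of connected components of $\partial\Omega$. For disjoint compact connected sets $E,F$ with more than one point (non-degenerate continua) put $$\Delta(E,F)=\frac{\operatorname{dist}(E,F)}{\min\{\operatorname{diam}E,\operatorname{diam}F\}}.$$ For a family $\Gamma$ of curves $\gamma:[0,1]\to\overline{\Omega}$ the transboundary modulus is $$\operatorname{mod}_{\partial_0\Omega}(\Gamma)=\inf\Big(\int_\Omega\rho^2\,d\mu+\sum_{K\in\partial_0\Omega}\rho_K^2\Big),$$ where the infimum is over all Borel functions $\rho:\Omega\to[0,\infty]$ and all weights $\rho_K\in[0,\infty]$, $K\in\partial_0\Omega$, such that $$\sum_m\int_{\gamma_m}\rho\,ds+\sum_{K\in\partial_0\Omega,\ K\cap\gamma\neq\emptyset}\rho_K\ \ge\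 1$$ for every $\gamma\in\Gamma$ for which all $\gamma_m$ are locally rectifiable; here the $\gamma_m$ are the restrictions of $\gamma$ to the connected components of $\gamma^{-1}(\Omega)$. For an integer $N\ge 0$, $\Omega$ is called $N$-transboundary Loewner if there is a decreasing function $\Psi:(0,\infty)\to(0,\infty)$ such that $$\operatorname{mod}_{\partial_0\Omega}\big(\Gamma(E,F;\overline{\Omega}\setminus \textstyle\bigcup\mathcal{J})\big)\ \ge\ \Psi(\Delta(E,F))$$ for all disjoint non-degenerate continua $E,F\subset\Omega$ and all $\mathcal{J}\subset\partial_0\Omega$ with $\#\mathcal{J}\le N$, where $\Gamma(E,F;A)$ is the family of all curves $\gamma:[0,1]\to A$ with $\gamma(0)\in E$ and $\gamma(1)\in F$. Then the following are equivalent: (1) $\Omega$ is $N$-transboundary Loewner for every $N\in\mathbb{N}$; (2) $\Omega$ is $2$-transboundary Loewner; (3) the boundary circles of $\Omega$ are uniformly relatively separated: there is $c>0$ such that $\Delta(C,C')>c$ for any two distinct circles $C,C'\in\partial_0\Omega$. -/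

import Mathlib

open Set MeasureTheory
open scoped ENNReal

noncomputable section

namespace CircleDomain

variable {M : Type*}

/-- The connected components of a subset `A` of a topological space. -/
def componentsOf [TopologicalSpace M] (A : Set M) : Set (Set M) :=
  {C | ∃ x ∈ A, C = connectedComponentIn A x}

/-- The boundary components of a set `Ω`. For an open subset of a complete metric space,
`closure Ω` is the completion of `Ω` and `frontier Ω = closure Ω \ Ω`. -/
def boundaryComponents [TopologicalSpace M] (Ω : Set M) : Set (Set M) :=
  componentsOf (frontier Ω)

/-- Circles in the plane, and in the round sphere with its chordal metric: metric spheres with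
more than one point. -/
def IsCircle [MetricSpace M] (S : Set M) : Prop :=
  S.Nontrivial ∧ ∃ (p : M) (r : ℝ), S = Metric.sphere p r

/-- A domain (non-empty connected open set) each of whose boundary components is a point or a
circle and whose complement has at most countably many connected components. -/
structure IsCountablyConnectedCircleDomain [MetricSpace M] (Ω : Set M) : Prop where
  isOpen : IsOpen Ω
  isConnected : IsConnected Ω
  point_or_circle : ∀ K ∈ boundaryComponents Ω, (∃ x, K = {x}) ∨ IsCircle K
  countable : (componentsOf Ωᶜ).Countable

/-- A non-degenerate continuum: a compact connected set with more than one point. -/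
structure IsNondegenerateContinuum [TopologicalSpace M] (E : Set M) : Prop where
  isCompact : IsCompact E
  isConnected : IsConnected E
  nontrivial : E.Nontrivial

/-- The distance `inf {d(x, y) : x ∈ E, y ∈ F}` between two sets. -/
def setDist [MetricSpace M] (E F : Set M) : ℝ :=
  sInf (Set.image2 dist E F)

/-- The relative distance `dist(E, F) / min (diam E, diam F)`. -/
def relDist [MetricSpace M] (E F : Set M) : ℝ :=
  setDist E F / min (Metric.diam E) (Metric.diam F)

/-- A family of sets is uniformly relatively separated. -/
def UniformlyRelativelySeparated [MetricSpace M] (𝒮 : Set (Set M)) : Prop :=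
  ∃ c : ℝ, 0 < c ∧ ∀ A ∈ 𝒮, ∀ B ∈ 𝒮, A ≠ B → c < relDist A B

/-- The circles among the boundary components (that is, all of them but the points). -/
def boundaryCircles [MetricSpace M] (Ω : Set M) : Set (Set M) :=
  {K | K ∈ boundaryComponents Ω ∧ IsCircle K}

/-- The family of curves `γ : [0,1] → A` that connect `E` and `F`. A curve is represented by a
function on `ℝ`, of which only the restriction to `[0,1]` matters. -/
def connectingCurves [TopologicalSpace M] (E F A : Set M) : Set (ℝ → M) :=
  {γ | ContinuousOn γ (Icc 0 1) ∧ MapsTo γ (Icc 0 1) A ∧ γ 0 ∈ E ∧ γ 1 ∈ F}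

/-- The maximal subintervals of `[0,1]` that `γ` maps into `Ω`. -/
def pieces [TopologicalSpace M] (Ω : Set M) (γ : ℝ → M) : Set (Set ℝ) :=
  componentsOf (Icc 0 1 ∩ γ ⁻¹' Ω)

/-- All the pieces of `γ` in `Ω` are locally rectifiable. -/
def LocallyRectifiableRel [MetricSpace M] (Ω : Set M) (γ : ℝ → M) : Prop :=
  ∀ J ∈ pieces Ω γ, LocallyBoundedVariationOn γ J

/-- The integral of `ρ` with respect to arclength along the rectifiable curve `γ` restricted to
`[a,b]`, by means of the arclength parametrization. -/
def compactLineIntegral [MetricSpace M] (ρ : M → ℝ≥0∞) (γ : ℝ → M) (a b : ℝ) : ℝ≥0∞ :=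
  ∫⁻ s in Icc 0 (variationOnFromTo γ (Icc a b) a b), ρ (naturalParameterization γ (Icc a b) a s)

/-- The integral of `ρ` with respect to arclength along the locally rectifiable curve `γ`
restricted to an interval `J`: the supremum over all compact subcurves. -/
def lineIntegral [MetricSpace M] (ρ : M → ℝ≥0∞) (γ : ℝ → M) (J : Set ℝ) : ℝ≥0∞ :=
  ⨆ (a : ℝ) (b : ℝ) (_ : a ∈ J) (_ : b ∈ J) (_ : a ≤ b), compactLineIntegral ρ γ a b

/-- The length of `γ` with respect to the mass distribution with density `ρ` on `Ω` and weights
`w` on the boundary components: every boundary component that meets `γ` is counted once. -/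
def transboundaryLength [MetricSpace M] (Ω : Set M) (ρ : M → ℝ≥0∞)
    (w : boundaryComponents Ω → ℝ≥0∞) (γ : ℝ → M) : ℝ≥0∞ :=
  (∑' J : pieces Ω γ, lineIntegral ρ γ J) +
    (∑' K : {K : boundaryComponents Ω | (γ '' Icc 0 1 ∩ (K : Set M)).Nonempty}, w K)

/-- Admissibility of a mass distribution for a family of curves in `closure Ω`. Only the values of
`ρ` on the open set `Ω` matter. -/
def IsAdmissible [MetricSpace M] [MeasurableSpace M] (Ω : Set M) (Γ : Set (ℝ → M))
    (ρ : M → ℝ≥0∞) (w : boundaryComponents Ω → ℝ≥0∞) : Prop :=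
  Measurable ρ ∧
    ∀ γ ∈ Γ, LocallyRectifiableRel Ω γ → 1 ≤ transboundaryLength Ω ρ w γ

/-- The transboundary modulus, with respect to all the boundary components of `Ω`, of a family of
curves in `closure Ω`. -/
def transboundaryModulus [MetricSpace M] [MeasurableSpace M] (μ : Measure M) (Ω : Set M)
    (Γ : Set (ℝ → M)) : ℝ≥0∞ :=
  ⨅ (ρ : M → ℝ≥0∞) (w : boundaryComponents Ω → ℝ≥0∞) (_ : IsAdmissible Ω Γ ρ w),
    (∫⁻ x in Ω, ρ x ^ 2 ∂μ) + (∑' K : boundaryComponents Ω, w K ^ 2)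

/-- The `N`-transboundary Loewner property. -/
def IsTransboundaryLoewner [MetricSpace M] [MeasurableSpace M] (μ : Measure M) (Ω : Set M)
    (N : ℕ) : Prop :=
  ∃ Ψ : ℝ → ℝ, AntitoneOn Ψ (Ioi 0) ∧ (∀ t, 0 < t → 0 < Ψ t) ∧
    ∀ E F : Set M, IsNondegenerateContinuum E → IsNondegenerateContinuum F →
      E ⊆ Ω → F ⊆ Ω → Disjoint E F →
      ∀ 𝒥 : Set (Set M), 𝒥 ⊆ boundaryComponents Ω → 𝒥.encard ≤ N →
        ENNReal.ofReal (Ψ (relDist E F)) ≤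
          transboundaryModulus μ Ω (connectingCurves E F (closure Ω \ ⋃₀ 𝒥))

/-- The unit sphere in Euclidean three-space, with the chordal metric. -/
abbrev RiemannSphere : Type := Metric.sphere (0 : EuclideanSpace ℝ (Fin 3)) 1

end CircleDomain

end

open scoped NNReal

namespace CircleDomain

/-! Plane and sphere are treated together through `PolarSpace`: polar coordinates with a common law
of cosines. A circle domain is the complement of disjoint round discs, bounded by its boundary
circles, and of point components (`exists_hullSystem`). This rests on unicoherence: a complementary
component has connected boundary, so it lies in a single disc or is a single point.

Separation implies Loewner. Suppose that a mass distribution has small total mass. By a length-area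
argument, every annulus of given relative thickness contains a short circle (`exists_short_circle`).
The weight of a disc enters the average over radii through the length of the set of radii whose
circles meet it; the square of this length is bounded by the area of the disc near the annulus,
because round discs are fat, and disjointness bounds the sum of these areas. Countably many points
are avoided by almost every radius, so point components play no role.

A circle minus one round disc is an arc, so two continua can be joined outside one excluded disc
along boundedly many short circles (`exists_link_local`). Finitely many excluded discs are handled
by induction, removing a smallest one (`IsSeparated.exists_link`). Separation gives it a collar, of
width proportional to its radius, that no other excluded disc meets. At scales small against the
collar only this disc matters. At larger scales a path that avoids the other discs is led around it
on a short circle in the collar (`exists_detour`); continua contained in the collar are first linked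
to circles that leave it (`exists_escape`). The path so obtained may cross discs that are not
excluded; it is pushed onto their boundary circles, which at most doubles its speed
(`exists_pushout`). The resulting curve has transboundary length below `1`, which contradicts
admissibility.

Loewner with two excluded components implies separation. If two circles are very close relative to
the smaller one, of radius `r`, then at scale `ε * r` around a nearly common point the two discs
look like complementary half-planes, and what they leave of an annulus lies in two sectors of
opening `O(ε)` (`measure_gap_le`). Give the annulus constant density, the two circles weight zero,
and every other component the oscillation on it of a radial ramp function. This is admissible for
curves that cross the annulus and avoid both circles (`one_le_transboundaryLength`), and its mass is
`O(ε)`, again by fatness. Continua on the two sides of the annulus have relative distance at most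
`4`, so a small `ε` contradicts the lower bound `Ψ 4`. -/

lemma le_of_sq_le_sq_of_nonneg {a b : ℝ} (h : a ^ 2 ≤ b ^ 2) (hb : 0 ≤ b) : a ≤ b :=
  (le_abs_self a).trans (abs_le_of_sq_le_sq h hb)

/-! ### Polar coordinates and the law of cosines, for plane and sphere alike -/

/-- A metric space with polar coordinates around every point and the law of cosines of the
plane (`k = 0`) or of the unit sphere with its chordal metric (`k = 1`). -/
structure PolarSpace (M : Type*) [MetricSpace M] where
  /-- the curvature -/
  k : ℝ
  k_eq : k = 0 ∨ k = 1
  /-- the point with polar coordinates `(r, θ)` around `a` -/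
  Φ : M → ℝ → ℝ → M
  continuous_polar : ∀ a, Continuous fun p : ℝ × ℝ => Φ a p.1 p.2
  exists_angle' : ∀ a z : M, ∃ θ, Φ a (dist a z) θ = z
  dist_bound : ∀ a z : M, k * dist a z ^ 2 ≤ 4
  law : ∀ (a : M) (r s θ φ : ℝ), 0 ≤ r → 0 ≤ s → k * r ^ 2 ≤ 4 → k * s ^ 2 ≤ 4 →
    dist (Φ a r θ) (Φ a s φ) ^ 2 = r ^ 2 + s ^ 2 - k * r ^ 2 * s ^ 2 / 2 -
      2 * (r * √(1 - k * r ^ 2 / 4)) * (s * √(1 - k * s ^ 2 / 4)) * Real.cos (θ - φ)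

namespace PolarSpace

variable {M : Type*} [MetricSpace M] (P : PolarSpace M)

lemma k_nonneg : 0 ≤ P.k := by rcases P.k_eq with h | h <;> simp [h]

/-- The Euclidean radius of the circle with centre `a` and radius `r`. -/
noncomputable def rad (r : ℝ) : ℝ := r * √(1 - P.k * r ^ 2 / 4)

lemma rad_nonneg {r : ℝ} (hr : 0 ≤ r) : 0 ≤ P.rad r := mul_nonneg hr (Real.sqrt_nonneg _)

lemma rad_le {r : ℝ} (hr : 0 ≤ r) : P.rad r ≤ r := by
  unfold rad
  have : √(1 - P.k * r ^ 2 / 4) ≤ 1 := by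
    apply Real.sqrt_le_one.2
    have := mul_nonneg P.k_nonneg (sq_nonneg r)
    linarith
  nlinarith

/-- The bound `k * r ^ 2 ≤ 3` keeps `r` away from the antipode. It recurs below as the range where
polar coordinates are comparable with those of the plane. -/
lemma half_le_rad {r : ℝ} (hr : 0 ≤ r) (h : P.k * r ^ 2 ≤ 3) : r / 2 ≤ P.rad r := by
  unfold rad
  have : 1 / 2 ≤ √(1 - P.k * r ^ 2 / 4) := by
    apply Real.le_sqrt_of_sq_le
    linarith
  nlinarith

lemma rad_sq {r : ℝ} (h : P.k * r ^ 2 ≤ 4) : P.rad r ^ 2 = r ^ 2 - P.k * r ^ 4 / 4 := by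
  unfold rad
  rw [mul_pow, Real.sq_sqrt (by linarith)]
  ring

lemma rad_zero : P.rad 0 = 0 := by simp [rad]

/-- For `k = 1` put `r = 2 sin (t / 2)`: then `1 - r ^ 2 / 2 = cos t` and `rad r = sin t`, and this
is the spherical law of cosines in chordal distances. The condition `k * r ^ 2 ≤ 4` says that `r`
does not exceed the diameter of the sphere. -/
lemma dist_sq (a : M) {r s : ℝ} (θ φ : ℝ) (hr : 0 ≤ r) (hs : 0 ≤ s) (hr' : P.k * r ^ 2 ≤ 4)
    (hs' : P.k * s ^ 2 ≤ 4) :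
    dist (P.Φ a r θ) (P.Φ a s φ) ^ 2 = r ^ 2 + s ^ 2 - P.k * r ^ 2 * s ^ 2 / 2 -
      2 * P.rad r * P.rad s * Real.cos (θ - φ) := P.law a r s θ φ hr hs hr' hs'

lemma polar_zero (a : M) (θ : ℝ) : P.Φ a 0 θ = a := by
  obtain ⟨φ, h⟩ := P.exists_angle' a a
  rw [dist_self] at h
  have h2 := P.dist_sq a θ φ le_rfl le_rfl (by simp) (by simp)
  rw [h] at h2
  simpa [rad_zero] using h2

lemma dist_polar (a : M) {r : ℝ} (θ : ℝ) (hr : 0 ≤ r) (hr' : P.k * r ^ 2 ≤ 4) :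
    dist a (P.Φ a r θ) = r := by
  have h2 := P.dist_sq a θ θ hr le_rfl hr' (by simp)
  rw [P.polar_zero, rad_zero] at h2
  rw [dist_comm]
  have : dist (P.Φ a r θ) a ^ 2 = r ^ 2 := by rw [h2]; ring
  exact (pow_left_inj₀ dist_nonneg hr two_ne_zero).1 this

lemma dist_polar' (a : M) {r : ℝ} (θ : ℝ) (hr : 0 ≤ r) (hr' : P.k * r ^ 2 ≤ 4) :
    dist (P.Φ a r θ) a = r := by rw [dist_comm, P.dist_polar a θ hr hr']

lemma polar_add_int (a : M) {r : ℝ} (θ : ℝ) (n : ℤ) (hr : 0 ≤ r) (hr' : P.k * r ^ 2 ≤ 4) :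
    P.Φ a r (θ + n * (2 * Real.pi)) = P.Φ a r θ := by
  have h2 := P.dist_sq a (θ + n * (2 * Real.pi)) θ hr hr hr' hr'
  have h3 := P.rad_sq hr'
  rw [show θ + n * (2 * Real.pi) - θ = n * (2 * Real.pi) by ring, Real.cos_int_mul_two_pi] at h2
  have : dist (P.Φ a r (θ + n * (2 * Real.pi))) (P.Φ a r θ) ^ 2 = 0 := by
    rw [h2]; linear_combination -2 * h3
  simpa using this

/-- Every point has polar coordinates with an angle in a given period. -/
lemma exists_angle (a z : M) (θ₀ : ℝ) :
    ∃ θ ∈ Ico θ₀ (θ₀ + 2 * Real.pi), P.Φ a (dist a z) θ = z := by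
  obtain ⟨θ, h⟩ := P.exists_angle' a z
  refine ⟨toIcoMod Real.two_pi_pos θ₀ θ, toIcoMod_mem_Ico _ _ _, ?_⟩
  have := self_sub_toIcoDiv_zsmul Real.two_pi_pos θ₀ θ
  rw [← this, zsmul_eq_mul, show θ - (toIcoDiv Real.two_pi_pos θ₀ θ : ℝ) * (2 * Real.pi) =
    θ + ((-toIcoDiv Real.two_pi_pos θ₀ θ : ℤ) : ℝ) * (2 * Real.pi) by push_cast; ring,
    P.polar_add_int a θ _ dist_nonneg (P.dist_bound a z), h]

lemma dist_sq_same (a : M) {r : ℝ} (θ φ : ℝ) (hr : 0 ≤ r) (hr' : P.k * r ^ 2 ≤ 4) :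
    dist (P.Φ a r θ) (P.Φ a r φ) ^ 2 = 4 * P.rad r ^ 2 * Real.sin ((θ - φ) / 2) ^ 2 := by
  rw [P.dist_sq a θ φ hr hr hr' hr', Real.sin_sq_eq_half_sub, show 2 * ((θ - φ) / 2) = θ - φ by ring]
  linear_combination (-2) * P.rad_sq hr'

lemma dist_same_le (a : M) {r : ℝ} (θ φ : ℝ) (hr : 0 ≤ r) (hr' : P.k * r ^ 2 ≤ 4) :
    dist (P.Φ a r θ) (P.Φ a r φ) ≤ P.rad r * |θ - φ| := by
  have h := P.dist_sq_same a θ φ hr hr'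
  have h0 := P.rad_nonneg hr
  refine le_of_sq_le_sq_of_nonneg ?_ (by positivity)
  rw [h]
  have := Real.abs_sin_le_abs (x := (θ - φ) / 2)
  have h3 : Real.sin ((θ - φ) / 2) ^ 2 ≤ ((θ - φ) / 2) ^ 2 := sq_le_sq.2 this
  rw [mul_pow, sq_abs]
  nlinarith [mul_le_mul_of_nonneg_left h3 (sq_nonneg (P.rad r))]

lemma sin_lower {x : ℝ} (hx : |x| ≤ Real.pi) : x ^ 2 / Real.pi ^ 2 ≤ Real.sin (x / 2) ^ 2 := by
  have hp := Real.pi_pos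
  have h1 : 2 / Real.pi * (|x| / 2) ≤ Real.sin (|x| / 2) :=
    Real.mul_le_sin (by positivity) (by linarith)
  have h2 : Real.sin (|x| / 2) ^ 2 = Real.sin (x / 2) ^ 2 := by
    rcases abs_cases x with ⟨h, _⟩ | ⟨h, _⟩ <;> rw [h]
    rw [neg_div, Real.sin_neg, neg_sq]
  rw [← h2]
  calc x ^ 2 / Real.pi ^ 2 = (2 / Real.pi * (|x| / 2)) ^ 2 := by
        rw [mul_pow, div_pow, div_pow, sq_abs]; field_simp
    _ ≤ _ := pow_le_pow_left₀ (by positivity) h1 2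

lemma arc_le_dist (a : M) {r θ φ : ℝ} (hr : 0 ≤ r) (hr' : P.k * r ^ 2 ≤ 4)
    (h : |θ - φ| ≤ Real.pi) :
    P.rad r * |θ - φ| ≤ Real.pi / 2 * dist (P.Φ a r θ) (P.Φ a r φ) := by
  have hp := Real.pi_pos
  have h0 := P.rad_nonneg hr
  refine le_of_sq_le_sq_of_nonneg ?_ (by positivity)
  rw [mul_pow, mul_pow, P.dist_sq_same a θ φ hr hr', sq_abs]
  have := sin_lower h
  rw [div_le_iff₀ (by positivity)] at this
  nlinarith [mul_le_mul_of_nonneg_left this (sq_nonneg (P.rad r))]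

/-- Isolates the part of the squared distance that does not depend on the angle as `(r - s) ^ 2`
plus a non-negative curvature error; both comparisons with the plane below start from it. -/
lemma radial_part {r s : ℝ} (hr' : P.k * r ^ 2 ≤ 4) (hs' : P.k * s ^ 2 ≤ 4) :
    r ^ 2 + s ^ 2 - P.k * r ^ 2 * s ^ 2 / 2 - 2 * P.rad r * P.rad s =
      (r - s) ^ 2 + r * s * (P.k * (r - s) ^ 2 / 4 +
        (√(1 - P.k * r ^ 2 / 4) - √(1 - P.k * s ^ 2 / 4)) ^ 2) := by
  have h1 := Real.sq_sqrt (show 0 ≤ 1 - P.k * r ^ 2 / 4 by linarith)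
  have h2 := Real.sq_sqrt (show 0 ≤ 1 - P.k * s ^ 2 / 4 by linarith)
  unfold rad
  linear_combination - r * s * h1 - r * s * h2

lemma dist_sq_ge (a : M) {r s : ℝ} (θ φ : ℝ) (hr : 0 ≤ r) (hs : 0 ≤ s) (hr' : P.k * r ^ 2 ≤ 3)
    (hs' : P.k * s ^ 2 ≤ 3) :
    (r - s) ^ 2 + r * s * Real.sin ((θ - φ) / 2) ^ 2 ≤ dist (P.Φ a r θ) (P.Φ a s φ) ^ 2 := by
  have h := P.radial_part (r := r) (s := s) (by linarith) (by linarith)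
  have e : Real.cos (θ - φ) = 1 - 2 * Real.sin ((θ - φ) / 2) ^ 2 := by
    rw [Real.sin_sq_eq_half_sub, show 2 * ((θ - φ) / 2) = θ - φ by ring]; ring
  rw [P.dist_sq a θ φ hr hs (by linarith) (by linarith), e]
  have h1 := P.half_le_rad hr hr'
  have h2 := P.half_le_rad hs hs'
  have h3 : r * s ≤ 4 * (P.rad r * P.rad s) := by
    have := mul_le_mul h1 h2 (by positivity) (P.rad_nonneg hr)
    linarith
  have h4 := mul_le_mul_of_nonneg_right h3 (sq_nonneg (Real.sin ((θ - φ) / 2)))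
  have h5 : 0 ≤ r * s * (P.k * (r - s) ^ 2 / 4 +
        (√(1 - P.k * r ^ 2 / 4) - √(1 - P.k * s ^ 2 / 4)) ^ 2) := by
    have := P.k_nonneg
    positivity
  nlinarith

lemma dist_sq_le (a : M) {r s : ℝ} (θ φ : ℝ) (hr : 0 ≤ r) (hs : 0 ≤ s) (hr' : P.k * r ^ 2 ≤ 3)
    (hs' : P.k * s ^ 2 ≤ 3) :
    dist (P.Φ a r θ) (P.Φ a s φ) ^ 2 ≤ 4 * (r - s) ^ 2 + r * s * (θ - φ) ^ 2 := by
  have h := P.radial_part (r := r) (s := s) (by linarith) (by linarith)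
  have e : Real.cos (θ - φ) = 1 - 2 * Real.sin ((θ - φ) / 2) ^ 2 := by
    rw [Real.sin_sq_eq_half_sub, show 2 * ((θ - φ) / 2) = θ - φ by ring]; ring
  rw [P.dist_sq a θ φ hr hs (by linarith) (by linarith), e]
  have h3 : P.rad r * P.rad s ≤ r * s := mul_le_mul (P.rad_le hr) (P.rad_le hs) (P.rad_nonneg hs) hr
  have h6 : Real.sin ((θ - φ) / 2) ^ 2 ≤ ((θ - φ) / 2) ^ 2 := sq_le_sq.2 Real.abs_sin_le_abs
  have h4 : P.rad r * P.rad s * Real.sin ((θ - φ) / 2) ^ 2 ≤ r * s * ((θ - φ) / 2) ^ 2 :=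
    mul_le_mul h3 h6 (sq_nonneg _) (by positivity)
  have h5 : r * s * (P.k * (r - s) ^ 2 / 4 +
        (√(1 - P.k * r ^ 2 / 4) - √(1 - P.k * s ^ 2 / 4)) ^ 2) ≤ 3 * (r - s) ^ 2 := by
    set A := √(1 - P.k * r ^ 2 / 4) with hA
    set B := √(1 - P.k * s ^ 2 / 4) with hB
    have hA2 : A ^ 2 = 1 - P.k * r ^ 2 / 4 := Real.sq_sqrt (by linarith)
    have hB2 : B ^ 2 = 1 - P.k * s ^ 2 / 4 := Real.sq_sqrt (by linarith)
    have hA1 : 1 / 2 ≤ A := Real.le_sqrt_of_sq_le (by linarith)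
    have hB1 : 1 / 2 ≤ B := Real.le_sqrt_of_sq_le (by linarith)
    have key : (A - B) ^ 2 ≤ 3 * (P.k * (r - s) ^ 2 / 4) := by
      have e1 : (A - B) * (A + B) = - (P.k * (r - s) * (r + s) / 4) := by
        linear_combination hA2 - hB2
      have e2 : (A - B) ^ 2 * (A + B) ^ 2 = (P.k * (r - s) * (r + s) / 4) ^ 2 := by
        rw [← mul_pow, e1]; ring
      have e3 : P.k * (r + s) ^ 2 ≤ 12 := by
        nlinarith [mul_nonneg P.k_nonneg (sq_nonneg (r - s))]
      have e4 : (A - B) ^ 2 ≤ (A - B) ^ 2 * (A + B) ^ 2 := by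
        exact le_mul_of_one_le_right (sq_nonneg _) (by nlinarith)
      rw [e2] at e4
      nlinarith [mul_le_mul_of_nonneg_left e3 (mul_nonneg P.k_nonneg (sq_nonneg (r - s)))]
    have e5 : P.k * (r * s) ≤ 3 := by
      nlinarith [mul_nonneg P.k_nonneg (sq_nonneg (r - s))]
    have e6 : r * s * (P.k * (r - s) ^ 2 / 4 + (A - B) ^ 2) ≤ r * s * (P.k * (r - s) ^ 2) := by
      apply mul_le_mul_of_nonneg_left _ (by positivity)
      linarith
    nlinarith [sq_nonneg (r - s)]
  nlinarith

lemma dist_radial_le (a : M) {r s : ℝ} (θ : ℝ) (hr : 0 ≤ r) (hs : 0 ≤ s) (hr' : P.k * r ^ 2 ≤ 3)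
    (hs' : P.k * s ^ 2 ≤ 3) : dist (P.Φ a r θ) (P.Φ a s θ) ≤ 2 * |r - s| := by
  have h := P.dist_sq_le a θ θ hr hs hr' hs'
  refine le_of_sq_le_sq_of_nonneg ?_ (by positivity)
  rw [mul_pow, sq_abs]
  nlinarith

/-- In positive curvature, every point has an antipode. -/
lemma exists_antipode (hk : P.k = 1) (a : M) : ∃ b, ∀ z, dist b z ^ 2 = 4 - dist a z ^ 2 := by
  refine ⟨P.Φ a 2 0, fun z => ?_⟩
  obtain ⟨θ, -, h⟩ := P.exists_angle a z 0
  have hb := P.dist_bound a z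
  have := P.dist_sq a (r := 2) (s := dist a z) 0 θ (by norm_num) dist_nonneg (by rw [hk]; norm_num) hb
  rw [h] at this
  rw [this]
  have h2 : P.rad 2 = 0 := by simp [rad, hk]; norm_num
  rw [h2, hk]; ring

/-- There are points at the same prescribed distance from two given points. -/
lemma exists_equidistant (p q : M) {s : ℝ} (hs : 0 < s) (hs2 : P.k * s ^ 2 ≤ 2)
    (h : dist p q ≤ s ∨ P.k * s ^ 2 = 2) : ∃ x, dist x p = s ∧ dist x q = s := by
  obtain ⟨φ, -, hq⟩ := P.exists_angle p q 0
  have hR := P.dist_bound p q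
  set R := dist p q with hRdef
  have hR0 : 0 ≤ R := dist_nonneg
  -- The point at distance `s` from `p` in direction `θ` has distance `s` from `q` exactly when `d *
  -- cos (θ - φ) = c`. This is solvable once `0 ≤ c ≤ d`; when `k * s ^ 2 = 2` the left side `c`
  -- vanishes, whatever the distance of `p` and `q`.
  set c := R ^ 2 * (1 - P.k * s ^ 2 / 2) with hc
  have hc0 : 0 ≤ c := mul_nonneg (sq_nonneg _) (by linarith)
  set d := 2 * P.rad s * P.rad R with hd
  have hcd : c ≤ d := by
    rcases h with h | h
    · have hk := P.k_nonneg
      have hRs : P.k * R ^ 2 ≤ 2 := le_trans (by gcongr) hs2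
      have h1 : R ^ 2 * (1 - P.k * s ^ 2 / 2) ≤ R * s := by
        have : 0 ≤ P.k * s ^ 2 := by positivity
        nlinarith
      have h2 : R * s ≤ 2 * P.rad s * P.rad R := by
        apply le_of_sq_le_sq_of_nonneg _ (by have := P.rad_nonneg hs.le; have := P.rad_nonneg hR0; positivity)
        have e : (2 * P.rad s * P.rad R) ^ 2 = 4 * P.rad s ^ 2 * P.rad R ^ 2 := by ring
        rw [e, P.rad_sq (by linarith), P.rad_sq (by linarith)]
        have e1 : s ^ 2 / 2 ≤ s ^ 2 - P.k * s ^ 4 / 4 := by nlinarith [sq_nonneg s]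
        have e2 : R ^ 2 / 2 ≤ R ^ 2 - P.k * R ^ 4 / 4 := by nlinarith [sq_nonneg R]
        have := mul_le_mul e1 e2 (by positivity) (by nlinarith [sq_nonneg s])
        nlinarith
      exact h1.trans h2
    · rw [hc, h]
      have := P.rad_nonneg hs.le
      have := P.rad_nonneg hR0
      simp only [hd]
      ring_nf
      positivity
  have hd0 : 0 ≤ d := hc0.trans hcd
  obtain ⟨θ, hθ⟩ : ∃ θ, d * Real.cos (θ - φ) = c := by
    refine ⟨Real.arccos (c / d) + φ, ?_⟩
    rw [add_sub_cancel_right, Real.cos_arccos]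
    · rcases hd0.eq_or_lt with h0 | h0
      · rw [← h0]; linarith
      · field_simp
    · have : 0 ≤ c / d := div_nonneg hc0 hd0
      linarith
    · exact div_le_one_of_le₀ hcd hd0
  refine ⟨P.Φ p s θ, P.dist_polar' p θ hs.le (by linarith), ?_⟩
  have h2 := P.dist_sq p θ φ hs.le hR0 (by linarith) hR
  rw [hq] at h2
  have : dist (P.Φ p s θ) q ^ 2 = s ^ 2 := by
    rw [h2]; linear_combination - hθ
  exact (pow_left_inj₀ dist_nonneg hs.le two_ne_zero).1 this

/-- A circle contains points at distance at least its radius from a given point. -/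
lemma exists_far_on_sphere (x p : M) {s : ℝ} (hs : 0 ≤ s) (hs2 : P.k * s ^ 2 ≤ 3) :
    ∃ z, dist x z = s ∧ s / 2 ≤ dist p z := by
  have h := P.dist_sq_same x Real.pi 0 hs (by linarith)
  rw [sub_zero, Real.sin_pi_div_two] at h
  have h1 := P.half_le_rad hs hs2
  have h2 : s ≤ dist (P.Φ x s Real.pi) (P.Φ x s 0) := by
    apply le_of_sq_le_sq_of_nonneg _ dist_nonneg
    rw [h]
    nlinarith
  have h3 := dist_triangle_left (P.Φ x s Real.pi) (P.Φ x s 0) p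
  rcases le_total (s / 2) (dist p (P.Φ x s Real.pi)) with h4 | h4
  · exact ⟨_, P.dist_polar x _ hs (by linarith), h4⟩
  · exact ⟨_, P.dist_polar x 0 hs (by linarith), by linarith⟩

end PolarSpace


/-! ### Connectedness, lifting of maps to the circle, unicoherence -/

namespace PolarSpace

variable {M : Type*} [MetricSpace M] (P : PolarSpace M)

lemma closedBall_subset_sector (x : M) (s : ℝ) :
    Metric.closedBall x s ⊆
      (fun p : ℝ × ℝ => P.Φ x p.1 p.2) '' (Icc 0 s ×ˢ Icc 0 (2 * Real.pi)) := by
  intro z hz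
  obtain ⟨θ, hθ, hz'⟩ := P.exists_angle x z 0
  refine ⟨(dist x z, θ), ⟨⟨dist_nonneg, by rw [dist_comm]; exact hz⟩, hθ.1, ?_⟩, hz'⟩
  linarith [hθ.2]

lemma setOf_dist_mem_eq_image (a : M) (I : Set ℝ) :
    {z | dist a z ∈ I} = (fun p : ℝ × ℝ => P.Φ a p.1 p.2) ''
      ((I ∩ {r | 0 ≤ r ∧ P.k * r ^ 2 ≤ 4}) ×ˢ univ) := by
  ext z
  simp only [mem_ofPred_eq, mem_image, mem_prod, mem_inter_iff, mem_univ, and_true, Prod.exists]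
  constructor
  · intro h
    obtain ⟨θ, -, hθ⟩ := P.exists_angle a z 0
    exact ⟨_, θ, ⟨h, dist_nonneg, P.dist_bound a z⟩, hθ⟩
  · rintro ⟨r, θ, ⟨h, h0, h1⟩, rfl⟩
    rwa [P.dist_polar a θ h0 h1]

lemma ordConnected_radii : ({r | 0 ≤ r ∧ P.k * r ^ 2 ≤ 4} : Set ℝ).OrdConnected := by
  refine ⟨fun x hx y hy z hz => ⟨hx.1.trans hz.1, le_trans ?_ hy.2⟩⟩
  exact mul_le_mul_of_nonneg_left (pow_le_pow_left₀ (hx.1.trans hz.1) hz.2 2) P.k_nonneg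

/-- Annuli, discs and circles are connected. -/
lemma isPreconnected_setOf_dist_mem (P : PolarSpace M) (a : M) {I : Set ℝ} (hI : I.OrdConnected) :
    IsPreconnected {z | dist a z ∈ I} := by
  rw [P.setOf_dist_mem_eq_image a I]
  apply IsPreconnected.image _ _ (P.continuous_polar a).continuousOn
  exact (hI.inter P.ordConnected_radii).isPreconnected.prod isPreconnected_univ

lemma isPathConnected_ball (P : PolarSpace M) (a : M) {s : ℝ} (hs : 0 < s) :
    IsPathConnected (Metric.ball a s) := by
  have : Metric.ball a s = {z | dist a z ∈ Iio s} := by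
    ext z; simp [dist_comm]
  rw [this, P.setOf_dist_mem_eq_image a]
  refine IsPathConnected.image ?_ (P.continuous_polar a)
  apply Convex.isPathConnected
  · exact ((ordConnected_Iio.inter P.ordConnected_radii).convex).prod convex_univ
  · exact ⟨(0, 0), by simp [hs]⟩

lemma locallyPathConnectedSpace (P : PolarSpace M) : LocallyPathConnectedSpace M :=
  .of_bases (fun _ => Metric.nhds_basis_ball) fun x _ h => P.isPathConnected_ball x h

lemma preconnectedSpace (P : PolarSpace M) : PreconnectedSpace M := by
  refine ⟨isPreconnected_of_forall_pair fun a _ b _ => ⟨{z | dist a z ∈ univ}, ?_, ?_, ?_, ?_⟩⟩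
  · simp
  · simp
  · simp
  · exact P.isPreconnected_setOf_dist_mem a ordConnected_univ

/-- Every continuous map to the circle lifts to the line. -/
lemma exists_lift_circle (P : PolarSpace M) [Nonempty M] (φ : C(M, Circle)) :
    ∃ g : C(M, ℝ), ∀ z, Circle.exp (g z) = φ z := by
  obtain ⟨a⟩ := ‹Nonempty M›
  -- Pull `φ` back to the simply connected plane of the pairs `(r, θ)` and lift it there. It remains
  -- to see that the lift depends only on the point that `(r, θ)` represents.
  let F : C(ℝ × ℝ, Circle) := φ.comp ⟨_, P.continuous_polar a⟩
  obtain ⟨e₀, he₀⟩ : ∃ e₀, Circle.exp e₀ = F 0 := ⟨_, Circle.exp_arg (F 0)⟩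
  obtain ⟨Θ, ⟨-, hΘ⟩, -⟩ := Circle.isCoveringMap_exp.existsUnique_continuousMap_lifts F 0 e₀ he₀
  have hΘ' : ∀ r θ, Circle.exp (Θ (r, θ)) = φ (P.Φ a r θ) := fun r θ => congrFun hΘ (r, θ)
  have hconst : ∀ r θ θ', (∀ x, P.Φ a r x = P.Φ a r θ') → Θ (r, θ) = Θ (r, θ') := by
    intro r θ θ' h
    refine Circle.isCoveringMap_exp.eqOn_of_comp_eqOn (s := univ) (g₁ := fun x => Θ (r, x))
      (g₂ := fun _ => Θ (r, θ')) isPreconnected_univ (by fun_prop) (by fun_prop) ?_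
      (mem_univ θ') rfl (mem_univ θ)
    intro x _
    simp only [Function.comp_apply, hΘ', h x]
  have hinv : ∀ r θ θ', 0 ≤ r → P.k * r ^ 2 ≤ 4 → P.Φ a r θ = P.Φ a r θ' →
      Θ (r, θ) = Θ (r, θ') := by
    intro r θ θ' h0 h1 h
    -- On a degenerate circle the lift is constant in the angle. Otherwise the angles differ by a
    -- multiple of `2π`, and the lifts along the two radial segments agree at radius `0`, hence
    -- everywhere.
    by_cases hr : P.rad r = 0
    · apply hconst
      intro x
      have := P.dist_sq_same a x θ' h0 h1
      rw [hr] at this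
      simpa using this
    · have h2 := P.dist_sq_same a θ θ' h0 h1
      rw [h, dist_self] at h2
      have h3 : Real.sin ((θ - θ') / 2) = 0 := by
        simpa [hr] using h2
      obtain ⟨n, hn⟩ := Real.sin_eq_zero_iff.1 h3
      have hθ : θ = θ' + n * (2 * Real.pi) := by linarith
      subst hθ
      refine Circle.isCoveringMap_exp.eqOn_of_comp_eqOn (s := Icc 0 r)
        (g₁ := fun x => Θ (x, θ' + n * (2 * Real.pi)))
        (g₂ := fun x => Θ (x, θ')) isPreconnected_Icc (by fun_prop) (by fun_prop) ?_
        (left_mem_Icc.2 h0) ?_ (right_mem_Icc.2 h0)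
      · intro x hx
        have hx1 : P.k * x ^ 2 ≤ 4 :=
          (mul_le_mul_of_nonneg_left (pow_le_pow_left₀ hx.1 hx.2 2) P.k_nonneg).trans h1
        simp only [Function.comp_apply, hΘ', P.polar_add_int a θ' n hx.1 hx1]
      · exact hconst _ _ _ fun x => by rw [P.polar_zero, P.polar_zero]
  choose ang hang hang' using fun z => P.exists_angle a z 0
  let g : M → ℝ := fun z => Θ (dist a z, ang z)
  have hg : Continuous g := by
    rw [continuous_iff_seqContinuous]
    intro u z hu
    apply Filter.tendsto_of_subseq_tendsto
    intro ns hns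
    -- The chosen angle is not continuous, but it ranges in a compact interval: along a subsequence
    -- it converges to some angle of the limit point, and any such angle gives the same value of the
    -- lift.
    obtain ⟨θ, -, ψ, hψ, hlim⟩ := (isCompact_Icc (a := (0 : ℝ)) (b := 0 + 2 * Real.pi)).tendsto_subseq
      (x := fun n => ang (u (ns n))) fun n => Ico_subset_Icc_self (hang _)
    refine ⟨ψ, ?_⟩
    have h1 : Filter.Tendsto (fun n => u (ns (ψ n))) Filter.atTop (nhds z) :=
      hu.comp (hns.comp hψ.tendsto_atTop)
    have h2 : Filter.Tendsto (fun n => dist a (u (ns (ψ n)))) Filter.atTop (nhds (dist a z)) :=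
      tendsto_const_nhds.dist h1
    have h3 := h2.prodMk_nhds hlim
    have h4 : P.Φ a (dist a z) θ = z := by
      refine tendsto_nhds_unique (((P.continuous_polar a).tendsto _).comp h3) ?_
      refine h1.congr fun n => ?_
      simp [hang']
    have h5 : g z = Θ (dist a z, θ) :=
      hinv _ _ _ dist_nonneg (P.dist_bound a z) (by rw [h4, hang'])
    rw [h5]
    exact (Θ.continuous.tendsto _).comp h3
  refine ⟨⟨g, hg⟩, fun z => ?_⟩
  simp only [ContinuousMap.coe_mk, g, hΘ', hang']

/-- Unicoherence. -/
theorem isPreconnected_inter_of_union_eq_univ (P : PolarSpace M) {A B : Set M}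
    (hA : IsClosed A) (hB : IsClosed B) (hA' : IsPreconnected A) (hB' : IsPreconnected B) (hAB : A ∪ B = univ) :
    IsPreconnected (A ∩ B) := by
  rw [isPreconnected_iff_subset_of_fully_disjoint_closed (hA.inter hB)]
  intro u v hu hv huv hd
  by_contra! hcon
  obtain ⟨⟨y, hyAB, hyu⟩, ⟨x, hxAB, hxv⟩⟩ :=
    And.intro (not_subset.1 hcon.1) (not_subset.1 hcon.2)
  have hxu : x ∈ u := (huv hxAB).resolve_right hxv
  have hyv : y ∈ v := (huv hyAB).resolve_left hyu
  have : Nonempty M := ⟨x⟩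
  obtain ⟨f, hfu, hfv, -⟩ := exists_continuous_zero_one_of_isClosed hu hv hd
  classical
  -- `f` separates the two supposed pieces of `A ∩ B`. The half turns `exp (iπf)` and `exp (-iπf)`
  -- agree where `f` is `0` or `1`, so they glue to a continuous map.
  let φ : M → Circle := fun z => if z ∈ A then Circle.exp (Real.pi * f z)
    else Circle.exp (- (Real.pi * f z))
  have hφA : ∀ z ∈ A, φ z = Circle.exp (Real.pi * f z) := fun z hz => if_pos hz
  have hφB : ∀ z ∈ B, φ z = Circle.exp (- (Real.pi * f z)) := by
    intro z hz
    by_cases hzA : z ∈ A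
    · rw [hφA z hzA]
      rcases huv ⟨hzA, hz⟩ with h | h
      · rw [hfu h]; simp
      · rw [hfv h]
        rw [← Circle.exp_sub_two_pi]
        congr 1
        simp only [Pi.one_apply]
        ring
    · exact if_neg hzA
  have hφ : Continuous φ := by
    rw [← continuousOn_univ, ← hAB]
    refine ContinuousOn.union_of_isClosed ?_ ?_ hA hB
    · exact ContinuousOn.congr (by fun_prop) hφA
    · exact ContinuousOn.congr (by fun_prop) hφB
  obtain ⟨g, hg⟩ := P.exists_lift_circle ⟨φ, hφ⟩
  have hgx : Circle.exp (g x) = 1 := by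
    rw [hg]
    simp only [ContinuousMap.coe_mk]
    rw [hφA x hxAB.1, hfu hxu]; simp
  -- By uniqueness of lifts on the connected sets `A` and `B`, the lift increases by `π` from `x` to
  -- `y` along `A` and decreases by `π` along `B`.
  have h1 : g y = g x + Real.pi * f y := by
    refine Circle.isCoveringMap_exp.eqOn_of_comp_eqOn (g₁ := g)
      (g₂ := fun z => g x + Real.pi * f z) hA' (by fun_prop) (by fun_prop) ?_ hxAB.1 ?_ hyAB.1
    · intro z hz
      simp only [Function.comp_apply, Circle.exp_add, hgx, one_mul]
      rw [hg, ContinuousMap.coe_mk, hφA z hz]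
    · simp [hfu hxu]
  have h2 : g y = g x + - (Real.pi * f y) := by
    refine Circle.isCoveringMap_exp.eqOn_of_comp_eqOn (g₁ := g)
      (g₂ := fun z => g x + - (Real.pi * f z)) hB' (by fun_prop) (by fun_prop) ?_ hxAB.2 ?_ hyAB.2
    · intro z hz
      simp only [Function.comp_apply, Circle.exp_add, hgx, one_mul]
      rw [hg, ContinuousMap.coe_mk, hφB z hz]
    · simp [hfu hxu]
  rw [hfv hyv] at h1 h2
  have := Real.pi_pos
  simp at h1 h2
  linarith

end PolarSpace

/-! ### Round discs and their complements -/

/-- A closed disc (`sign = 1`) or the complement of an open disc (`sign = -1`). -/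
structure Disk (M : Type*) where
  center : M
  radius : ℝ
  sign : ℝ

namespace Disk

variable {M : Type*} [MetricSpace M] (d : Disk M)

/-- The signed distance function of a disc, negative inside. -/
def height (z : M) : ℝ := d.sign * (dist z d.center - d.radius)

/-- The points of a disc. -/
def carrier : Set M := {z | d.height z ≤ 0}

/-- The complementary disc. -/
def flip : Disk M := ⟨d.center, d.radius, -d.sign⟩

lemma height_flip (z : M) : d.flip.height z = - d.height z := by simp [flip, height]

lemma continuous_height : Continuous d.height := by unfold height; fun_prop

lemma isClosed_carrier : IsClosed d.carrier := isClosed_le d.continuous_height continuous_const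

end Disk

namespace PolarSpace

variable {M : Type*} [MetricSpace M] (P : PolarSpace M)

/-- The radius of a round disc is positive and, on the sphere, at most that of a hemisphere. -/
structure IsRound (d : Disk M) : Prop where
  pos : 0 < d.radius
  le : P.k * d.radius ^ 2 ≤ 2
  sign : d.sign = 1 ∨ d.sign = -1

variable {P} {d : Disk M}

lemma IsRound.flip (h : P.IsRound d) : P.IsRound d.flip :=
  ⟨h.pos, h.le, by rcases h.sign with h | h <;> simp [Disk.flip, h]⟩

lemma IsRound.height_sub_le (h : P.IsRound d) (z w : M) : d.height z - d.height w ≤ dist z w := by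
  have h1 := dist_triangle z w d.center
  have h2 := dist_triangle w z d.center
  rw [dist_comm w z] at h2
  unfold Disk.height
  rcases h.sign with h | h <;> rw [h] <;> linarith

lemma IsRound.height_eq_zero (h : P.IsRound d) {z : M} :
    d.height z = 0 ↔ z ∈ Metric.sphere d.center d.radius := by
  unfold Disk.height
  rcases h.sign with h | h <;> rw [h] <;> simp [sub_eq_zero]
  rw [eq_comm]

/-- Points outside a disc are close to points which are well outside it. -/
lemma IsRound.exists_corkscrew (h : P.IsRound d) {z : M} (hz : 0 ≤ d.height z) {σ : ℝ} (hσ : 0 ≤ σ)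
    (hk : P.k * σ ^ 2 ≤ 1 / 100) (hs : d.sign = -1 → 4 * σ ≤ d.radius) :
    ∃ p, dist z p ≤ 2 * σ ∧ σ ≤ d.height p := by
  by_cases hzσ : σ ≤ d.height z
  · exact ⟨z, by simpa using hσ, hzσ⟩
  push Not at hzσ
  -- Move `z` radially by `σ`, outward for a disc and inward for an exterior disc. In the latter
  -- case the free region is a ball, which has to be large against `σ`.
  obtain ⟨θ, -, hθ⟩ := P.exists_angle d.center z 0
  set R := dist d.center z with hR
  have hR0 : 0 ≤ R := dist_nonneg
  have hk0 := P.k_nonneg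
  have hr := h.pos
  have hle := h.le
  rcases h.sign with hsg | hsg
  · simp only [Disk.height, hsg, one_mul, dist_comm z, ← hR] at hz hzσ
    have h1 : P.k * (R + σ) ^ 2 ≤ 3 := by
      have : P.k * (R + σ) ^ 2 ≤ P.k * (d.radius + 2 * σ) ^ 2 := by
        exact mul_le_mul_of_nonneg_left (pow_le_pow_left₀ (by linarith) (by linarith) 2) hk0
      rcases P.k_eq with hk' | hk'
      · rw [hk']; norm_num
      · rw [hk'] at this hk hle ⊢
        have e1 : σ ≤ 1 / 10 := by nlinarith
        have e2 : d.radius ≤ 3 / 2 := by nlinarith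
        nlinarith
    have h0 : P.k * R ^ 2 ≤ 3 := le_trans (by gcongr; linarith) h1
    refine ⟨P.Φ d.center (R + σ) θ, ?_, ?_⟩
    · have := P.dist_radial_le d.center θ hR0 (show 0 ≤ R + σ by linarith) h0 h1
      rw [hθ] at this
      rwa [show R - (R + σ) = -σ by ring, abs_neg, abs_of_nonneg hσ] at this
    · simp only [Disk.height, hsg, one_mul]
      rw [P.dist_polar' _ _ (by linarith) (by linarith)]
      linarith
  · simp only [Disk.height, hsg, dist_comm z, ← hR] at hz hzσ
    have h4 := hs hsg
    have h0 : P.k * R ^ 2 ≤ 3 := by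
      have : P.k * R ^ 2 ≤ P.k * d.radius ^ 2 := by gcongr; linarith
      linarith
    have hRσ : 0 ≤ R - σ := by linarith
    have h1 : P.k * (R - σ) ^ 2 ≤ 3 := le_trans (by gcongr; linarith) h0
    refine ⟨P.Φ d.center (R - σ) θ, ?_, ?_⟩
    · have := P.dist_radial_le d.center θ hR0 hRσ h0 h1
      rw [hθ] at this
      rwa [show R - (R - σ) = σ by ring, abs_of_nonneg hσ] at this
    · simp only [Disk.height, hsg]
      rw [P.dist_polar' _ _ (by linarith) (by linarith)]
      linarith

/-- Cosine falls and then rises on `[0, 2π]`. With its counterpart on `[-π, π]`, this turns the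
condition of missing a disc into an interval of angles. -/
lemma cos_le_max {a b x : ℝ} (ha : 0 ≤ a) (hb : b ≤ 2 * Real.pi) (hx : x ∈ Icc a b) :
    Real.cos x ≤ max (Real.cos a) (Real.cos b) := by
  rcases le_total x Real.pi with h | h
  · exact le_max_of_le_left (Real.cos_le_cos_of_nonneg_of_le_pi ha h hx.1)
  · apply le_max_of_le_right
    rw [← Real.cos_two_pi_sub x, ← Real.cos_two_pi_sub b]
    exact Real.cos_le_cos_of_nonneg_of_le_pi (by linarith) (by linarith) (by linarith [hx.2])

lemma min_le_cos {a b x : ℝ} (ha : -Real.pi ≤ a) (hb : b ≤ Real.pi) (hx : x ∈ Icc a b) :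
    min (Real.cos a) (Real.cos b) ≤ Real.cos x := by
  rcases le_total 0 x with h | h
  · exact min_le_of_right_le (Real.cos_le_cos_of_nonneg_of_le_pi h hb hx.2)
  · apply min_le_of_left_le
    rw [← Real.cos_neg x, ← Real.cos_neg a]
    exact Real.cos_le_cos_of_nonneg_of_le_pi (by linarith) (by linarith) (by linarith [hx.1])

/-- A circle minus a round disc is an arc. -/
lemma IsRound.exists_arc (h : P.IsRound d) {x u v : M} {r : ℝ} (hu : dist x u = r)
    (hv : dist x v = r) (hud : u ∉ d.carrier) (hvd : v ∉ d.carrier) :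
    ∃ θ₁ ∈ Icc (-(2 * Real.pi)) (4 * Real.pi), ∃ θ₂ ∈ Icc (-(2 * Real.pi)) (4 * Real.pi),
      P.Φ x r θ₁ = u ∧ P.Φ x r θ₂ = v ∧ ∀ θ ∈ uIcc θ₁ θ₂, P.Φ x r θ ∉ d.carrier := by
  have hr0 : 0 ≤ r := hu ▸ dist_nonneg
  have hrk : P.k * r ^ 2 ≤ 4 := hu ▸ P.dist_bound x u
  have hp := Real.pi_pos
  obtain ⟨φ, hφ, hb⟩ := P.exists_angle x d.center 0
  set R := dist x d.center
  set α := r ^ 2 + R ^ 2 - P.k * r ^ 2 * R ^ 2 / 2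
  set β := 2 * P.rad r * P.rad R with hβdef
  have hβ : 0 ≤ β := by
    have := P.rad_nonneg hr0; have := P.rad_nonneg (dist_nonneg : 0 ≤ R); positivity
  -- The squared distance to the centre of the disc is `α - β cos (θ - φ)`. Angles are taken in a
  -- period starting at `φ` for a disc and in one centred at `φ` for an exterior disc, so that the
  -- admissible angles form an interval. As `φ` lies in `[0, 2π)`, all angles stay in `[-2π, 4π]`.
  have hf : ∀ θ, dist (P.Φ x r θ) d.center ^ 2 = α - β * Real.cos (θ - φ) := by
    intro θ
    have := P.dist_sq x θ φ hr0 (dist_nonneg : 0 ≤ R) hrk (P.dist_bound _ _)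
    rwa [hb] at this
  have hrad := h.pos
  simp only [Disk.carrier, mem_ofPred_eq, Disk.height] at hud hvd ⊢
  rcases h.sign with hs | hs
  · rw [hs] at hud hvd ⊢
    obtain ⟨θ₁, h₁, e₁⟩ := P.exists_angle x u φ
    obtain ⟨θ₂, h₂, e₂⟩ := P.exists_angle x v φ
    rw [hu] at e₁; rw [hv] at e₂
    simp only [mem_Icc, mem_Ico] at *
    refine ⟨θ₁, ⟨by linarith, by linarith⟩, θ₂, ⟨by linarith, by linarith⟩, e₁, e₂, fun θ hθ => ?_⟩
    have key : d.radius ^ 2 < α - β * Real.cos (θ - φ) := by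
      have k1 : d.radius ^ 2 < α - β * Real.cos (θ₁ - φ) := by
        rw [← hf, e₁]; nlinarith
      have k2 : d.radius ^ 2 < α - β * Real.cos (θ₂ - φ) := by
        rw [← hf, e₂]; nlinarith
      have hc : Real.cos (θ - φ) ≤ max (Real.cos (θ₁ - φ)) (Real.cos (θ₂ - φ)) := by
        rcases le_total θ₁ θ₂ with hle | hle
        · rw [uIcc_of_le hle] at hθ
          exact cos_le_max (by linarith) (by linarith) ⟨by linarith [hθ.1], by linarith [hθ.2]⟩
        · rw [uIcc_of_ge hle] at hθ
          rw [max_comm]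
          exact cos_le_max (by linarith) (by linarith) ⟨by linarith [hθ.1], by linarith [hθ.2]⟩
      rcases le_max_iff.1 hc with hc | hc
      · linarith [mul_le_mul_of_nonneg_left hc hβ]
      · linarith [mul_le_mul_of_nonneg_left hc hβ]
    rw [← hf] at key
    have := lt_of_pow_lt_pow_left₀ 2 dist_nonneg key
    linarith
  · rw [hs] at hud hvd ⊢
    obtain ⟨θ₁, h₁, e₁⟩ := P.exists_angle x u (φ - Real.pi)
    obtain ⟨θ₂, h₂, e₂⟩ := P.exists_angle x v (φ - Real.pi)
    rw [hu] at e₁; rw [hv] at e₂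
    simp only [mem_Icc, mem_Ico] at *
    refine ⟨θ₁, ⟨by linarith, by linarith⟩, θ₂, ⟨by linarith, by linarith⟩, e₁, e₂, fun θ hθ => ?_⟩
    have key : α - β * Real.cos (θ - φ) < d.radius ^ 2 := by
      have k1 : α - β * Real.cos (θ₁ - φ) < d.radius ^ 2 := by
        rw [← hf, e₁]
        exact pow_lt_pow_left₀ (by linarith) dist_nonneg two_ne_zero
      have k2 : α - β * Real.cos (θ₂ - φ) < d.radius ^ 2 := by
        rw [← hf, e₂]
        exact pow_lt_pow_left₀ (by linarith) dist_nonneg two_ne_zero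
      have hc : min (Real.cos (θ₁ - φ)) (Real.cos (θ₂ - φ)) ≤ Real.cos (θ - φ) := by
        rcases le_total θ₁ θ₂ with hle | hle
        · rw [uIcc_of_le hle] at hθ
          exact min_le_cos (by linarith) (by linarith) ⟨by linarith [hθ.1], by linarith [hθ.2]⟩
        · rw [uIcc_of_ge hle] at hθ
          rw [min_comm]
          exact min_le_cos (by linarith) (by linarith) ⟨by linarith [hθ.1], by linarith [hθ.2]⟩
      rcases min_le_iff.1 hc with hc | hc
      · linarith [mul_le_mul_of_nonneg_left hc hβ]
      · linarith [mul_le_mul_of_nonneg_left hc hβ]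
    rw [← hf] at key
    have := lt_of_pow_lt_pow_left₀ 2 hrad.le key
    linarith

end PolarSpace


/-! ### Complementary components and boundary components of a circle domain -/

variable {M : Type*}

lemma eq_of_mem_componentsOf [TopologicalSpace M] {A K K' : Set M} (hK : K ∈ componentsOf A)
    (hK' : K' ∈ componentsOf A) {z : M} (hz : z ∈ K) (hz' : z ∈ K') : K = K' := by
  obtain ⟨x, -, rfl⟩ := hK
  obtain ⟨y, -, rfl⟩ := hK'
  rw [connectedComponentIn_eq hz, connectedComponentIn_eq hz']

lemma subset_of_mem_componentsOf [TopologicalSpace M] {A K : Set M} (hK : K ∈ componentsOf A) :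
    K ⊆ A := by
  obtain ⟨x, -, rfl⟩ := hK
  exact connectedComponentIn_subset _ _

lemma isConnected_of_mem_componentsOf [TopologicalSpace M] {A K : Set M}
    (hK : K ∈ componentsOf A) : IsConnected K := by
  obtain ⟨x, hx, rfl⟩ := hK
  exact isConnected_connectedComponentIn_iff.2 hx

lemma exists_mem_componentsOf [TopologicalSpace M] {A : Set M} {x : M} (hx : x ∈ A) :
    ∃ K ∈ componentsOf A, x ∈ K :=
  ⟨_, ⟨x, hx, rfl⟩, mem_connectedComponentIn hx⟩

lemma isClosed_of_mem_componentsOf [TopologicalSpace M] {A K : Set M} (hA : IsClosed A)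
    (hK : K ∈ componentsOf A) : IsClosed K := by
  obtain ⟨x, hx, rfl⟩ := hK
  refine isClosed_of_closure_subset ?_
  exact (isPreconnected_connectedComponentIn.closure).subset_connectedComponentIn
    (subset_closure (mem_connectedComponentIn hx))
    (closure_minimal (connectedComponentIn_subset _ _) hA)

/-- A connected set that misses the frontier cannot pass from the exterior of `Q` to its interior.
Applied later to the outer side of a disc, it confines a complementary component to the disc. -/
lemma subset_compl_of_disjoint_frontier [TopologicalSpace M] {S Q : Set M} (hS : IsPreconnected S)
    (hQ : IsClosed Q) (hd : Disjoint S (frontier Q)) (hne : (S ∩ Qᶜ).Nonempty) : S ⊆ Qᶜ := by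
  have h : S ⊆ Qᶜ ∪ interior Q := by
    intro z hz
    by_cases hzQ : z ∈ Q
    · right
      by_contra hzi
      exact hd.le_bot ⟨hz, by rw [frontier, hQ.closure_eq]; exact ⟨hzQ, hzi⟩⟩
    · exact Or.inl hzQ
  refine hS.subset_left_of_subset_union hQ.isOpen_compl isOpen_interior ?_ h hne
  exact disjoint_compl_left.mono_right interior_subset

section Domain

variable [MetricSpace M] {Ω : Set M}

/-- By local connectedness, a component of `Ωᶜ` through an interior point of `Ωᶜ` is a neighbourhood
of that point. -/
lemma frontier_component_subset (P : PolarSpace M) (hΩ : IsOpen Ω) {Q : Set M}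
    (hQ : Q ∈ componentsOf Ωᶜ) : frontier Q ⊆ frontier Ω := by
  have := P.locallyPathConnectedSpace
  have hQc := isClosed_of_mem_componentsOf hΩ.isClosed_compl hQ
  intro x hx
  have hxQ : x ∈ Q := hQc.closure_eq ▸ hx.1
  rw [← frontier_compl, frontier, hΩ.isClosed_compl.closure_eq]
  refine ⟨subset_of_mem_componentsOf hQ hxQ, fun hi => hx.2 ?_⟩
  have hQx : Q = connectedComponentIn Ωᶜ x := by
    obtain ⟨y, -, rfl⟩ := hQ
    exact connectedComponentIn_eq hxQ
  rw [mem_interior_iff_mem_nhds] at hi ⊢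
  rw [hQx]
  exact connectedComponentIn_mem_nhds hi

lemma frontier_component_nonempty (P : PolarSpace M) (hΩ : Ω.Nonempty) {Q : Set M}
    (hQ : Q ∈ componentsOf Ωᶜ) : (frontier Q).Nonempty := by
  have := P.preconnectedSpace
  rw [nonempty_frontier_iff]
  refine ⟨(isConnected_of_mem_componentsOf hQ).nonempty, fun h => ?_⟩
  obtain ⟨x, hx⟩ := hΩ
  exact subset_of_mem_componentsOf hQ (h ▸ mem_univ x) hx

/-- The complementary components of a domain have connected boundary. -/
lemma isPreconnected_frontier_component (P : PolarSpace M) (hΩ : IsOpen Ω) (hΩ' : IsConnected Ω)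
    {Q : Set M} (hQ : Q ∈ componentsOf Ωᶜ) : IsPreconnected (frontier Q) := by
  have hQc := isClosed_of_mem_componentsOf hΩ.isClosed_compl hQ
  -- `Qᶜ` is `Ω` together with the other complementary components, each of which is attached to `Ω`
  -- at a point of its frontier.
  have hcompl : IsPreconnected Qᶜ := by
    obtain ⟨ω, hω⟩ := hΩ'.nonempty
    have hΩQ : Ω ⊆ Qᶜ := fun x hx hxQ => subset_of_mem_componentsOf hQ hxQ hx
    refine isPreconnected_of_forall ω fun y hy => ?_
    by_cases hyΩ : y ∈ Ω
    · exact ⟨Ω, hΩQ, hω, hyΩ, hΩ'.isPreconnected⟩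
    obtain ⟨Q', hQ', hyQ'⟩ := exists_mem_componentsOf (A := Ωᶜ) hyΩ
    obtain ⟨q, hq⟩ := frontier_component_nonempty P hΩ'.nonempty hQ'
    have hqΩ := frontier_component_subset P hΩ hQ' hq
    have hqQ' : q ∈ Q' :=
      (isClosed_of_mem_componentsOf hΩ.isClosed_compl hQ').closure_eq ▸ hq.1
    have hQQ' : Q' ⊆ Qᶜ := fun x hx hxQ => hy (eq_of_mem_componentsOf hQ' hQ hx hxQ ▸ hyQ')
    have h1 : IsPreconnected (insert q Ω) := by
      refine hΩ'.isPreconnected.subset_closure (subset_insert _ _) ?_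
      exact insert_subset hqΩ.1 subset_closure
    refine ⟨insert q Ω ∪ Q', ?_, Or.inl (Or.inr hω), Or.inr hyQ', ?_⟩
    · exact union_subset (insert_subset (hQQ' hqQ') hΩQ) hQQ'
    · exact h1.union q (mem_insert _ _) hqQ'
        (isConnected_of_mem_componentsOf hQ').isPreconnected
  -- Unicoherence for `Q` and the closure of `Qᶜ`, whose intersection is the frontier of `Q`.
  have := P.isPreconnected_inter_of_union_eq_univ hQc (isClosed_closure (s := Qᶜ))
    (isConnected_of_mem_componentsOf hQ).isPreconnected hcompl.closure
    (by
      rw [eq_univ_iff_forall]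
      intro x
      by_cases h : x ∈ Q
      · exact Or.inl h
      · exact Or.inr (subset_closure h))
  rwa [frontier_eq_closure_inter_closure, hQc.closure_eq]

/-- Every circle has a centre with respect to which it is at most a great circle. -/
lemma IsCircle.exists_radius (P : PolarSpace M) {K : Set M} (hK : IsCircle K) :
    ∃ b r, 0 < r ∧ P.k * r ^ 2 ≤ 2 ∧ K = Metric.sphere b r := by
  obtain ⟨⟨u, hu, v, hv, huv⟩, p, r, rfl⟩ := hK
  have hu' : dist p u = r := by rw [dist_comm]; exact hu
  have hv' : dist p v = r := by rw [dist_comm]; exact hv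
  have hr0 : 0 < r := by
    rcases (hu' ▸ dist_nonneg : 0 ≤ r).eq_or_lt with h | h
    · rw [← h, dist_eq_zero] at hu' hv'
      exact absurd (hu'.symm.trans hv') huv
    · exact h
  rcases P.k_eq with hk | hk
  · exact ⟨p, r, hr0, by rw [hk]; norm_num, rfl⟩
  by_cases h2 : r ^ 2 ≤ 2
  · exact ⟨p, r, hr0, by rw [hk, one_mul]; exact h2, rfl⟩
  obtain ⟨b, hb⟩ := P.exists_antipode hk p
  have hb4 : r ^ 2 ≤ 4 := by
    have := P.dist_bound p u
    rwa [hk, one_mul, hu'] at this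
  have hne : r ^ 2 ≠ 4 := by
    intro h
    have h1 := hb u
    have h2 := hb v
    rw [hu', h, sub_self, sq_eq_zero_iff, dist_eq_zero] at h1
    rw [hv', h, sub_self, sq_eq_zero_iff, dist_eq_zero] at h2
    exact huv (h1.symm.trans h2)
  have h4 : 0 < 4 - r ^ 2 := sub_pos.2 (lt_of_le_of_ne hb4 hne)
  refine ⟨b, √(4 - r ^ 2), Real.sqrt_pos.2 h4, ?_, ?_⟩
  · rw [hk, one_mul, Real.sq_sqrt h4.le]; linarith
  · ext z
    rw [Metric.mem_sphere, Metric.mem_sphere, dist_comm z p, dist_comm z b]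
    have := hb z
    rw [eq_comm (a := dist b z), Real.sqrt_eq_iff_mul_self_eq h4.le dist_nonneg, ← sq, this]
    constructor
    · intro h; rw [h]
    · intro h
      have : dist p z ^ 2 = r ^ 2 := by linarith
      exact (pow_left_inj₀ dist_nonneg hr0.le two_ne_zero).1 this

lemma PolarSpace.IsRound.isPreconnected_height_pos {P : PolarSpace M} {d : Disk M}
    (h : P.IsRound d) : IsPreconnected {z | 0 < d.height z} := by
  rcases h.sign with hs | hs
  · convert P.isPreconnected_setOf_dist_mem d.center (ordConnected_Ioi (a := d.radius)) using 2
    ext z; simp [Disk.height, hs, dist_comm]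
  · convert P.isPreconnected_setOf_dist_mem d.center (ordConnected_Iio (a := d.radius)) using 2
    ext z; simp [Disk.height, hs, dist_comm]

lemma PolarSpace.IsRound.isPreconnected_carrier {P : PolarSpace M} {d : Disk M}
    (h : P.IsRound d) : IsPreconnected d.carrier := by
  rcases h.sign with hs | hs
  · convert P.isPreconnected_setOf_dist_mem d.center (ordConnected_Iic (a := d.radius)) using 1
    ext z; simp [Disk.height, Disk.carrier, hs, dist_comm]
  · convert P.isPreconnected_setOf_dist_mem d.center (ordConnected_Ici (a := d.radius)) using 1
    ext z; simp [Disk.height, Disk.carrier, hs, dist_comm]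

/-- The description of a circle domain by the disjoint round discs and the points that are
removed. -/
structure HullSystem (P : PolarSpace M) (Ω : Set M) where
  disk : boundaryCircles Ω → Disk M
  round : ∀ K, P.IsRound (disk K)
  sphere_eq : ∀ K : boundaryCircles Ω,
    (K : Set M) = Metric.sphere (disk K).center (disk K).radius
  height_pos : ∀ K, ∀ z ∈ Ω, 0 < (disk K).height z
  disjoint : Pairwise fun K K' => Disjoint (disk K).carrier (disk K').carrier
  cover : ∀ z, z ∉ Ω → {z} ∈ boundaryComponents Ω ∨ ∃ K, z ∈ (disk K).carrier
  countable : (boundaryComponents Ω).Countable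

/-- Being connected, `Ω` lies on one side of each boundary circle, and the disc is the other side. A
component of `Ωᶜ` has connected frontier, contained in one boundary component, and is therefore
confined to that point or to the disc of that circle. -/
theorem IsCountablyConnectedCircleDomain.exists_hullSystem (P : PolarSpace M)
    (hΩ : IsCountablyConnectedCircleDomain Ω) : Nonempty (HullSystem P Ω) := by
  have hfr : ∀ K ∈ boundaryComponents Ω, K ⊆ frontier Ω := fun K hK =>
    subset_of_mem_componentsOf hK
  have hfrΩ : Disjoint Ω (frontier Ω) := by
    rw [hΩ.isOpen.frontier_eq]; exact disjoint_sdiff_right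
  have hex : ∀ K : boundaryCircles Ω, ∃ d : Disk M, P.IsRound d ∧
      (K : Set M) = Metric.sphere d.center d.radius ∧ ∀ z ∈ Ω, 0 < d.height z := by
    rintro ⟨K, hK, hKc⟩
    obtain ⟨b, r, hr, hk, rfl⟩ := hKc.exists_radius P
    have hdis : Disjoint Ω (Metric.sphere b r) := hfrΩ.mono_right (hfr _ hK)
    have hsub : Ω ⊆ {z | dist z b < r} ∪ {z | r < dist z b} := fun z hz => by
      rcases lt_trichotomy (dist z b) r with h | h | h
      · exact Or.inl h
      · exact absurd (hdis.le_bot ⟨hz, h⟩) (by simp)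
      · exact Or.inr h
    have hd2 : Disjoint {z | dist z b < r} {z | r < dist z b} := by
      rw [disjoint_left]; intro z h1 h2; exact lt_asymm (mem_ofPred_eq.mp h1) (mem_ofPred_eq.mp h2)
    rcases hΩ.isConnected.isPreconnected.subset_or_subset
      (isOpen_lt (by fun_prop) (by fun_prop)) (isOpen_lt (by fun_prop) (by fun_prop)) hd2 hsub
      with h | h
    · refine ⟨⟨b, r, -1⟩, ⟨hr, hk, Or.inr rfl⟩, rfl, fun z hz => ?_⟩
      have : dist z b < r := h hz
      simp only [Disk.height]; linarith
    · refine ⟨⟨b, r, 1⟩, ⟨hr, hk, Or.inl rfl⟩, rfl, fun z hz => ?_⟩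
      have : r < dist z b := h hz
      simp only [Disk.height]; linarith
  choose D hD hsph hpos using hex
  have hcl : ∀ K, ∀ z ∈ closure Ω, 0 ≤ (D K).height z := fun K z hz =>
    closure_minimal (s := Ω) (t := {z | 0 ≤ (D K).height z}) (fun z hz => (hpos K z hz).le)
      (isClosed_le continuous_const (D K).continuous_height) hz
  have hpos' : ∀ (K : boundaryCircles Ω), ∀ K' ∈ boundaryComponents Ω, K' ≠ K → ∀ z ∈ K',
      0 < (D K).height z := by
    intro K K' hK' hne z hz
    refine lt_of_le_of_ne (hcl K z (hfr K' hK' hz).1) fun h => hne ?_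
    have : z ∈ (K : Set M) := by
      rw [hsph, ← (hD K).height_eq_zero]; exact h.symm
    exact eq_of_mem_componentsOf hK' K.2.1 hz this
  have hKcar : ∀ K : boundaryCircles Ω, (K : Set M) ⊆ (D K).carrier := by
    intro K z hz
    rw [hsph, ← (hD K).height_eq_zero] at hz
    exact hz.le
  -- The connected disc of `K` misses the circle `K'`, because `K'` lies strictly outside it. So it
  -- stays on one side of `K'`, the side that contains the circle `K`.
  have hdisj : Pairwise fun K K' => Disjoint (D K).carrier (D K').carrier := by
    intro K K' hne
    have hne' : (K' : Set M) ≠ K := fun h => hne (Subtype.ext h.symm)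
    have hsub : (D K).carrier ⊆ {z | 0 < (D K').height z} ∪ {z | (D K').height z < 0} := by
      intro z hz
      rcases lt_trichotomy ((D K').height z) 0 with h | h | h
      · exact Or.inr h
      · have : z ∈ (K' : Set M) := by rw [hsph, ← (hD K').height_eq_zero]; exact h
        exact absurd (hpos' K K' K'.2.1 hne' z this) (not_lt.2 hz)
      · exact Or.inl h
    have hd2 : Disjoint {z | 0 < (D K').height z} {z | (D K').height z < 0} := by
      rw [disjoint_left]; intro z h1 h2; exact lt_asymm (mem_ofPred_eq.mp h1) (mem_ofPred_eq.mp h2)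
    obtain ⟨x, hx⟩ := K.2.2.1.nonempty
    have := (hD K).isPreconnected_carrier.subset_left_of_subset_union
      (isOpen_lt continuous_const (D K').continuous_height)
      (isOpen_lt (D K').continuous_height continuous_const) hd2 hsub
      ⟨x, hKcar K hx, hpos' K' K K.2.1 hne'.symm x hx⟩
    rw [disjoint_left]
    intro z hz hz'
    exact absurd (mem_ofPred_eq.mp (this hz)) (not_lt.2 hz')
  have hQ : ∀ Q ∈ componentsOf Ωᶜ, (∃ x, {x} ∈ boundaryComponents Ω ∧ Q ⊆ {x}) ∨
      ∃ K, Q ⊆ (D K).carrier := by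
    intro Q hQ
    have hQc := isClosed_of_mem_componentsOf hΩ.isOpen.isClosed_compl hQ
    obtain ⟨q, hq⟩ := frontier_component_nonempty P hΩ.isConnected.nonempty hQ
    have hsub := frontier_component_subset P hΩ.isOpen hQ
    have hpre := isPreconnected_frontier_component P hΩ.isOpen hΩ.isConnected hQ
    set K := connectedComponentIn (frontier Ω) q with hKdef
    have hK : K ∈ boundaryComponents Ω := ⟨q, hsub hq, rfl⟩
    have hQK : frontier Q ⊆ K := hpre.subset_connectedComponentIn hq hsub
    obtain ⟨ω, hω⟩ := hΩ.isConnected.nonempty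
    have hωQ : ω ∈ Qᶜ := fun h => subset_of_mem_componentsOf hQ h hω
    rcases hΩ.point_or_circle K hK with ⟨x, hx⟩ | hc
    · left
      refine ⟨x, hx ▸ hK, ?_⟩
      have hωx : ω ≠ x := by
        rintro rfl
        exact hfrΩ.le_bot ⟨hω, hfr K hK (hx ▸ rfl)⟩
      have h1 := P.isPreconnected_setOf_dist_mem x (ordConnected_Ioi (a := (0 : ℝ)))
      have h2 := subset_compl_of_disjoint_frontier h1 hQc
        (by
          rw [disjoint_left]
          intro z hz hz'
          have : z = x := by simpa [hx] using hQK hz'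
          subst this
          simp at hz)
        ⟨ω, by simpa using hωx.symm, hωQ⟩
      intro z hz
      by_contra hzx
      exact h2 (show z ∈ {z | dist x z ∈ Ioi 0} by simpa [eq_comm] using hzx) hz
    · right
      refine ⟨⟨K, hK, hc⟩, ?_⟩
      have h2 := subset_compl_of_disjoint_frontier (hD ⟨K, hK, hc⟩).isPreconnected_height_pos hQc
        (by
          rw [disjoint_left]
          intro z hz hz'
          have hzK : z ∈ ((⟨K, hK, hc⟩ : boundaryCircles Ω) : Set M) := hQK hz'
          rw [hsph, ← (hD _).height_eq_zero] at hzK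
          exact absurd hzK (ne_of_gt hz))
        ⟨ω, hpos _ ω hω, hωQ⟩
      intro z hz
      by_contra hzx
      exact h2 (show z ∈ {z | 0 < (D ⟨K, hK, hc⟩).height z} from mem_ofPred_eq.mpr (not_le.1 hzx)) hz
  refine ⟨⟨D, hD, hsph, hpos, hdisj, ?_, ?_⟩⟩
  · intro z hz
    obtain ⟨Q, hQ', hzQ⟩ := exists_mem_componentsOf (A := Ωᶜ) hz
    rcases hQ Q hQ' with ⟨x, hx, hQx⟩ | ⟨K, hK⟩
    · left
      have : z = x := hQx hzQ
      rwa [this]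
    · exact Or.inr ⟨K, hK hzQ⟩
  · have hne : ∀ K : boundaryComponents Ω, ∃ z, z ∈ (K : Set M) := fun K =>
      (isConnected_of_mem_componentsOf K.2).nonempty
    choose p hp using hne
    have hpΩ : ∀ K, p K ∈ Ωᶜ := fun K h => hfrΩ.le_bot ⟨h, hfr K K.2 (hp K)⟩
    have hcount := hΩ.countable
    have := hcount.to_subtype
    -- Countability is inherited from the components of `Ωᶜ`: the one through a point of `K` lies in
    -- a single disc or point, which meets no other boundary component.
    let f : boundaryComponents Ω → componentsOf Ωᶜ := fun K =>
      ⟨connectedComponentIn Ωᶜ (p K), p K, hpΩ K, rfl⟩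
    have hf : Function.Injective f := by
      intro K K' h
      have hmem : ∀ K, p K ∈ (f K : Set M) := fun K => mem_connectedComponentIn (hpΩ K)
      rcases hQ (f K) (f K).2 with ⟨x, hx, hQx⟩ | ⟨C, hC⟩
      · have h1 : p K = x := hQx (hmem K)
        have h2 : p K' = x := hQx (h ▸ hmem K')
        exact Subtype.ext (eq_of_mem_componentsOf K.2 K'.2 (hp K) (by rw [h1, ← h2]; exact hp K'))
      · have h3 : ∀ K : boundaryComponents Ω, p K ∈ (D C).carrier → (K : Set M) = C := by
          intro K hK
          by_contra hne
          exact absurd (hpos' C K K.2 hne (p K) (hp K)) (not_lt.2 hK)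
        exact Subtype.ext ((h3 K (hC (hmem K))).trans (h3 K' (hC (h ▸ hmem K'))).symm)
    exact Set.countable_coe_iff.1 hf.countable

end Domain


/-! ### Area estimates -/

variable {M : Type*} [MetricSpace M] [MeasurableSpace M] [BorelSpace M]

/-- A measure which is comparable with the two-dimensional Hausdorff measure. -/
structure IsComparable (μ : Measure M) (C : ℝ≥0) : Prop where
  hausdorff_le : ∀ A, μH[2] A ≤ C * μ A
  le_hausdorff : ∀ A, μ A ≤ C * μH[2] A

/-- The inverse of `f` is `K`-Lipschitz on the image. This is how areas are bounded from below. -/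
lemma hausdorffMeasure_le_of_expanding {X : Type*} [MetricSpace X] [MeasurableSpace X]
    [BorelSpace X]
    {K : ℝ≥0} {f : X → M} {S : Set X} (h : ∀ p ∈ S, ∀ q ∈ S, dist p q ≤ K * dist (f p) (f q)) :
    μH[2] S ≤ K ^ 2 * μH[2] (f '' S) := by
  classical
  rcases S.eq_empty_or_nonempty with rfl | ⟨x₀, hx₀⟩
  · simp
  have : Nonempty X := ⟨x₀⟩
  have hinj : InjOn f S := by
    intro p hp q hq hpq
    have := h p hp q hq
    rw [hpq, dist_self, mul_zero] at this
    exact dist_le_zero.1 this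
  have hL : LipschitzOnWith K (Function.invFunOn f S) (f '' S) := by
    refine LipschitzOnWith.of_dist_le_mul ?_
    rintro _ ⟨p, hp, rfl⟩ _ ⟨q, hq, rfl⟩
    rw [hinj.leftInvOn_invFunOn hp, hinj.leftInvOn_invFunOn hq]
    exact h p hp q hq
  have := hL.hausdorffMeasure_image_le (d := 2) (by norm_num)
  rw [hinj.leftInvOn_invFunOn.image_image] at this
  simpa using this

namespace PolarSpace

variable (P : PolarSpace M) {μ : Measure M} {C : ℝ≥0}

/-- With the angle rescaled by `s`, polar coordinates are `3`-Lipschitz for the maximum metric of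
the parameter rectangle; hence the factor `9 = 3 ^ 2`. -/
lemma measure_sector_le (hμ : IsComparable μ C) (x : M) {r₁ r₂ s θ₁ θ₂ : ℝ} (h₁ : 0 ≤ r₁)
    (h₂ : r₂ ≤ s) (hs : 0 < s) (hk : P.k * s ^ 2 ≤ 3) :
    μ ((fun p : ℝ × ℝ => P.Φ x p.1 p.2) '' (Icc r₁ r₂ ×ˢ Icc θ₁ θ₂)) ≤
      C * (9 * (ENNReal.ofReal (r₂ - r₁) * ENNReal.ofReal (s * (θ₂ - θ₁)))) := by
  let f : ℝ × ℝ → M := fun p => P.Φ x p.1 (p.2 / s)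
  have himg : (fun p : ℝ × ℝ => P.Φ x p.1 p.2) '' (Icc r₁ r₂ ×ˢ Icc θ₁ θ₂) ⊆
      f '' (Icc r₁ r₂ ×ˢ Icc (s * θ₁) (s * θ₂)) := by
    rintro _ ⟨⟨r, θ⟩, ⟨hr, hθ⟩, rfl⟩
    refine ⟨(r, s * θ), ⟨hr, ?_, ?_⟩, ?_⟩
    · exact mul_le_mul_of_nonneg_left hθ.1 hs.le
    · exact mul_le_mul_of_nonneg_left hθ.2 hs.le
    · simp only [f]; rw [mul_div_cancel_left₀ _ hs.ne']
  have hkr : ∀ r ∈ Icc r₁ r₂, P.k * r ^ 2 ≤ 3 := fun r hr =>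
    (mul_le_mul_of_nonneg_left (pow_le_pow_left₀ (h₁.trans hr.1) (hr.2.trans h₂) 2)
      P.k_nonneg).trans hk
  have hL : LipschitzOnWith 3 f (Icc r₁ r₂ ×ˢ Icc (s * θ₁) (s * θ₂)) := by
    refine LipschitzOnWith.of_dist_le_mul ?_
    rintro ⟨r, t⟩ ⟨hr, -⟩ ⟨r', t'⟩ ⟨hr', -⟩
    simp only at hr hr'
    have h0 := h₁.trans hr.1
    have h0' := h₁.trans hr'.1
    have h := P.dist_sq_le x (t / s) (t' / s) h0 h0' (hkr r hr) (hkr r' hr')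
    refine le_of_sq_le_sq_of_nonneg (h.trans ?_) (by positivity)
    rw [Prod.dist_eq, Real.dist_eq, Real.dist_eq]
    set m := max |r - r'| |t - t'|
    have e1 : (r - r') ^ 2 ≤ m ^ 2 := by rw [← sq_abs]; gcongr; exact le_max_left _ _
    have e2 : (t - t') ^ 2 ≤ m ^ 2 := by rw [← sq_abs]; gcongr; exact le_max_right _ _
    have e3 : r * r' ≤ s ^ 2 := by
      rw [sq]; exact mul_le_mul (hr.2.trans h₂) (hr'.2.trans h₂) h0' hs.le
    have e4 : r * r' * (t / s - t' / s) ^ 2 ≤ (t - t') ^ 2 := by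
      rw [← sub_div, div_pow, ← mul_div_assoc, div_le_iff₀ (by positivity)]
      nlinarith [sq_nonneg (t - t')]
    rw [mul_pow]
    norm_num
    nlinarith [sq_nonneg m]
  have h2 := hL.hausdorffMeasure_image_le (d := 2) (by norm_num)
  rw [hausdorffMeasure_prod_real, Measure.volume_eq_prod, Measure.prod_prod, Real.volume_Icc,
    Real.volume_Icc, ← mul_sub] at h2
  calc _ ≤ μ (f '' (Icc r₁ r₂ ×ˢ Icc (s * θ₁) (s * θ₂))) := measure_mono himg
    _ ≤ C * μH[2] (f '' (Icc r₁ r₂ ×ˢ Icc (s * θ₁) (s * θ₂))) := hμ.le_hausdorff _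
    _ ≤ _ := by
      gcongr
      refine h2.trans (le_of_eq ?_)
      congr 1
      norm_num

/-- The area of a disc is at most quadratic in its radius. -/
lemma measure_closedBall_le (P : PolarSpace M) (hμ : IsComparable μ C) (x : M) {s : ℝ}
    (hs : 0 < s) :
    μ (Metric.closedBall x s) ≤ C * ENNReal.ofReal (150 * s ^ 2) := by
  have key : ∀ y : M, ∀ r, 0 < r → P.k * r ^ 2 ≤ 3 →
      μ (Metric.closedBall y r) ≤ C * ENNReal.ofReal (75 * r ^ 2) := by
    intro y r hr hk
    have h := P.measure_sector_le hμ y (r₁ := 0) (r₂ := r) (s := r) (θ₁ := 0) (θ₂ := 2 * Real.pi)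
      le_rfl le_rfl hr hk
    refine ((measure_mono (P.closedBall_subset_sector y r)).trans h).trans ?_
    gcongr
    rw [sub_zero, sub_zero, ← ENNReal.ofReal_mul hr.le,
      show (9 : ℝ≥0∞) = ENNReal.ofReal 9 by simp, ← ENNReal.ofReal_mul (by norm_num)]
    apply ENNReal.ofReal_le_ofReal
    have := Real.pi_lt_four
    nlinarith [sq_nonneg r]
  by_cases hk : P.k * s ^ 2 ≤ 3
  · refine (key x s hs hk).trans ?_
    gcongr
    norm_num
  · have hk1 : P.k = 1 := by
      rcases P.k_eq with h | h
      · rw [h] at hk; norm_num at hk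
      · exact h
    rw [hk1, one_mul, not_le] at hk
    -- For a radius near the diameter of the sphere, two hemispheres around `x` and its antipode
    -- cover everything.
    obtain ⟨b, hb⟩ := P.exists_antipode hk1 x
    have hsub : Metric.closedBall x s ⊆ Metric.closedBall x √2 ∪ Metric.closedBall b √2 := by
      intro z _
      simp only [mem_union, Metric.mem_closedBall, dist_comm z]
      have := hb z
      rcases le_total (dist x z ^ 2) 2 with h | h
      · left; exact Real.le_sqrt_of_sq_le h
      · right; exact Real.le_sqrt_of_sq_le (by linarith)
    have h2 : (0 : ℝ) < √2 := by positivity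
    have hk2 : P.k * √2 ^ 2 ≤ 3 := by rw [hk1]; norm_num
    refine (measure_mono hsub).trans ((measure_union_le _ _).trans ?_)
    refine (add_le_add (key x _ h2 hk2) (key b _ h2 hk2)).trans ?_
    rw [← mul_add, ← ENNReal.ofReal_add (by positivity) (by positivity)]
    gcongr
    norm_num
    nlinarith

/-- The region of the pairs `(r, t)` that parametrize by arclength an arc of opening `π` of the
circles of radius in `[s₁, s₂]`. -/
def arcRegion (s₁ s₂ θ₀ : ℝ) : Set (ℝ × ℝ) :=
  {p | p.1 ∈ Icc s₁ s₂ ∧ p.1 * θ₀ ≤ p.2 ∧ p.2 ≤ p.1 * (θ₀ + Real.pi)}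

/-- The arclength parametrization of the circles around `x`. -/
noncomputable def arcMap (x : M) (p : ℝ × ℝ) : M := P.Φ x p.1 (p.2 / p.1)

lemma measurable_arcMap (x : M) : Measurable (P.arcMap x) :=
  (P.continuous_polar x).measurable.comp (measurable_fst.prodMk (measurable_snd.div measurable_fst))

/-- A substitute for the coarea formula. On arcs of opening `π` the map `arcMap` contracts by at
most `25`, whence `625 = 25 ^ 2`. Longer arcs would bring distant parameters together, and the bound
on `θ₀` controls the shear caused by the coordinate `t = r * θ`. -/
lemma volume_arcRegion_inter_le (hμ : IsComparable μ C) (x : M) {s₁ s₂ θ₀ : ℝ} (h₁ : 0 < s₁)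
    (h₂ : s₂ ≤ 2 * s₁) (hk : P.k * s₂ ^ 2 ≤ 3) (hθ : |θ₀| ≤ 12) (A : Set M) :
    volume (arcRegion s₁ s₂ θ₀ ∩ P.arcMap x ⁻¹' A) ≤ 625 * (C * μ A) := by
  have hp := Real.pi_pos
  have hp4 := Real.pi_lt_four
  have hexp : ∀ p ∈ arcRegion s₁ s₂ θ₀ ∩ P.arcMap x ⁻¹' A,
      ∀ q ∈ arcRegion s₁ s₂ θ₀ ∩ P.arcMap x ⁻¹' A,
      dist p q ≤ (25 : ℝ≥0) * dist (P.arcMap x p) (P.arcMap x q) := by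
    rintro ⟨r, t⟩ ⟨⟨hr, ht, ht'⟩, -⟩ ⟨r', t'⟩ ⟨⟨hr', hu, hu'⟩, -⟩
    simp only at hr hr' ht ht' hu hu'
    have hr0 : 0 < r := h₁.trans_le hr.1
    have hr0' : 0 < r' := h₁.trans_le hr'.1
    have hkr : ∀ r ∈ Icc s₁ s₂, P.k * r ^ 2 ≤ 3 := fun r hr =>
      (mul_le_mul_of_nonneg_left (pow_le_pow_left₀ (h₁.le.trans hr.1) hr.2 2)
        P.k_nonneg).trans hk
    obtain ⟨θ, rfl⟩ : ∃ θ, t = r * θ := ⟨t / r, by field_simp⟩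
    obtain ⟨θ', rfl⟩ : ∃ θ', t' = r' * θ' := ⟨t' / r', by field_simp⟩
    have a1 : θ₀ ≤ θ := le_of_mul_le_mul_left ht hr0
    have a2 : θ ≤ θ₀ + Real.pi := le_of_mul_le_mul_left ht' hr0
    have a3 : θ₀ ≤ θ' := le_of_mul_le_mul_left hu hr0'
    have a4 : θ' ≤ θ₀ + Real.pi := le_of_mul_le_mul_left hu' hr0'
    simp only [arcMap]
    rw [mul_div_cancel_left₀ _ hr0.ne', mul_div_cancel_left₀ _ hr0'.ne']
    have h := P.dist_sq_ge x θ θ' hr0.le hr0'.le (hkr r hr) (hkr r' hr')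
    set δ := dist (P.Φ x r θ) (P.Φ x r' θ')
    have hδ : 0 ≤ δ := dist_nonneg
    have hsin := sin_lower (x := θ - θ') (abs_le.2 ⟨by linarith, by linarith⟩)
    have b1 : |r - r'| ≤ δ := by
      refine le_of_sq_le_sq_of_nonneg ?_ hδ
      rw [sq_abs]
      have : 0 ≤ r * r' * Real.sin ((θ - θ') / 2) ^ 2 := by positivity
      linarith
    have b2 : r * |θ - θ'| ≤ 8 * δ := by
      refine le_of_sq_le_sq_of_nonneg ?_ (by positivity)
      rw [mul_pow, sq_abs]
      have c1 : r ^ 2 ≤ 2 * (r * r') := by nlinarith [hr.2, hr'.1]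
      have c2 : (θ - θ') ^ 2 ≤ 16 * Real.sin ((θ - θ') / 2) ^ 2 := by
        rw [div_le_iff₀ (by positivity)] at hsin
        have : Real.pi ^ 2 ≤ 16 := by nlinarith
        nlinarith [sq_nonneg (Real.sin ((θ - θ') / 2))]
      have c3 : r ^ 2 * (θ - θ') ^ 2 ≤ 2 * (r * r') * (16 * Real.sin ((θ - θ') / 2) ^ 2) :=
        mul_le_mul c1 c2 (sq_nonneg _) (by positivity)
      nlinarith [sq_nonneg (r - r')]
    have b3 : |r * θ - r' * θ'| ≤ 25 * δ := by
      have e : r * θ - r' * θ' = r * (θ - θ') + (r - r') * θ' := by ring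
      have hθ' : |θ'| ≤ 16 := by
        rw [abs_le] at hθ ⊢
        constructor <;> linarith
      rw [e]
      refine (abs_add_le _ _).trans ?_
      rw [abs_mul, abs_mul, abs_of_pos hr0]
      have : |r - r'| * |θ'| ≤ δ * 16 := mul_le_mul b1 hθ' (abs_nonneg _) hδ
      linarith
    rw [Prod.dist_eq, Real.dist_eq, Real.dist_eq]
    refine max_le ?_ b3
    simp only [NNReal.coe_ofNat]
    linarith
  have h := hausdorffMeasure_le_of_expanding hexp
  rw [hausdorffMeasure_prod_real] at h
  refine h.trans ?_
  calc _ ≤ ((25 : ℝ≥0) : ℝ≥0∞) ^ 2 * μH[2] A := by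
        gcongr
        rintro _ ⟨p, hp, rfl⟩
        exact hp.2
    _ ≤ ((25 : ℝ≥0) : ℝ≥0∞) ^ 2 * (C * μ A) := by gcongr; exact hμ.hausdorff_le A
    _ = _ := by norm_num

/-- The area of a disc is at least quadratic in its radius. -/
lemma le_measure_ball (hμ : IsComparable μ C) (x : M) {s : ℝ} (hs : 0 < s)
    (hk : P.k * s ^ 2 ≤ 3) : ENNReal.ofReal (s ^ 2) ≤ 1875 * (C * μ (Metric.ball x s)) := by
  have hp := Real.pi_gt_three
  have hk' : P.k * (3 * s / 4) ^ 2 ≤ 3 := by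
    have := mul_nonneg P.k_nonneg (sq_nonneg s)
    nlinarith
  have h := P.volume_arcRegion_inter_le hμ x (s₁ := s / 2) (s₂ := 3 * s / 4) (θ₀ := 0)
    (by positivity) (by linarith) hk' (by simp) (Metric.ball x s)
  have hsub : Icc (s / 2) (3 * s / 4) ×ˢ Icc 0 (3 * s / 2) ⊆
      arcRegion (s / 2) (3 * s / 4) 0 ∩ P.arcMap x ⁻¹' Metric.ball x s := by
    rintro ⟨r, t⟩ ⟨hr, ht⟩
    simp only [mem_Icc] at hr ht
    have hr0 : 0 ≤ r := by linarith
    refine ⟨⟨hr, by simpa using ht.1, ?_⟩, ?_⟩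
    · simp only; nlinarith
    · simp only [arcMap, mem_preimage, Metric.mem_ball]
      rw [P.dist_polar' x _ hr0]
      · linarith
      · have : P.k * r ^ 2 ≤ P.k * (3 * s / 4) ^ 2 :=
          mul_le_mul_of_nonneg_left (pow_le_pow_left₀ hr0 hr.2 2) P.k_nonneg
        linarith
  have h2 := (measure_mono hsub).trans h
  rw [Measure.volume_eq_prod, Measure.prod_prod, Real.volume_Icc, Real.volume_Icc,
    ← ENNReal.ofReal_mul (by linarith)] at h2
  calc ENNReal.ofReal (s ^ 2) ≤ 3 * ENNReal.ofReal ((3 * s / 4 - s / 2) * (3 * s / 2 - 0)) := by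
        rw [show (3 : ℝ≥0∞) = ENNReal.ofReal 3 by simp, ← ENNReal.ofReal_mul (by norm_num)]
        apply ENNReal.ofReal_le_ofReal
        nlinarith [sq_nonneg s]
    _ ≤ 3 * (625 * (C * μ (Metric.ball x s))) := by gcongr
    _ = _ := by rw [← mul_assoc]; norm_num

variable {P}

/-- The part of a round disc near one of its points is fat. -/
lemma IsRound.le_measure_inter (hμ : IsComparable μ C) {d : Disk M} (h : P.IsRound d) {z : M}
    (hz : z ∈ d.carrier) {σ : ℝ} (hσ : 0 < σ) (hk : P.k * σ ^ 2 ≤ 1 / 100)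
    (hs : d.sign = 1 → 4 * σ ≤ d.radius) :
    ENNReal.ofReal (σ ^ 2) ≤ 1875 * (C * μ (d.carrier ∩ Metric.ball z (3 * σ))) := by
  -- The corkscrew point of the complementary disc lies at depth at least `σ` in `d` and within `2 *
  -- σ` of `z`, so the ball of radius `σ` around it is in both sets.
  obtain ⟨p, hp, hp'⟩ := h.flip.exists_corkscrew (z := z)
    (by rw [Disk.height_flip]; exact neg_nonneg.2 hz) hσ.le hk
    (fun h' => hs (by simpa [Disk.flip] using h'))
  refine (P.le_measure_ball hμ p hσ (by linarith)).trans ?_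
  gcongr
  refine subset_inter ?_ ?_
  · intro y hy
    have h1 := h.flip.height_sub_le p y
    rw [Metric.mem_ball, dist_comm] at hy
    rw [Disk.height_flip] at *
    rw [Disk.height_flip] at h1
    simp only [Disk.carrier, mem_ofPred_eq]
    linarith
  · intro y hy
    rw [Metric.mem_ball] at *
    have := dist_triangle y p z
    rw [dist_comm p z] at this
    linarith

/-- The square of the length of the set of radii of the circles that meet a round disc is
controlled by an area. -/
lemma IsRound.volume_radii_sq_le (hμ : IsComparable μ C) {d : Disk M} (h : P.IsRound d) (x : M)
    {s : ℝ} (hs : 0 < s) (hk : P.k * s ^ 2 ≤ 3) :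
    volume (Ioo 0 s ∩ {r | (Metric.sphere x r ∩ d.carrier).Nonempty}) ^ 2 ≤
      1600 * (1875 * (C * μ (d.carrier ∩ Metric.closedBall x (2 * s)))) := by
  set V := Ioo 0 s ∩ {r | (Metric.sphere x r ∩ d.carrier).Nonempty} with hV
  rcases V.eq_empty_or_nonempty with h0 | ⟨r₀, hr₀, z, hzx, hz⟩
  · rw [h0]; simp
  have hVs : volume V ≤ ENNReal.ofReal s := by
    calc volume V ≤ volume (Ioo 0 s) := measure_mono inter_subset_left
      _ = _ := by simp
  -- The set of radii has length at most `min (2 * radius) s` for a disc, and at most `s` in any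
  -- case. Take `σ` as a twentieth of `min radius s`, or of `s` for an exterior disc.
  obtain ⟨σ, hσ, hσs, hVσ, hσr⟩ : ∃ σ, 0 < σ ∧ σ ≤ s / 20 ∧ volume V ≤ ENNReal.ofReal (40 * σ) ∧
      (d.sign = 1 → 4 * σ ≤ d.radius) := by
    have hr := h.pos
    rcases h.sign with hs1 | hs1
    · refine ⟨min d.radius s / 20, by positivity, ?_, ?_, ?_⟩
      · linarith [min_le_right d.radius s]
      · have hVr : volume V ≤ ENNReal.ofReal (2 * d.radius) := by
          have : V ⊆ Icc (dist x d.center - d.radius) (dist x d.center + d.radius) := by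
            rintro r ⟨-, y, hyx, hy⟩
            simp only [Disk.carrier, Disk.height, hs1, mem_ofPred_eq] at hy
            rw [Metric.mem_sphere] at hyx
            have e1 := dist_triangle x y d.center
            have e2 := dist_triangle y d.center x
            rw [dist_comm x y] at e1
            rw [dist_comm d.center x] at e2
            constructor <;> linarith
          refine (measure_mono this).trans ?_
          rw [Real.volume_Icc]
          apply ENNReal.ofReal_le_ofReal
          linarith
        rcases min_cases d.radius s with ⟨h1, _⟩ | ⟨h1, _⟩
        · rw [h1]; convert hVr using 2; ring
        · rw [h1]; exact hVs.trans (ENNReal.ofReal_le_ofReal (by linarith))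
      · intro _; linarith [min_le_left d.radius s]
    · refine ⟨s / 20, by positivity, le_rfl, ?_, fun h' => ?_⟩
      · exact hVs.trans (ENNReal.ofReal_le_ofReal (by linarith))
      · rw [hs1] at h'; norm_num at h'
  have hkσ : P.k * σ ^ 2 ≤ 1 / 100 := by
    have : P.k * σ ^ 2 ≤ P.k * (s / 20) ^ 2 :=
      mul_le_mul_of_nonneg_left (pow_le_pow_left₀ hσ.le hσs 2) P.k_nonneg
    nlinarith
  have key := h.le_measure_inter hμ hz hσ hkσ hσr
  calc volume V ^ 2 ≤ ENNReal.ofReal (40 * σ) ^ 2 := by gcongr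
    _ = 1600 * ENNReal.ofReal (σ ^ 2) := by
      rw [← ENNReal.ofReal_pow (by positivity), show (1600 : ℝ≥0∞) = ENNReal.ofReal 1600 by simp,
        ← ENNReal.ofReal_mul (by norm_num)]
      congr 1; ring
    _ ≤ _ := by
      gcongr
      refine key.trans ?_
      gcongr
      intro y hy
      rw [Metric.mem_ball] at hy
      rw [Metric.mem_closedBall]
      rw [Metric.mem_sphere] at hzx
      have := dist_triangle y z x
      linarith [hr₀.2]

end PolarSpace


/-! ### The length-area method: short circles -/

/-- Young's inequality, used in place of Cauchy–Schwarz; the parameter `a` is optimized only in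
`exists_short_circle`. -/
lemma ENNReal_mul_le_add_sq (w l : ℝ≥0∞) {a : ℝ≥0∞} (ha : a ≠ 0) (ha' : a ≠ ⊤) :
    w * l ≤ a * w ^ 2 + a⁻¹ * l ^ 2 := by
  rcases le_total l (a * w) with h | h
  · refine le_add_right ?_
    calc w * l ≤ w * (a * w) := by gcongr
      _ = a * w ^ 2 := by ring
  · refine le_add_left ?_
    have : w ≤ a⁻¹ * l := by
      calc w = a⁻¹ * (a * w) := by rw [← mul_assoc, ENNReal.inv_mul_cancel ha ha', one_mul]
        _ ≤ a⁻¹ * l := by gcongr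
    calc w * l ≤ a⁻¹ * l * l := by gcongr
      _ = a⁻¹ * l ^ 2 := by ring

namespace PolarSpace

variable {M : Type*} [MetricSpace M] [MeasurableSpace M] [BorelSpace M] (P : PolarSpace M)
  {μ : Measure M} {C : ℝ≥0} {ι : Type*}

/-- The length of the circle around `x` of radius `r` with respect to the density `ρ` and the
weights `w` on the discs `D`. The circle is traversed three times. -/
noncomputable def circleCost (D : ι → Disk M) (ρ : M → ℝ≥0∞) (w : ι → ℝ≥0∞) (x : M) (r : ℝ) :
    ℝ≥0∞ :=
  (∫⁻ t in Icc (-(2 * Real.pi) * r) (4 * Real.pi * r), ρ (P.Φ x r (t / r))) +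
    ∑' i, indicator {r | (Metric.sphere x r ∩ (D i).carrier).Nonempty} (fun _ => w i) r

lemma measurableSet_arcs :
    MeasurableSet {p : ℝ × ℝ | p.2 ∈ Icc (-(2 * Real.pi) * p.1) (4 * Real.pi * p.1)} := by
  have h1 : MeasurableSet {p : ℝ × ℝ | -(2 * Real.pi) * p.1 ≤ p.2} :=
    measurableSet_le (by fun_prop) (by fun_prop)
  have h2 : MeasurableSet {p : ℝ × ℝ | p.2 ≤ 4 * Real.pi * p.1} :=
    measurableSet_le (by fun_prop) (by fun_prop)
  convert h1.inter h2 using 1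
  ext p; rfl

/-- Six arcs of opening `π` cover the angles from `-2π` to `4π`, each with the factor `625`. -/
lemma lintegral_arcs_le (hμ : IsComparable μ C) (x : M) {s₁ s₂ : ℝ} (h₁ : 0 < s₁)
    (h₂ : s₂ ≤ 2 * s₁) (hk : P.k * s₂ ^ 2 ≤ 3) {ρ : M → ℝ≥0∞} (hρ : Measurable ρ) :
    ∫⁻ r in Ioo s₁ s₂, ∫⁻ t in Icc (-(2 * Real.pi) * r) (4 * Real.pi * r), ρ (P.Φ x r (t / r)) ≤
      3750 * C * ∫⁻ z in Metric.closedBall x s₂, ρ z ∂μ := by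
  have hp := Real.pi_pos
  have hp3 := Real.pi_gt_three
  have hp4 := Real.pi_lt_four
  set B := Metric.closedBall x s₂ with hB
  set g := B.indicator ρ with hg
  have hgm : Measurable g := hρ.indicator measurableSet_closedBall
  let R : Set (ℝ × ℝ) := {p | p.1 ∈ Ioo s₁ s₂ ∧ -(2 * Real.pi) * p.1 ≤ p.2 ∧
    p.2 ≤ 4 * Real.pi * p.1}
  have hRm : MeasurableSet R := by
    convert (measurable_fst measurableSet_Ioo).inter measurableSet_arcs using 1
    ext p; rfl
  have step1 : ∫⁻ r in Ioo s₁ s₂, ∫⁻ t in Icc (-(2 * Real.pi) * r) (4 * Real.pi * r),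
      ρ (P.Φ x r (t / r)) ≤ ∫⁻ p in R, g (P.arcMap x p) := by
    rw [← lintegral_indicator hRm, Measure.volume_eq_prod, lintegral_prod (R.indicator fun p => g (P.arcMap x p))
      ((hgm.comp (P.measurable_arcMap x)).indicator hRm).aemeasurable]
    rw [← lintegral_indicator measurableSet_Ioo]
    refine lintegral_mono fun r => ?_
    by_cases hr : r ∈ Ioo s₁ s₂
    · rw [indicator_of_mem hr, ← lintegral_indicator measurableSet_Icc]
      refine lintegral_mono fun t => ?_
      by_cases ht : t ∈ Icc (-(2 * Real.pi) * r) (4 * Real.pi * r)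
      · have hmem : (r, t) ∈ R := ⟨hr, ht⟩
        have hr0 : 0 ≤ r := h₁.le.trans hr.1.le
        have hkr : P.k * r ^ 2 ≤ 3 :=
          (mul_le_mul_of_nonneg_left (pow_le_pow_left₀ hr0 hr.2.le 2) P.k_nonneg).trans hk
        have hmemB : P.Φ x r (t / r) ∈ B := by
          rw [hB, Metric.mem_closedBall, P.dist_polar' x _ hr0 (by linarith)]
          exact hr.2.le
        simp only
        rw [indicator_of_mem ht, indicator_of_mem hmem, hg]
        simp only [arcMap]
        rw [indicator_of_mem hmemB]
      · rw [indicator_of_notMem ht]; exact zero_le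
    · rw [indicator_of_notMem hr]; exact zero_le
  have hcover : R ⊆ ⋃ j : Fin 6, arcRegion s₁ s₂ (-(2 * Real.pi) + (j : ℕ) * Real.pi) := by
    rintro ⟨r, t⟩ ⟨hr, ht, ht'⟩
    simp only at hr ht ht'
    have hr0 : 0 < r := h₁.trans hr.1
    obtain ⟨θ, rfl⟩ : ∃ θ, t = r * θ := ⟨t / r, by field_simp⟩
    have a1 : -(2 * Real.pi) ≤ θ := by nlinarith
    have a2 : θ ≤ 4 * Real.pi := by nlinarith
    have key : ∃ j : Fin 6, -(2 * Real.pi) + (j : ℕ) * Real.pi ≤ θ ∧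
        θ ≤ -(2 * Real.pi) + (j : ℕ) * Real.pi + Real.pi := by
      by_cases c1 : θ ≤ -Real.pi
      · exact ⟨0, by simp; linarith, by simp; linarith⟩
      by_cases c2 : θ ≤ 0
      · exact ⟨1, by simp; linarith, by simp; linarith⟩
      by_cases c3 : θ ≤ Real.pi
      · exact ⟨2, by simp; linarith, by simp; linarith⟩
      by_cases c4 : θ ≤ 2 * Real.pi
      · exact ⟨3, by simp; linarith, by simp; linarith⟩
      by_cases c5 : θ ≤ 3 * Real.pi
      · exact ⟨4, by simp; linarith, by simp; linarith⟩
      · exact ⟨5, by simp; linarith, by simp; linarith⟩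
    obtain ⟨j, h1, h2⟩ := key
    exact mem_iUnion.2 ⟨j, Ioo_subset_Icc_self hr, mul_le_mul_of_nonneg_left h1 hr0.le,
      mul_le_mul_of_nonneg_left h2 hr0.le⟩
  have step2 : ∀ θ₀ : ℝ, |θ₀| ≤ 12 →
      ∫⁻ p in arcRegion s₁ s₂ θ₀, g (P.arcMap x p) ≤ 625 * C * ∫⁻ z, g z ∂μ := by
    intro θ₀ hθ₀
    rw [← lintegral_map hgm (P.measurable_arcMap x), ← lintegral_const_mul _ hgm,
      lintegral_const_mul _ hgm, ← smul_eq_mul, ← lintegral_smul_measure]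
    refine lintegral_mono' ?_ le_rfl
    refine Measure.le_iff.2 fun A hA => ?_
    rw [Measure.map_apply (P.measurable_arcMap x) hA,
      Measure.restrict_apply (P.measurable_arcMap x hA), Measure.smul_apply, smul_eq_mul, inter_comm,
      mul_assoc]
    exact P.volume_arcRegion_inter_le hμ x h₁ h₂ hk hθ₀ A
  calc _ ≤ ∫⁻ p in R, g (P.arcMap x p) := step1
    _ ≤ ∫⁻ p, g (P.arcMap x p) ∂(Measure.sum fun j : Fin 6 =>
          volume.restrict (arcRegion s₁ s₂ (-(2 * Real.pi) + (j : ℕ) * Real.pi))) :=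
        lintegral_mono' ((Measure.restrict_mono hcover le_rfl).trans Measure.restrict_iUnion_le)
          le_rfl
    _ = ∑ j : Fin 6, ∫⁻ p in arcRegion s₁ s₂ (-(2 * Real.pi) + (j : ℕ) * Real.pi),
          g (P.arcMap x p) := by rw [lintegral_sum_measure, tsum_fintype]
    _ ≤ ∑ j : Fin 6, 625 * C * ∫⁻ z, g z ∂μ := by
        refine Finset.sum_le_sum fun j _ => step2 _ ?_
        have : ((j : ℕ) : ℝ) ≤ 5 := by exact_mod_cast Nat.le_of_lt_succ j.2
        have h0 : (0 : ℝ) ≤ (j : ℕ) := by positivity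
        rw [abs_le]
        constructor <;> nlinarith
    _ = _ := by
        rw [Finset.sum_const, Finset.card_univ, Fintype.card_fin, hg,
          lintegral_indicator measurableSet_closedBall, nsmul_eq_mul]
        push_cast
        ring

/-- The density is handled by `ρ ≤ a ρ² + a⁻¹` on the ball. A weight `w i` integrates to `w i` times
the length of the radii that meet disc `i`; Young's inequality splits the product, and the squared
length is at most a multiple of the area of the disc near `x`. The discs are disjoint, so these
areas add up to at most that of a ball. -/
lemma lintegral_circleCost_le [Countable ι] (hμ : IsComparable μ C) {D : ι → Disk M}
    (hD : ∀ i, P.IsRound (D i)) (hdis : Pairwise fun i j => Disjoint (D i).carrier (D j).carrier)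
    {ρ : M → ℝ≥0∞} (hρ : Measurable ρ) (w : ι → ℝ≥0∞) (x : M) {s₁ s₂ : ℝ} (h₁ : 0 < s₁)
    (h₁₂ : s₁ ≤ s₂) (h₂ : s₂ ≤ 2 * s₁) (hk : P.k * s₂ ^ 2 ≤ 3) {a : ℝ≥0∞} (ha : a ≠ 0)
    (ha' : a ≠ ⊤) :
    ∫⁻ r in Ioo s₁ s₂, P.circleCost D ρ w x r ≤
      ((3750 * C + 1 + 562500 * C ^ 2 + 1800000000 * C ^ 2 : ℝ≥0) : ℝ≥0∞) *
        (a * (∫⁻ z, ρ z ^ 2 ∂μ + ∑' i, w i ^ 2) + a⁻¹ * ENNReal.ofReal (s₂ ^ 2)) := by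
  have hs₂ : 0 < s₂ := h₁.trans_le h₁₂
  have hball : ∀ s, 0 < s → μ (Metric.closedBall x s) ≤ C * (150 * ENNReal.ofReal (s ^ 2)) := by
    intro s hs
    refine (P.measure_closedBall_le hμ x hs).trans (le_of_eq ?_)
    rw [ENNReal.ofReal_mul (by norm_num)]
    norm_num
  set m := ∫⁻ z, ρ z ^ 2 ∂μ + ∑' i, w i ^ 2 with hm
  set S := ENNReal.ofReal (s₂ ^ 2) with hS
  have part1 : ∫⁻ z in Metric.closedBall x s₂, ρ z ∂μ ≤ a * m + a⁻¹ * (C * (150 * S)) := by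
    calc ∫⁻ z in Metric.closedBall x s₂, ρ z ∂μ
        ≤ ∫⁻ z in Metric.closedBall x s₂, (a * ρ z ^ 2 + a⁻¹) ∂μ := by
          refine lintegral_mono fun z => ?_
          simpa using ENNReal_mul_le_add_sq (ρ z) 1 ha ha'
      _ = a * ∫⁻ z in Metric.closedBall x s₂, ρ z ^ 2 ∂μ + a⁻¹ * μ (Metric.closedBall x s₂) := by
          rw [lintegral_add_right _ measurable_const, lintegral_const_mul _ (hρ.pow_const 2),
            setLIntegral_const]
      _ ≤ _ := by
          gcongr
          · exact (setLIntegral_le_lintegral _ _).trans le_self_add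
          · exact hball s₂ hs₂
  let V : ι → Set ℝ := fun i => {r | (Metric.sphere x r ∩ (D i).carrier).Nonempty}
  -- A measurable hull of the same measure makes it unnecessary to show that the set of radii is
  -- measurable.
  let U : ι → Set ℝ := fun i => toMeasurable (volume.restrict (Ioo s₁ s₂)) (V i)
  have hUV : ∀ i, (volume.restrict (Ioo s₁ s₂)) (U i) ^ 2 ≤
      1600 * (1875 * (C * μ ((D i).carrier ∩ Metric.closedBall x (2 * s₂)))) := by
    intro i
    rw [measure_toMeasurable, Measure.restrict_apply₀' measurableSet_Ioo.nullMeasurableSet,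
      inter_comm]
    refine le_trans ?_ ((hD i).volume_radii_sq_le hμ x hs₂ hk)
    gcongr
  have part2 : ∫⁻ r in Ioo s₁ s₂, ∑' i, indicator (V i) (fun _ => w i) r ≤
      a * m + a⁻¹ * (1800000000 * C ^ 2 * S) := by
    calc ∫⁻ r in Ioo s₁ s₂, ∑' i, indicator (V i) (fun _ => w i) r
        ≤ ∫⁻ r in Ioo s₁ s₂, ∑' i, indicator (U i) (fun _ => w i) r := by
          refine lintegral_mono fun r => ENNReal.tsum_le_tsum fun i => ?_
          exact indicator_le_indicator_of_subset (subset_toMeasurable _ _) (fun _ => zero_le) r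
      _ = ∑' i, w i * (volume.restrict (Ioo s₁ s₂)) (U i) := by
          rw [lintegral_tsum fun i =>
            (measurable_const.indicator (measurableSet_toMeasurable _ _)).aemeasurable]
          congr 1; ext i
          rw [lintegral_indicator_const (measurableSet_toMeasurable _ _)]
      _ ≤ ∑' i, (a * w i ^ 2 + a⁻¹ * (volume.restrict (Ioo s₁ s₂)) (U i) ^ 2) :=
          ENNReal.tsum_le_tsum fun i => ENNReal_mul_le_add_sq _ _ ha ha'
      _ ≤ ∑' i, (a * w i ^ 2 + a⁻¹ * (1600 * (1875 *
            (C * μ ((D i).carrier ∩ Metric.closedBall x (2 * s₂)))))) := by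
          refine ENNReal.tsum_le_tsum fun i => ?_
          gcongr
          exact hUV i
      _ = a * ∑' i, w i ^ 2 + a⁻¹ * (1600 * (1875 *
            (C * ∑' i, μ ((D i).carrier ∩ Metric.closedBall x (2 * s₂))))) := by
          rw [ENNReal.tsum_add]
          simp only [ENNReal.tsum_mul_left]
      _ ≤ a * m + a⁻¹ * (1600 * (1875 * (C * (C * (150 * ENNReal.ofReal ((2 * s₂) ^ 2)))))) := by
          gcongr
          · exact le_add_self
          · rw [← measure_iUnion]
            · refine (measure_mono ?_).trans (hball (2 * s₂) (by positivity))
              exact iUnion_subset fun i => inter_subset_right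
            · intro i j hij
              exact (hdis hij).mono inter_subset_left inter_subset_left
            · intro i
              exact (D i).isClosed_carrier.measurableSet.inter measurableSet_closedBall
      _ = _ := by
          rw [mul_pow, ENNReal.ofReal_mul (by norm_num)]
          norm_num
          ring
  have hmeas : Measurable fun r =>
      ∫⁻ t in Icc (-(2 * Real.pi) * r) (4 * Real.pi * r), ρ (P.Φ x r (t / r)) := by
    have h1 := ((hρ.comp (P.measurable_arcMap x)).indicator measurableSet_arcs).lintegral_prod_right'
      (ν := (volume : Measure ℝ))
    convert h1 using 2 with r
    rw [← lintegral_indicator measurableSet_Icc]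
    rfl
  unfold circleCost
  rw [lintegral_add_left hmeas]
  calc _ ≤ 3750 * C * (a * m + a⁻¹ * (C * (150 * S))) +
        (a * m + a⁻¹ * (1800000000 * C ^ 2 * S)) := by
        refine add_le_add ?_ part2
        refine (P.lintegral_arcs_le hμ x h₁ h₂ hk hρ).trans ?_
        gcongr
    _ = (3750 * C + 1) * (a * m) + (562500 * C ^ 2 + 1800000000 * C ^ 2) * (a⁻¹ * S) := by
        ring
    _ ≤ _ := by
        have e1 : 3750 * (C : ℝ≥0∞) + 1 ≤
            ((3750 * C + 1 + 562500 * C ^ 2 + 1800000000 * C ^ 2 : ℝ≥0) : ℝ≥0∞) := by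
          push_cast
          rw [add_assoc (3750 * (C : ℝ≥0∞) + 1)]
          exact le_self_add
        have e2 : 562500 * (C : ℝ≥0∞) ^ 2 + 1800000000 * C ^ 2 ≤
            ((3750 * C + 1 + 562500 * C ^ 2 + 1800000000 * C ^ 2 : ℝ≥0) : ℝ≥0∞) := by
          push_cast
          rw [add_assoc (3750 * (C : ℝ≥0∞) + 1)]
          exact le_add_self
        rw [mul_add _ (a * m) (a⁻¹ * S)]
        exact add_le_add (by gcongr) (by gcongr)

/-- If the total mass is small, there are short circles in all annuli. -/
theorem exists_short_circle (C : ℝ≥0) {η q : ℝ} (hη : 0 < η) (hq : 0 < q) :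
    ∃ ε : ℝ, 0 < ε ∧ ∀ {M : Type*} [MetricSpace M] [MeasurableSpace M] [BorelSpace M]
      (P : PolarSpace M) (μ : Measure M) {ι : Type*} [Countable ι] (D : ι → Disk M) (ρ : M → ℝ≥0∞)
      (w : ι → ℝ≥0∞), IsComparable μ C → (∀ i, P.IsRound (D i)) →
      (Pairwise fun i j => Disjoint (D i).carrier (D j).carrier) → Measurable ρ →
      ∫⁻ z, ρ z ^ 2 ∂μ + ∑' i, w i ^ 2 ≤ ENNReal.ofReal ε →
      ∀ (x : M) (s₁ s₂ : ℝ) (T : Set M), 0 < s₁ → s₂ ≤ 2 * s₁ → P.k * s₂ ^ 2 ≤ 3 →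
        s₁ < s₂ → s₂ ≤ q * (s₂ - s₁) → T.Countable →
      ∃ r ∈ Ioo s₁ s₂, P.circleCost D ρ w x r ≤ ENNReal.ofReal η ∧ ∀ p ∈ T, dist x p ≠ r := by
  set A : ℝ≥0 := 3750 * C + 1 + 562500 * C ^ 2 + 1800000000 * C ^ 2 with hA
  have hA0 : (0 : ℝ) < A := by
    have : 0 < A := by rw [hA]; positivity
    exact_mod_cast this
  -- With `a = N * s₂` and mass at most `1 / N ^ 2`, the bound on the integral becomes `2 * A * s₂ /
  -- N = η * s₂ / (2 * q)`. If no circle were short, the integral would be at least `η * (s₂ - s₁) ≥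
  -- η * s₂ / q`.
  set N : ℝ := 4 * A * q / η with hN
  have hN0 : 0 < N := by positivity
  refine ⟨1 / N ^ 2, by positivity, ?_⟩
  intro M _ _ _ P μ ι _ D ρ w hμ hD hdis hρ hmass x s₁ s₂ T h₁ h₂ hk h₁₂ hs hT
  have hs₂ : 0 < s₂ := h₁.trans h₁₂
  by_contra! hcon
  have hbound := P.lintegral_circleCost_le hμ hD hdis hρ w x h₁ h₁₂.le h₂ hk
    (a := ENNReal.ofReal (N * s₂)) (by simpa using mul_pos hN0 hs₂) ENNReal.ofReal_ne_top
  have hub : ∫⁻ r in Ioo s₁ s₂, P.circleCost D ρ w x r ≤ ENNReal.ofReal (η * s₂ / (2 * q)) := by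
    refine hbound.trans ?_
    calc _ ≤ (A : ℝ≥0∞) * (ENNReal.ofReal (N * s₂) * ENNReal.ofReal (1 / N ^ 2) +
          (ENNReal.ofReal (N * s₂))⁻¹ * ENNReal.ofReal (s₂ ^ 2)) := by gcongr
      _ = ENNReal.ofReal (A * (N * s₂ * (1 / N ^ 2) + (N * s₂)⁻¹ * s₂ ^ 2)) := by
          rw [← ENNReal.ofReal_inv_of_pos (by positivity), ← ENNReal.ofReal_mul (by positivity),
            ← ENNReal.ofReal_mul (by positivity), ← ENNReal.ofReal_add (by positivity)
            (by positivity), ENNReal.ofReal_mul (by positivity), ENNReal.ofReal_coe_nnreal]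
      _ = _ := by
          congr 1
          rw [hN]
          field_simp
          ring
  have hlb : ENNReal.ofReal (η * (s₂ - s₁)) ≤ ∫⁻ r in Ioo s₁ s₂, P.circleCost D ρ w x r := by
    calc ENNReal.ofReal (η * (s₂ - s₁)) = ∫⁻ r in Ioo s₁ s₂, ENNReal.ofReal η := by
          rw [setLIntegral_const, Real.volume_Ioo, ENNReal.ofReal_mul hη.le]
      _ ≤ _ := by
          have hnull : ∀ᵐ r ∂(volume : Measure ℝ), r ∉ dist x '' T :=
            (hT.image _).ae_notMem _
          refine lintegral_mono_ae ?_
          filter_upwards [ae_restrict_of_ae hnull, ae_restrict_mem measurableSet_Ioo] with r hr hr'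
          by_contra! hlt
          obtain ⟨p, hp, hpr⟩ := hcon r hr' hlt.le
          exact hr ⟨p, hp, hpr⟩
  have := hlb.trans hub
  rw [ENNReal.ofReal_le_ofReal_iff (by positivity)] at this
  have h3 : η * s₂ / (2 * q) = η * s₂ / q / 2 := by field_simp
  have h4 : η * s₂ / q ≤ η * (s₂ - s₁) := by
    rw [div_le_iff₀ hq]; nlinarith
  have h5 : 0 < η * s₂ / q := by positivity
  linarith

end PolarSpace


/-! ### Paths and their costs -/

section Link

variable {M : Type*} [MetricSpace M] {ι : Type*} {D : ι → Disk M} {ρ : M → ℝ≥0∞} {w : ι → ℝ≥0∞}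

/-- The length of a path with respect to a density and to weights on discs. -/
noncomputable def pathCost (D : ι → Disk M) (ρ : M → ℝ≥0∞) (w : ι → ℝ≥0∞) (γ : ℝ → M) (I : Set ℝ) :
    ℝ≥0∞ :=
  (∫⁻ t in I, ρ (γ t)) + ∑' i, indicator {i | (γ '' I ∩ (D i).carrier).Nonempty} w i

/-- The points `a` and `b` are joined in `A` by a path of length at most `l`. -/
def Link (D : ι → Disk M) (ρ : M → ℝ≥0∞) (w : ι → ℝ≥0∞) (A : Set M) (a b : M) (l : ℝ≥0∞) : Prop :=
  ∃ (L : ℝ) (γ : ℝ → M), 0 ≤ L ∧ LipschitzOnWith 1 γ (Icc 0 L) ∧ MapsTo γ (Icc 0 L) A ∧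
    γ 0 = a ∧ γ L = b ∧ pathCost D ρ w γ (Icc 0 L) ≤ l

lemma pathCost_le {γ β : ℝ → M} {I I' : Set ℝ} (h : γ '' I ⊆ β '' I')
    (h' : ∫⁻ t in I, ρ (γ t) ≤ ∫⁻ t in I', ρ (β t)) :
    pathCost D ρ w γ I ≤ pathCost D ρ w β I' :=
  add_le_add h' (ENNReal.tsum_le_tsum fun i => indicator_le_indicator_of_subset
    (fun _ hi => hi.mono (inter_subset_inter_left _ h)) (fun _ => zero_le) i)

lemma pathCost_mono (γ : ℝ → M) {I I' : Set ℝ} (h : I ⊆ I') :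
    pathCost D ρ w γ I ≤ pathCost D ρ w γ I' :=
  pathCost_le (image_mono h) (lintegral_mono_set h)

lemma Link.mono {A A' : Set M} {a b : M} {l l' : ℝ≥0∞} (h : Link D ρ w A a b l) (hA : A ⊆ A')
    (hl : l ≤ l') : Link D ρ w A' a b l' := by
  obtain ⟨L, γ, h0, h1, h2, h3, h4, h5⟩ := h
  exact ⟨L, γ, h0, h1, h2.mono_right hA, h3, h4, h5.trans hl⟩

lemma setLIntegral_Icc_add (f : ℝ → ℝ≥0∞) (s L : ℝ) :
    ∫⁻ t in Icc 0 L, f (t + s) = ∫⁻ t in Icc s (s + L), f t := by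
  have h := (measurePreserving_add_right (volume : Measure ℝ) s).setLIntegral_comp_preimage_emb
    (MeasurableEquiv.addRight s).measurableEmbedding f (Icc s (s + L))
  rw [← h]
  congr 2
  simp

lemma setLIntegral_Icc_sub_left (f : ℝ → ℝ≥0∞) (L : ℝ) :
    ∫⁻ t in Icc 0 L, f (L - t) = ∫⁻ t in Icc 0 L, f t := by
  have h := (Measure.measurePreserving_sub_left (volume : Measure ℝ) L).setLIntegral_comp_preimage_emb
    (MeasurableEquiv.subLeft L).measurableEmbedding f (Icc 0 L)
  rw [← h]
  congr 2
  simp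

/-- A path parametrized by any interval is a link. -/
lemma link_of_Icc {A : Set M} {γ : ℝ → M} {s t : ℝ} (hst : s ≤ t)
    (hL : LipschitzOnWith 1 γ (Icc s t)) (hA : MapsTo γ (Icc s t) A) {l : ℝ≥0∞}
    (hl : pathCost D ρ w γ (Icc s t) ≤ l) : Link D ρ w A (γ s) (γ t) l := by
  have hmaps : MapsTo (fun u => u + s) (Icc 0 (t - s)) (Icc s t) := fun u hu =>
    ⟨by linarith [hu.1], by linarith [hu.2]⟩
  refine ⟨t - s, fun u => γ (u + s), by linarith, ?_, hA.comp hmaps, by simp, by simp, ?_⟩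
  · refine LipschitzOnWith.of_dist_le_mul fun x hx y hy => ?_
    have := hL.dist_le_mul _ (hmaps hx) _ (hmaps hy)
    simpa using this
  · refine le_trans ?_ hl
    refine pathCost_le ?_ ?_
    · rintro _ ⟨u, hu, rfl⟩
      exact ⟨_, hmaps hu, rfl⟩
    · rw [setLIntegral_Icc_add (fun u => ρ (γ u)), add_sub_cancel]

lemma Link.symm {A : Set M} {a b : M} {l : ℝ≥0∞} (h : Link D ρ w A a b l) :
    Link D ρ w A b a l := by
  obtain ⟨L, γ, h0, h1, h2, h3, h4, h5⟩ := h
  have hmaps : MapsTo (fun u => L - u) (Icc 0 L) (Icc 0 L) := fun u hu =>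
    ⟨by linarith [hu.2], by linarith [hu.1]⟩
  refine ⟨L, fun u => γ (L - u), h0, ?_, h2.comp hmaps, by simpa, by simpa, le_trans ?_ h5⟩
  · refine LipschitzOnWith.of_dist_le_mul fun x hx y hy => ?_
    have := h1.dist_le_mul _ (hmaps hx) _ (hmaps hy)
    rwa [Real.dist_eq, sub_sub_sub_cancel_left, abs_sub_comm, ← Real.dist_eq] at this
  · refine pathCost_le ?_ ?_
    · rintro _ ⟨u, hu, rfl⟩
      exact ⟨_, hmaps hu, rfl⟩
    · rw [setLIntegral_Icc_sub_left (fun u => ρ (γ u))]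

lemma Link.trans {A : Set M} {a b c : M} {l l' : ℝ≥0∞} (h : Link D ρ w A a b l)
    (h' : Link D ρ w A b c l') : Link D ρ w A a c (l + l') := by
  obtain ⟨L, γ, h0, h1, h2, h3, h4, h5⟩ := h
  obtain ⟨L', β, h0', h1', h2', h3', h4', h5'⟩ := h'
  let g : ℝ → M := fun t => if t ≤ L then γ t else β (t - L)
  have hg1 : ∀ t ∈ Icc 0 L, g t = γ t := fun t ht => if_pos ht.2
  have hg2 : ∀ t ∈ Icc L (L + L'), g t = β (t - L) := by
    intro t ht
    rcases ht.1.eq_or_lt with h | h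
    · subst h; simp [g, h3', h4]
    · exact if_neg (not_le.2 h)
  have hsub : ∀ t ∈ Icc L (L + L'), t - L ∈ Icc 0 L' := fun t ht =>
    ⟨by linarith [ht.1], by linarith [ht.2]⟩
  have hcases : Icc 0 (L + L') = Icc 0 L ∪ Icc L (L + L') := by
    rw [Icc_union_Icc_eq_Icc h0 (by linarith)]
  have him : g '' Icc 0 (L + L') ⊆ γ '' Icc 0 L ∪ β '' Icc 0 L' := by
    rw [hcases]
    rintro _ ⟨t, ht | ht, rfl⟩
    · exact Or.inl ⟨t, ht, (hg1 t ht).symm⟩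
    · exact Or.inr ⟨t - L, hsub t ht, (hg2 t ht).symm⟩
  have hlip : ∀ s ∈ Icc 0 (L + L'), ∀ t ∈ Icc 0 (L + L'), s ≤ t → dist (g s) (g t) ≤ t - s := by
    intro s hs t ht hst
    have k1 : ∀ s ∈ Icc 0 L, ∀ t ∈ Icc 0 L, s ≤ t → dist (g s) (g t) ≤ t - s := by
      intro s hs t ht hst
      have := h1.dist_le_mul s hs t ht
      rw [hg1 s hs, hg1 t ht]
      rwa [NNReal.coe_one, one_mul, Real.dist_eq, abs_sub_comm, abs_of_nonneg (by linarith)] at this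
    have k2 : ∀ s ∈ Icc L (L + L'), ∀ t ∈ Icc L (L + L'), s ≤ t → dist (g s) (g t) ≤ t - s := by
      intro s hs t ht hst
      have := h1'.dist_le_mul _ (hsub s hs) _ (hsub t ht)
      rw [hg2 s hs, hg2 t ht]
      rw [NNReal.coe_one, one_mul, Real.dist_eq, abs_sub_comm, abs_of_nonneg (by linarith)] at this
      linarith
    rw [hcases] at hs ht
    rcases le_total t L with h | h
    · exact k1 s ⟨by rcases hs with hs | hs <;> linarith [hs.1], by linarith⟩ t
        ⟨by rcases ht with ht | ht <;> linarith [ht.1], h⟩ hst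
    · have ht' : t ∈ Icc L (L + L') := ⟨h, by rcases ht with ht | ht <;> linarith [ht.2]⟩
      rcases le_total s L with h' | h'
      · have e1 := k1 s ⟨by rcases hs with hs | hs <;> linarith [hs.1], h'⟩ L
          (right_mem_Icc.2 h0) h'
        have e2 := k2 L (left_mem_Icc.2 (by linarith)) t ht' h
        linarith [dist_triangle (g s) (g L) (g t)]
      · exact k2 s ⟨h', by rcases hs with hs | hs <;> linarith [hs.2]⟩ t ht' hst
  refine ⟨L + L', g, by linarith, ?_, ?_, ?_, ?_, ?_⟩
  · refine LipschitzOnWith.of_dist_le_mul fun x hx y hy => ?_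
    rw [NNReal.coe_one, one_mul, Real.dist_eq]
    rcases le_total x y with hxy | hxy
    · rw [abs_sub_comm, abs_of_nonneg (by linarith)]; exact hlip x hx y hy hxy
    · rw [abs_of_nonneg (by linarith), dist_comm]; exact hlip y hy x hx hxy
  · rintro t ht
    rcases him ⟨t, ht, rfl⟩ with ⟨u, hu, e⟩ | ⟨u, hu, e⟩
    · rw [← e]; exact h2 hu
    · rw [← e]; exact h2' hu
  · rw [hg1 0 (left_mem_Icc.2 h0), h3]
  · rw [hg2 _ (right_mem_Icc.2 (by linarith)), add_sub_cancel_left, h4']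
  · refine le_trans ?_ (add_le_add h5 h5')
    unfold pathCost
    rw [add_add_add_comm, ← ENNReal.tsum_add]
    gcongr with i
    · rw [hcases]
      refine (lintegral_union_le _ _ _).trans (add_le_add (le_of_eq ?_) (le_of_eq ?_))
      · exact setLIntegral_congr_fun measurableSet_Icc fun t ht => by rw [hg1 t ht]
      · rw [← setLIntegral_Icc_add (fun t => ρ (g t))]
        refine setLIntegral_congr_fun measurableSet_Icc fun t ht => ?_
        rw [hg2 (t + L) ⟨by linarith [ht.1], by linarith [ht.2]⟩, add_sub_cancel_right]
    · by_cases hi : (g '' Icc 0 (L + L') ∩ (D i).carrier).Nonempty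
      · obtain ⟨z, hz, hzi⟩ := hi
        rcases him hz with hz' | hz'
        · exact le_add_right ((indicator_le_self' (fun _ _ => zero_le) i).trans
            (le_of_eq (indicator_of_mem (show i ∈ {i | (γ '' Icc 0 L ∩ (D i).carrier).Nonempty}
              from ⟨z, hz', hzi⟩) w).symm))
        · exact le_add_left ((indicator_le_self' (fun _ _ => zero_le) i).trans
            (le_of_eq (indicator_of_mem (show i ∈ {i | (β '' Icc 0 L' ∩ (D i).carrier).Nonempty}
              from ⟨z, hz', hzi⟩) w).symm))
      · rw [indicator_of_notMem (by exact hi)]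
        exact zero_le

end Link

/-! ### Joining continua along short circles outside one obstacle -/

namespace PolarSpace

variable {M : Type*} [MetricSpace M] (P : PolarSpace M) {ι : Type*}
  {D : ι → Disk M} {ρ : M → ℝ≥0∞} {w : ι → ℝ≥0∞}

/-- An obstacle is empty or a round disc. -/
def IsObstacle (B : Set M) : Prop := B = ∅ ∨ ∃ d : Disk M, P.IsRound d ∧ B = d.carrier

variable {P}

/-- Two points of a circle are linked in the circle, outside an obstacle. -/
lemma IsObstacle.link {B : Set M} (hB : P.IsObstacle B) {x u v : M} {r : ℝ} (hr : 0 < r)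
    (hu : dist x u = r) (hv : dist x v = r) (huB : u ∉ B) (hvB : v ∉ B) :
    Link D ρ w ({z | dist x z = r} \ B) u v (P.circleCost D ρ w x r) := by
  have hp := Real.pi_pos
  have hk : P.k * r ^ 2 ≤ 4 := hu ▸ P.dist_bound x u
  obtain ⟨θ₁, hθ₁, θ₂, hθ₂, e₁, e₂, hθ⟩ : ∃ θ₁ ∈ Icc (-(2 * Real.pi)) (4 * Real.pi),
      ∃ θ₂ ∈ Icc (-(2 * Real.pi)) (4 * Real.pi), P.Φ x r θ₁ = u ∧ P.Φ x r θ₂ = v ∧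
      ∀ θ ∈ uIcc θ₁ θ₂, P.Φ x r θ ∉ B := by
    rcases hB with rfl | ⟨d, hd, rfl⟩
    · obtain ⟨θ₁, hθ₁, e₁⟩ := P.exists_angle x u 0
      obtain ⟨θ₂, hθ₂, e₂⟩ := P.exists_angle x v 0
      rw [hu] at e₁; rw [hv] at e₂
      exact ⟨θ₁, ⟨by linarith [hθ₁.1], by linarith [hθ₁.2]⟩, θ₂,
        ⟨by linarith [hθ₂.1], by linarith [hθ₂.2]⟩, e₁, e₂, fun _ _ => notMem_empty _⟩
    · exact hd.exists_arc hu hv huB hvB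
  clear hu hv huB hvB
  wlog hle : θ₁ ≤ θ₂ generalizing θ₁ θ₂ u v
  · exact (this θ₂ hθ₂ θ₁ hθ₁ e₂ e₁ (by rwa [uIcc_comm]) (le_of_not_ge hle)).symm
  rw [uIcc_of_le hle] at hθ
  have hmem : ∀ t ∈ Icc (r * θ₁) (r * θ₂), t / r ∈ Icc θ₁ θ₂ := fun t ht =>
    ⟨by rw [le_div_iff₀ hr, mul_comm]; exact ht.1, by rw [div_le_iff₀ hr, mul_comm]; exact ht.2⟩
  have h := link_of_Icc (D := D) (ρ := ρ) (w := w) (A := {z | dist x z = r} \ B)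
    (γ := fun t => P.Φ x r (t / r)) (s := r * θ₁) (t := r * θ₂)
    (l := P.circleCost D ρ w x r) (mul_le_mul_of_nonneg_left hle hr.le) ?_ ?_ ?_
  · simpa [mul_div_cancel_left₀ _ hr.ne', e₁, e₂] using h
  · refine LipschitzOnWith.of_dist_le_mul fun s _ t _ => ?_
    refine (P.dist_same_le x _ _ hr.le hk).trans ?_
    rw [← sub_div, abs_div, abs_of_pos hr, NNReal.coe_one, one_mul, Real.dist_eq]
    calc P.rad r * (|s - t| / r) ≤ r * (|s - t| / r) := by
          gcongr; exact P.rad_le hr.le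
      _ = |s - t| := by field_simp
  · intro t ht
    exact ⟨P.dist_polar x _ hr.le hk, hθ _ (hmem t ht)⟩
  · unfold pathCost circleCost
    refine add_le_add (lintegral_mono_set ?_) (ENNReal.tsum_le_tsum fun i => ?_)
    · intro t ht
      constructor
      · have := mul_le_mul_of_nonneg_left hθ₁.1 hr.le
        linarith [ht.1]
      · have := mul_le_mul_of_nonneg_left hθ₂.2 hr.le
        linarith [ht.2]
    · by_cases hi : (Metric.sphere x r ∩ (D i).carrier).Nonempty
      · rw [indicator_of_mem (s := {r | (Metric.sphere x r ∩ (D i).carrier).Nonempty}) hi]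
        exact indicator_le_self' (fun _ _ => zero_le) i
      · rw [indicator_of_notMem]
        · exact zero_le
        · rintro ⟨_, ⟨t, ht, rfl⟩, hz⟩
          exact hi ⟨_, P.dist_polar' x _ hr.le hk, hz⟩

variable (P)

/-- There are short circles, avoiding `T`, in all annuli of relative thickness `1 / q`. -/
def ShortCircles (D : ι → Disk M) (ρ : M → ℝ≥0∞) (w : ι → ℝ≥0∞) (T : Set M) (η q : ℝ) : Prop :=
  ∀ (x : M) (s₁ s₂ : ℝ), 0 < s₁ → s₁ < s₂ → s₂ ≤ 2 * s₁ → P.k * s₂ ^ 2 ≤ 3 →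
    s₂ ≤ q * (s₂ - s₁) →
    ∃ r ∈ Ioo s₁ s₂, P.circleCost D ρ w x r ≤ ENNReal.ofReal η ∧ ∀ p ∈ T, dist x p ≠ r

variable {P}

/-- A larger `q` allows thinner annuli, so it is the stronger requirement. -/
lemma ShortCircles.mono {T : Set M} {η η' q q' : ℝ} (h : P.ShortCircles D ρ w T η q) (hη : η ≤ η')
    (hq : q' ≤ q) : P.ShortCircles D ρ w T η' q' := by
  intro x s₁ s₂ h0 h1 h2 h3 h4
  obtain ⟨r, hr, hc, hT⟩ := h x s₁ s₂ h0 h1 h2 h3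
    (h4.trans (mul_le_mul_of_nonneg_right hq (by linarith)))
  exact ⟨r, hr, hc.trans (ENNReal.ofReal_le_ofReal hη), hT⟩

lemma exists_dist_eq {E : Set M} (hE : IsPreconnected E) (p : M) {a b : M} (ha : a ∈ E)
    (hb : b ∈ E) {s : ℝ} (has : dist p a ≤ s) (hbs : s ≤ dist p b) : ∃ z ∈ E, dist p z = s :=
  hE.intermediate_value ha hb (by fun_prop) ⟨has, hbs⟩

/-- Near a point outside an obstacle there is a point well outside it. -/
lemma IsObstacle.exists_thick {B : Set M} (hB : P.IsObstacle B) {x₀ x₁ : M} {σ : ℝ} (hσ : 0 < σ)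
    (h₀ : x₀ ∉ B) (h₁ : x₁ ∉ B) (h : 200 * σ ≤ dist x₀ x₁) :
    ∃ p, (p = x₀ ∨ 8 * σ ≤ dist x₀ p) ∧ dist x₀ p ≤ 20 * σ ∧ ∀ y, dist p y < 2 * σ → y ∉ B := by
  rcases hB with rfl | ⟨d, hd, rfl⟩
  · exact ⟨x₀, Or.inl rfl, by simpa using hσ.le, fun _ _ => notMem_empty _⟩
  simp only [Disk.carrier, mem_ofPred_eq, not_le] at h₀ h₁
  have hk : P.k * (10 * σ) ^ 2 ≤ 1 / 100 := by
    have h1 : P.k * (200 * σ) ^ 2 ≤ P.k * dist x₀ x₁ ^ 2 :=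
      mul_le_mul_of_nonneg_left (pow_le_pow_left₀ (by positivity) h 2) P.k_nonneg
    have h2 := P.dist_bound x₀ x₁
    linarith
  have hs : d.sign = -1 → 4 * (10 * σ) ≤ d.radius := by
    intro hs
    simp only [Disk.height, hs] at h₀ h₁
    have := dist_triangle_right x₀ x₁ d.center
    linarith
  have hthick : ∀ p, 2 * σ ≤ d.height p → ∀ y, dist p y < 2 * σ → y ∉ d.carrier := by
    intro p hp y hy hyd
    have h1 := hd.height_sub_le p y
    simp only [Disk.carrier, mem_ofPred_eq] at hyd
    linarith
  obtain ⟨p, hp, hp'⟩ := hd.exists_corkscrew h₀.le (by positivity : 0 ≤ 10 * σ) hk hs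
  -- The corkscrew point has depth `10 * σ`. If it is within `8 * σ` of `x₀`, then `x₀` itself has
  -- depth `2 * σ`; otherwise circles around `x₀` passing near it are wide compared with `σ`.
  by_cases h8 : 8 * σ ≤ dist x₀ p
  · exact ⟨p, Or.inr h8, by linarith, hthick p (by linarith)⟩
  · refine ⟨x₀, Or.inl rfl, by simpa using hσ.le, hthick x₀ ?_⟩
    have := hd.height_sub_le p x₀
    rw [dist_comm] at this
    linarith

/-- Circles around `x` of radius slightly smaller than `dist x p` cross small circles around `p`. -/
lemma exists_mem_sphere_inter (P : PolarSpace M) {x p : M} {s s' r σ : ℝ} (hs : dist x p = s)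
    (hσ : 8 * σ ≤ s) (hk : P.k * s ^ 2 ≤ 3) (hs' : s' ∈ Ioo (s - σ / 2) s)
    (hr : r ∈ Ioo σ (2 * σ)) : ∃ z, dist x z = s' ∧ dist p z = r := by
  have hσ0 : 0 < σ := by linarith [hr.1, hr.2]
  have hs'0 : 0 ≤ s' := by linarith [hs'.1]
  have hk' : P.k * s' ^ 2 ≤ 3 :=
    (mul_le_mul_of_nonneg_left (pow_le_pow_left₀ hs'0 hs'.2.le 2) P.k_nonneg).trans hk
  obtain ⟨θ, -, hθ⟩ := P.exists_angle x p 0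
  rw [hs] at hθ
  -- The radial projection of `p` to the circle of radius `s'` is within `σ` of `p`, while another
  -- point of that connected circle is at distance at least `s' / 2`, which exceeds `2 * σ`.
  have h1 := P.dist_radial_le x θ (by linarith) hs'0 hk hk'
  rw [hθ, abs_of_nonneg (by linarith [hs'.2])] at h1
  obtain ⟨y, hy, hy'⟩ := P.exists_far_on_sphere x p hs'0 hk'
  have hpre := P.isPreconnected_setOf_dist_mem x (ordConnected_singleton (a := s'))
  obtain ⟨z, hz, hz'⟩ := exists_dist_eq hpre p (a := P.Φ x s' θ) (b := y) (s := r)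
    (P.dist_polar x θ hs'0 (by linarith)) hy (by linarith [hr.1, hs'.1]) (by linarith [hr.2, hs'.1])
  exact ⟨z, hz, hz'⟩

/-- A large connected set is linked, outside an obstacle, to short circles around points that are
well outside the obstacle. -/
theorem ShortCircles.exists_link_sphere {T : Set M} {η Q : ℝ}
    (hS : P.ShortCircles D ρ w T η (2 * (28 + Q))) (hQ : 0 ≤ Q) {B : Set M} (hB : P.IsObstacle B)
    {E : Set M} (hE : IsPreconnected E) (hEB : Disjoint E B) {x₀ x₁ : M}
    (hx₀ : x₀ ∈ E) (hx₁ : x₁ ∈ E) {σ : ℝ} (hσ : 0 < σ) (hx : 200 * σ ≤ dist x₀ x₁) {q : M}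
    (hq : ∀ y, dist q y < 2 * σ → y ∉ B) (hxq : dist x₀ q ≤ Q * σ) {s : ℝ}
    (hs : s ∈ Ioo σ (2 * σ)) :
    ∃ e ∈ E, ∃ z, dist q z = s ∧
      Link D ρ w ((Metric.closedBall x₀ ((80 + 2 * Q) * σ) \ B) \ T) e z
        (ENNReal.ofReal η + ENNReal.ofReal η + ENNReal.ofReal η) := by
  have hkσ : P.k * σ ^ 2 ≤ 1 / 10000 := by
    have h1 : P.k * (200 * σ) ^ 2 ≤ P.k * dist x₀ x₁ ^ 2 :=
      mul_le_mul_of_nonneg_left (pow_le_pow_left₀ (by positivity) hx 2) P.k_nonneg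
    have h2 := P.dist_bound x₀ x₁
    linarith
  have hk0 := P.k_nonneg
  have hnB : ∀ z ∈ E, z ∉ B := fun z hz hzB => hEB.le_bot ⟨hz, hzB⟩
  obtain ⟨p, hp, hp20, hpB⟩ := hB.exists_thick hσ (hnB _ hx₀) (hnB _ hx₁) hx
  -- a short circle around `p`
  obtain ⟨s₁, hs₁, hc₁, hT₁⟩ := hS p σ (2 * σ) hσ (by linarith) le_rfl (by nlinarith)
    (by nlinarith)
  have hpB' : ∀ z, dist p z = s₁ → z ∉ B := fun z hz => hpB z (hz ▸ hs₁.2)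
  have hcirc : ∀ {x : M} {r R : ℝ}, 0 < r → P.circleCost D ρ w x r ≤ ENNReal.ofReal η →
      (∀ y ∈ T, dist x y ≠ r) → dist x₀ x + r ≤ (80 + 2 * Q) * σ →
      ∀ {u v}, dist x u = r → dist x v = r → u ∉ B → v ∉ B →
      Link D ρ w ((Metric.closedBall x₀ ((80 + 2 * Q) * σ) \ B) \ T) u v (ENNReal.ofReal η) := by
    intro x r R hr hc hT hR u v hu hv huB hvB
    refine (hB.link hr hu hv huB hvB).mono ?_ hc
    rintro z ⟨hz, hzB⟩
    refine ⟨⟨?_, hzB⟩, fun hzT => hT z hzT hz⟩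
    rw [Metric.mem_closedBall, dist_comm]
    have hz' : dist x z = r := hz
    linarith [dist_triangle x₀ x z]
  -- from `E` to the circle around `p`
  obtain ⟨e, he, a, ha, hlink₁⟩ : ∃ e ∈ E, ∃ a, dist p a = s₁ ∧
      Link D ρ w ((Metric.closedBall x₀ ((80 + 2 * Q) * σ) \ B) \ T) e a (ENNReal.ofReal η) := by
    rcases hp with rfl | hp8
    · obtain ⟨e, he, hes⟩ := exists_dist_eq hE p hx₀ hx₁ (s := s₁)
        (by rw [dist_self]; linarith [hs₁.1]) (by linarith [hs₁.2])
      exact ⟨e, he, e, hes, hcirc (R := 0) (by linarith [hs₁.1]) hc₁ hT₁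
        (by rw [dist_self]; nlinarith [hs₁.2]) hes hes (hnB e he) (hnB e he)⟩
    · have hk3 : P.k * dist x₀ p ^ 2 ≤ 3 := by
        have : P.k * dist x₀ p ^ 2 ≤ P.k * (20 * σ) ^ 2 := by gcongr
        linarith
      obtain ⟨s₀, hs₀, hc₀, hT₀⟩ := hS x₀ (dist x₀ p - σ / 2) (dist x₀ p) (by linarith)
        (by linarith) (by linarith) hk3 (by nlinarith)
      obtain ⟨e, he, hes⟩ := exists_dist_eq hE x₀ hx₀ hx₁ (s := s₀)
        (by rw [dist_self]; linarith [hs₀.1]) (by linarith [hs₀.2])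
      obtain ⟨a, ha, ha'⟩ := exists_mem_sphere_inter P rfl hp8 hk3 hs₀ hs₁
      exact ⟨e, he, a, ha', hcirc (R := 0) (by linarith [hs₀.1]) hc₀ hT₀
        (by rw [dist_self]; nlinarith [hs₀.2]) hes ha (hnB e he) (hpB' a ha')⟩
  -- a circle that passes near `p` and `q`
  have hpq : dist p q ≤ (20 + Q) * σ := by
    have := dist_triangle_left p q x₀
    linarith
  -- The circle around `x` passes near both `p` and `q`. Its radius `t` is at least `8 * σ` so that
  -- it crosses the small circles, and at least `dist p q` so that `x` exists, unless that is too
  -- much for the sphere and `√2` serves. An annulus of thickness `σ / 2` and radius at most `(28 +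
  -- Q) * σ` accounts for `2 * (28 + Q)`.
  obtain ⟨t, ht8, htQ, htk, x, hxp, hxq'⟩ : ∃ t, 8 * σ ≤ t ∧ t ≤ (28 + Q) * σ ∧ P.k * t ^ 2 ≤ 2 ∧
      ∃ x, dist x p = t ∧ dist x q = t := by
    set t₀ := max (dist p q) (8 * σ) with ht₀
    have h8 : 8 * σ ≤ t₀ := le_max_right _ _
    have hle : t₀ ≤ (28 + Q) * σ := max_le (by linarith) (by nlinarith)
    by_cases hk2 : P.k * t₀ ^ 2 ≤ 2
    · obtain ⟨x, h1, h2⟩ := P.exists_equidistant p q (s := t₀) (by linarith) hk2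
        (Or.inl (le_max_left _ _))
      exact ⟨t₀, h8, hle, hk2, x, h1, h2⟩
    · have hk1 : P.k = 1 := by
        rcases P.k_eq with h | h
        · rw [h] at hk2; norm_num at hk2
        · exact h
      rw [hk1, one_mul, not_le] at hk2
      rw [hk1] at hkσ
      have hsq : P.k * √2 ^ 2 = 2 := by rw [hk1]; norm_num
      obtain ⟨x, h1, h2⟩ := P.exists_equidistant p q (s := √2) (by positivity) hsq.le (Or.inr hsq)
      refine ⟨√2, ?_, ?_, hsq.le, x, h1, h2⟩
      · apply Real.le_sqrt_of_sq_le; nlinarith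
      · refine le_trans ?_ hle
        rw [Real.sqrt_le_left (by linarith)]
        exact hk2.le
  obtain ⟨s₃, hs₃, hc₃, hT₃⟩ := hS x (t - σ / 2) t (by linarith) (by linarith) (by linarith)
    (by linarith) (by nlinarith)
  obtain ⟨b, hb, hb'⟩ := exists_mem_sphere_inter P hxp ht8 (by linarith) hs₃ hs₁
  obtain ⟨z, hz, hz'⟩ := exists_mem_sphere_inter P hxq' ht8 (by linarith) hs₃ hs
  refine ⟨e, he, z, hz', ?_⟩
  have hlink₂ := hcirc (R := 0) (by linarith [hs₁.1]) hc₁ hT₁ (by nlinarith [hs₁.2]) ha hb'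
    (hpB' a ha) (hpB' b hb')
  have hx₀x : dist x₀ x ≤ 20 * σ + t := by
    have := dist_triangle x₀ p x
    rw [dist_comm p x] at this
    linarith
  have hlink₃ := hcirc (R := 0) (by linarith [hs₃.1]) hc₃ hT₃ (by nlinarith [hs₃.2]) hb hz
    (hpB' b hb') (hq z (hz' ▸ hs.2))
  exact (hlink₁.trans hlink₂).trans hlink₃

/-- Two large connected sets are linked outside an obstacle, at a scale comparable with their
distance. -/
theorem ShortCircles.exists_link_local {T : Set M} {η Q : ℝ}
    (hS : P.ShortCircles D ρ w T η (2 * (48 + Q))) (hQ : 0 ≤ Q) {B : Set M} (hB : P.IsObstacle B)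
    {E F : Set M} (hE : IsPreconnected E) (hF : IsPreconnected F) (hEB : Disjoint E B)
    (hFB : Disjoint F B) {x₀ x₁ y₀ y₁ : M} (hx₀ : x₀ ∈ E) (hx₁ : x₁ ∈ E)
    (hy₀ : y₀ ∈ F) (hy₁ : y₁ ∈ F) {σ : ℝ} (hσ : 0 < σ) (hx : 200 * σ ≤ dist x₀ x₁)
    (hy : 200 * σ ≤ dist y₀ y₁) (hxy : dist x₀ y₀ ≤ Q * σ) :
    ∃ e ∈ E, ∃ f ∈ F, Link D ρ w ((Metric.closedBall x₀ ((120 + 3 * Q) * σ) \ B) \ T) e f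
      (7 * ENNReal.ofReal η) := by
  have hkσ : P.k * σ ^ 2 ≤ 1 / 10000 := by
    have h1 : P.k * (200 * σ) ^ 2 ≤ P.k * dist x₀ x₁ ^ 2 :=
      mul_le_mul_of_nonneg_left (pow_le_pow_left₀ (by positivity) hx 2) P.k_nonneg
    have h2 := P.dist_bound x₀ x₁
    linarith
  have hnB : ∀ z ∈ E, z ∉ B := fun z hz hzB => hEB.le_bot ⟨hz, hzB⟩
  -- Both sets are linked to the same short circle around `q`. Two links of cost `3η` and one arc of
  -- that circle give `7η`.
  obtain ⟨q, -, hq20, hqB⟩ := hB.exists_thick hσ (hnB _ hx₀) (hnB _ hx₁) hx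
  obtain ⟨s, hs, hc, hT⟩ := hS q σ (2 * σ) hσ (by linarith) le_rfl (by nlinarith)
    (by nlinarith)
  obtain ⟨e, he, z, hz, hl⟩ := (hS.mono le_rfl (by linarith)).exists_link_sphere (Q := 20)
    (by norm_num) hB hE hEB hx₀ hx₁ hσ hx hqB hq20 hs
  obtain ⟨f, hf, z', hz', hl'⟩ := (hS.mono le_rfl (by linarith)).exists_link_sphere (Q := 20 + Q)
    (by positivity) hB hF hFB hy₀ hy₁ hσ hy hqB
    (by have := dist_triangle_left y₀ q x₀; linarith) hs
  have hlz := hB.link (D := D) (ρ := ρ) (w := w) (by linarith [hs.1]) hz hz'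
    (hqB z (hz ▸ hs.2)) (hqB z' (hz' ▸ hs.2))
  refine ⟨e, he, f, hf, ?_⟩
  have k1 := hl.mono (A' := (Metric.closedBall x₀ ((120 + 3 * Q) * σ) \ B) \ T)
    (sdiff_subset_sdiff_left (sdiff_subset_sdiff_left
      (Metric.closedBall_subset_closedBall (by nlinarith)))) le_rfl
  have k2 := hl'.symm.mono (A' := (Metric.closedBall x₀ ((120 + 3 * Q) * σ) \ B) \ T)
    (sdiff_subset_sdiff_left (sdiff_subset_sdiff_left
      (Metric.closedBall_subset_closedBall' (by rw [dist_comm]; nlinarith)))) le_rfl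
  have k3 := hlz.mono (A' := (Metric.closedBall x₀ ((120 + 3 * Q) * σ) \ B) \ T)
    (by
      rintro y ⟨hy, hyB⟩
      refine ⟨⟨?_, hyB⟩, fun hyT => hT y hyT hy⟩
      have hy' : dist q y = s := hy
      rw [Metric.mem_closedBall, dist_comm]
      nlinarith [dist_triangle x₀ q y, hs.2]) hc
  refine ((k1.trans k3).trans k2).mono subset_rfl (le_of_eq ?_)
  ring

end PolarSpace


/-! ### Induction over finitely many separated discs -/

namespace PolarSpace

variable {M : Type*} [MetricSpace M] {P : PolarSpace M} {ι : Type*}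
  {D : ι → Disk M} {ρ : M → ℝ≥0∞} {w : ι → ℝ≥0∞} {T : Set M}

/-- The complement of finitely many discs and of a set `T`. -/
def avoid (D : ι → Disk M) (J : Finset ι) (T : Set M) : Set M :=
  {z | z ∉ T ∧ ∀ j ∈ J, z ∉ (D j).carrier}

variable (P) in
/-- Disjoint round discs with uniformly relatively separated boundary circles. -/
structure IsSeparated (D : ι → Disk M) (c : ℝ) : Prop where
  round : ∀ i, P.IsRound (D i)
  disjoint : Pairwise fun i j => Disjoint (D i).carrier (D j).carrier
  sep : ∀ i j, i ≠ j → ∀ u v, (D i).height u = 0 → (D j).height v = 0 →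
    c * min (D i).radius (D j).radius ≤ dist u v

lemma IsRound.exists_height_eq_zero {d : Disk M} (hd : P.IsRound d) {x : M} (h₀ : 0 ≤ d.height x)
    (h : d.height x ≤ d.radius / 100) : ∃ u, d.height u = 0 ∧ dist x u ≤ 2 * d.height x := by
  obtain ⟨θ, -, hθ⟩ := P.exists_angle d.center x 0
  have hr := hd.pos
  have hk := hd.le
  have habs : |dist d.center x - d.radius| = d.height x := by
    rcases hd.sign with e | e
    · simp only [Disk.height, e, dist_comm x] at h₀ h ⊢
      rw [abs_of_nonneg (by linarith)]; ring
    · simp only [Disk.height, e, dist_comm x] at h₀ h ⊢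
      rw [abs_of_nonpos (by linarith)]; ring
  have hle : dist d.center x ≤ 101 / 100 * d.radius := by
    have := (abs_le.1 habs.le).2
    linarith
  have hk3 : P.k * dist d.center x ^ 2 ≤ 3 := by
    have : P.k * dist d.center x ^ 2 ≤ P.k * (101 / 100 * d.radius) ^ 2 :=
      mul_le_mul_of_nonneg_left (pow_le_pow_left₀ dist_nonneg hle 2) P.k_nonneg
    nlinarith
  refine ⟨P.Φ d.center d.radius θ, ?_, ?_⟩
  · rw [hd.height_eq_zero, Metric.mem_sphere, P.dist_polar' _ _ hr.le (by linarith)]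
  · have := P.dist_radial_le d.center θ dist_nonneg hr.le hk3 (by linarith)
    rwa [hθ, habs] at this

/-- Near a smallest disc there are no other discs. -/
lemma IsSeparated.notMem_of_near {c κ : ℝ} (hD : P.IsSeparated D c) {i j : ι} (hij : j ≠ i)
    (hr : (D i).radius ≤ (D j).radius) (hκ : κ ≤ 1 / 100) (hκc : 200 * κ ≤ c) {x z : M}
    (h₀ : 0 ≤ (D i).height x) (hx : (D i).height x ≤ κ * (D i).radius)
    (hz : dist x z < 198 * κ * (D i).radius) : z ∉ (D j).carrier := by
  have hr0 := (hD.round i).pos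
  obtain ⟨u, hu, hxu⟩ := (hD.round i).exists_height_eq_zero h₀ (by nlinarith)
  have huz : dist u z < c * (D i).radius := by
    have h1 := dist_triangle_left u z x
    have h2 : 200 * κ * (D i).radius ≤ c * (D i).radius := by gcongr
    nlinarith
  intro hzj
  have hpos : 0 < c * (D i).radius := dist_nonneg.trans_lt huz
  have huj : 0 < (D j).height u := by
    by_contra hcon
    exact (hD.disjoint hij).le_bot ⟨not_lt.1 hcon, hu.le⟩
  -- A ball around the circle point `u` that reached disc `j` would contain a point of its boundary
  -- circle, closer to `u` than the separation permits.
  have hpre := (P.isPathConnected_ball u hpos).isConnected.isPreconnected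
  obtain ⟨v, hv, hv0⟩ := hpre.intermediate_value (f := (D j).height)
    (show z ∈ Metric.ball u _ by rwa [Metric.mem_ball, dist_comm]) (Metric.mem_ball_self hpos)
    (D j).continuous_height.continuousOn ⟨hzj, huj.le⟩
  have h1 := hD.sep i j hij.symm u v hu hv0
  rw [min_eq_left hr] at h1
  rw [Metric.mem_ball, dist_comm] at hv
  linarith

/-- A path that avoids all discs but one either avoids that one or leads to a given circle
around it. -/
lemma link_or_link_height [DecidableEq ι] {J : Finset ι} {i : ι} {τ : ℝ} (hτ : 0 < τ)
    {l : ℝ≥0∞} (hcirc : ∀ u, (D i).height u = τ → u ∈ avoid D J T → Link D ρ w (avoid D J T) u u l)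
    {E : Set M} (hE : IsPreconnected E) (hEA : E ⊆ avoid D J T) {p : M} (hp : p ∈ E)
    (hpτ : τ ≤ (D i).height p) {e f : M} (he : e ∈ E) {l' : ℝ≥0∞}
    (h : Link D ρ w (avoid D (J.erase i) T) e f l') :
    Link D ρ w (avoid D J T) e f l' ∨
      ∃ e' ∈ E, ∃ u, (D i).height u = τ ∧ Link D ρ w (avoid D J T) e' u (l + l') := by
  have hmem : ∀ z ∈ avoid D (J.erase i) T, 0 < (D i).height z → z ∈ avoid D J T := by
    refine fun z hz hzi => ⟨hz.1, fun j hj => ?_⟩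
    by_cases hji : j = i
    · subst hji; exact not_le.2 hzi
    · exact hz.2 j (Finset.mem_erase.2 ⟨hji, hj⟩)
  obtain ⟨L, γ, h0, h1, h2, h3, h4, h5⟩ := h
  -- If `e` is below level `τ`, then `E`, which also contains `p`, crosses the level itself.
  by_cases heτ : (D i).height e < τ
  · obtain ⟨u, hu, huτ⟩ := hE.intermediate_value he hp (D i).continuous_height.continuousOn
      ⟨heτ.le, hpτ⟩
    exact Or.inr ⟨u, hu, u, huτ, (hcirc u huτ (hEA hu)).mono subset_rfl le_self_add⟩
  rw [not_lt] at heτ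
  have hcont : ContinuousOn (fun t => (D i).height (γ t)) (Icc 0 L) :=
    (D i).continuous_height.comp_continuousOn h1.continuousOn
  -- Otherwise stop the path the first time it reaches level `τ`; until then it is outside disc `i`.
  by_cases hS : (Icc 0 L ∩ (fun t => (D i).height (γ t)) ⁻¹' Iic τ).Nonempty
  · have hcl : IsClosed (Icc 0 L ∩ (fun t => (D i).height (γ t)) ⁻¹' Iic τ) :=
      hcont.preimage_isClosed_of_isClosed isClosed_Icc isClosed_Iic
    obtain ⟨t₀, ⟨ht₀, ht₀τ⟩, hleast⟩ :=
      (isCompact_Icc.of_isClosed_subset hcl inter_subset_left).exists_isLeast hS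
    have hsub : Icc 0 t₀ ⊆ Icc 0 L := Icc_subset_Icc_right ht₀.2
    have heq : (D i).height (γ t₀) = τ := by
      obtain ⟨t, ht, htτ⟩ := intermediate_value_Icc' ht₀.1 (hcont.mono hsub)
        ⟨ht₀τ, by simpa only [h3] using heτ⟩
      have := hleast ⟨hsub ht, (show (D i).height (γ t) ≤ τ from htτ.le)⟩
      rwa [le_antisymm ht.2 this] at htτ
    refine Or.inr ⟨e, he, γ t₀, heq, ?_⟩
    rw [← h3]
    refine link_of_Icc ht₀.1 (h1.mono hsub) (fun t ht => hmem _ (h2 (hsub ht)) ?_)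
      ((pathCost_mono γ hsub).trans (h5.trans le_add_self))
    rcases ht.2.eq_or_lt with e | hlt
    · rw [e, heq]; exact hτ
    · refine hτ.trans (not_le.1 fun hcon => ?_)
      exact (not_le.2 hlt) (hleast ⟨hsub ht, hcon⟩)
  · refine Or.inl ⟨L, γ, h0, h1, fun t ht => hmem _ (h2 ht) (hτ.trans (not_le.1 fun hcon => ?_)),
      h3, h4, h5⟩
    exact hS ⟨t, ht, hcon⟩

/-- A path that avoids all discs but a smallest one can be led around that one. -/
lemma IsSeparated.exists_detour [DecidableEq ι] {c κ η q : ℝ} (hD : P.IsSeparated D c)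
    (hS : P.ShortCircles D ρ w T η q) (hκ0 : 0 < κ) (hκ : κ ≤ 1 / 100) (hκc : 200 * κ ≤ c)
    (hq : 4 / κ ≤ q) {J : Finset ι} {i : ι} (hmin : ∀ j ∈ J, (D i).radius ≤ (D j).radius)
    {E F : Set M} (hE : IsPreconnected E) (hF : IsPreconnected F) (hEA : E ⊆ avoid D J T)
    (hFA : F ⊆ avoid D J T) {p p' : M} (hp : p ∈ E) (hp' : p' ∈ F)
    (hpκ : κ * (D i).radius ≤ (D i).height p) (hpκ' : κ * (D i).radius ≤ (D i).height p')
    {e f : M} (he : e ∈ E) (hf : f ∈ F) {l : ℝ≥0∞}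
    (h : Link D ρ w (avoid D (J.erase i) T) e f l) :
    ∃ e ∈ E, ∃ f ∈ F, Link D ρ w (avoid D J T) e f (2 * l + 3 * ENNReal.ofReal η) := by
  have hr := (hD.round i).pos
  have hk := (hD.round i).le
  have hk0 := P.k_nonneg
  have hκr : κ * (D i).radius ≤ (D i).radius / 100 := by nlinarith
  have hκr0 : 0 < κ * (D i).radius := by positivity
  have hqκ : 4 * (D i).radius ≤ q * (κ * (D i).radius) := by
    have : 4 ≤ q * κ := by rwa [div_le_iff₀ hκ0] at hq
    nlinarith
  -- a short circle in the collar
  obtain ⟨τ, hτ, R, hR0, hR, hc, hT⟩ : ∃ τ ∈ Ioo (κ * (D i).radius / 2) (κ * (D i).radius),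
      ∃ R, 0 < R ∧ (∀ u, (D i).height u = τ ↔ dist (D i).center u = R) ∧
      P.circleCost D ρ w (D i).center R ≤ ENNReal.ofReal η ∧ ∀ y ∈ T, dist (D i).center y ≠ R := by
    have hk2 : P.k * (101 / 100 * (D i).radius) ^ 2 ≤ 3 := by nlinarith
    rcases (hD.round i).sign with hs | hs
    · have hk3 : P.k * ((D i).radius + κ * (D i).radius) ^ 2 ≤ 3 := by
        refine le_trans ?_ hk2
        gcongr; linarith
      obtain ⟨R, hR, hc, hT⟩ := hS (D i).center ((D i).radius + κ * (D i).radius / 2)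
        ((D i).radius + κ * (D i).radius) (by positivity) (by linarith) (by linarith) hk3
        (by linarith)
      refine ⟨R - (D i).radius, ⟨by linarith [hR.1], by linarith [hR.2]⟩, R, by linarith [hR.1],
        fun u => ?_, hc, hT⟩
      simp only [Disk.height, hs, one_mul, dist_comm u]
      constructor <;> intro h <;> linarith
    · have hk3 : P.k * ((D i).radius - κ * (D i).radius / 2) ^ 2 ≤ 3 := by
        refine le_trans ?_ hk2
        gcongr
        · linarith
        · linarith
      obtain ⟨R, hR, hc, hT⟩ := hS (D i).center ((D i).radius - κ * (D i).radius)
        ((D i).radius - κ * (D i).radius / 2) (by linarith) (by linarith) (by linarith) hk3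
        (by linarith)
      refine ⟨(D i).radius - R, ⟨by linarith [hR.2], by linarith [hR.1]⟩, R, by linarith [hR.1],
        fun u => ?_, hc, hT⟩
      simp only [Disk.height, hs, dist_comm u]
      constructor <;> intro h <;> linarith
  have hτ0 : 0 < τ := by linarith [hτ.1]
  have hlink : ∀ u v, (D i).height u = τ → (D i).height v = τ →
      Link D ρ w (avoid D J T) u v (ENNReal.ofReal η) := by
    intro u v hu hv
    refine (IsObstacle.link (P := P) (Or.inl rfl) hR0 ((hR u).1 hu) ((hR v).1 hv) (notMem_empty _)
      (notMem_empty _)).mono ?_ hc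
    rintro z ⟨hz, -⟩
    have hzR : dist (D i).center z = R := hz
    have hzτ := (hR z).2 hzR
    refine ⟨fun hzT => hT z hzT hzR, fun j hj => ?_⟩
    by_cases hji : j = i
    · subst hji
      intro hcon
      have : (D j).height z ≤ 0 := hcon
      linarith
    · exact hD.notMem_of_near hji (hmin j hj) hκ hκc (x := z) (by linarith) (by linarith [hτ.2])
        (by rw [dist_self]; positivity)
  -- Run along the path from each end to the collar circle. If one run never gets there, the path
  -- already avoids disc `i`; otherwise the two runs, of cost `l + η` each, are joined along the
  -- circle.
  rcases link_or_link_height hτ0 (fun u hu _ => hlink u u hu hu) hE hEA hp (by linarith [hτ.2]) he h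
    with h1 | ⟨e', he', u, hu, h1⟩
  · refine ⟨e, he, f, hf, h1.mono subset_rfl ?_⟩
    rw [two_mul, add_assoc]
    exact le_self_add
  rcases link_or_link_height hτ0 (fun u hu _ => hlink u u hu hu) hF hFA hp' (by linarith [hτ.2]) hf
    h.symm with h2 | ⟨f', hf', v, hv, h2⟩
  · refine ⟨e, he, f, hf, h2.symm.mono subset_rfl ?_⟩
    rw [two_mul, add_assoc]
    exact le_self_add
  refine ⟨e', he', f', hf', ((h1.trans (hlink u v hu hv)).trans h2.symm).mono subset_rfl ?_⟩
  exact le_of_eq (by ring)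

/-- A large set in the collar of a smallest disc is linked to a circle outside the collar. -/
lemma IsSeparated.exists_escape {c κ η Q : ℝ} (hD : P.IsSeparated D c) (hQ : 0 ≤ Q)
    (hS : P.ShortCircles D ρ w T η (2 * (58 + 10 * Q))) (hκ0 : 0 < κ) (hκ : κ ≤ 1 / 100)
    (hκc : 200 * κ ≤ c) {J : Finset ι} {i : ι} (hi : i ∈ J)
    (hmin : ∀ j ∈ J, (D i).radius ≤ (D j).radius) {E : Set M} (hE : IsPreconnected E)
    (hEA : E ⊆ avoid D J T) {x₀ x₁ : M} (hx₀ : x₀ ∈ E) (hx₁ : x₁ ∈ E) {σ : ℝ} (hσ : 0 < σ)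
    (hx : 200 * σ ≤ dist x₀ x₁) (hσκ : σ ≤ κ * (D i).radius)
    (hσQ : κ * (D i).radius ≤ (3 + Q) * σ) :
    ∃ E', IsPreconnected E' ∧ E' ⊆ avoid D J T ∧
      (∃ p ∈ E', κ * (D i).radius ≤ (D i).height p) ∧
      (∃ x₀' ∈ E', ∃ x₁' ∈ E', σ / 2 ≤ dist x₀' x₁' ∧ dist x₀ x₀' ≤ 12 * (3 + Q) * σ) ∧
      ∀ z ∈ E', ∀ y l, Link D ρ w (avoid D J T) z y l →
        ∃ e ∈ E, Link D ρ w (avoid D J T) e y (4 * ENNReal.ofReal η + l) := by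
  have hr := (hD.round i).pos
  have hk := (hD.round i).le
  have hk0 := P.k_nonneg
  set m := κ * (D i).radius with hm
  have hm0 : 0 < m := by positivity
  have hmr : m ≤ (D i).radius / 100 := by rw [hm]; nlinarith
  -- A set that already leaves the collar needs no replacement.
  by_cases hcol : ∃ p ∈ E, m ≤ (D i).height p
  · refine ⟨E, hE, hEA, hcol, ⟨x₀, hx₀, x₁, hx₁, by linarith, by rw [dist_self]; positivity⟩, ?_⟩
    exact fun z hz y l h => ⟨z, hz, h.mono subset_rfl le_add_self⟩
  push Not at hcol
  have hhx : 0 < (D i).height x₀ := not_le.1 ((hEA hx₀).2 i hi)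
  have hxm := hcol x₀ hx₀
  have hkm : P.k * (5 * m) ^ 2 ≤ 1 / 100 := by
    have : P.k * (5 * m) ^ 2 ≤ P.k * ((D i).radius / 20) ^ 2 := by gcongr; linarith
    linarith
  -- The point `q` has height at least `5 * m`, so a circle around it of radius below `2 * σ` lies
  -- beyond the collar. That circle is the new set `E'`.
  obtain ⟨q, hq, hhq⟩ := (hD.round i).exists_corkscrew hhx.le (by positivity : 0 ≤ 5 * m) hkm
    (fun _ => by linarith)
  have hqB : ∀ y, dist q y < 2 * σ → m < (D i).height y := by
    intro y hy
    have := (hD.round i).height_sub_le q y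
    linarith
  obtain ⟨s, hs, hc, hT⟩ := hS q σ (2 * σ) hσ (by linarith) le_rfl
    (by
      have : P.k * (2 * σ) ^ 2 ≤ P.k * (5 * m) ^ 2 := by gcongr; linarith
      linarith) (by nlinarith)
  -- All of this happens near `x₀`, where disc `i` is the only one of `J` that can be met: the
  -- problem with one obstacle.
  have hnear : ∀ z, dist x₀ z ≤ 100 * m → ∀ j ∈ J, j ≠ i → z ∉ (D j).carrier := by
    intro z hz j hj hji
    exact hD.notMem_of_near hji (hmin j hj) hκ hκc hhx.le hxm.le (by rw [mul_assoc]; linarith)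
  have hE' : ∀ z, dist q z = s → z ∈ avoid D J T := by
    intro z hz
    refine ⟨fun hzT => hT z hzT hz, fun j hj => ?_⟩
    by_cases hji : j = i
    · subst hji
      have := hqB z (hz ▸ hs.2)
      exact not_le.2 (hm0.trans this)
    · exact hnear z (by linarith [dist_triangle x₀ q z, hs.2]) j hj hji
  have hs0 : 0 < s := by linarith [hs.1]
  have hks : P.k * s ^ 2 ≤ 3 := by
    have : P.k * s ^ 2 ≤ P.k * (5 * m) ^ 2 := by gcongr; linarith [hs.2]
    linarith
  have hB : P.IsObstacle (D i).carrier := Or.inr ⟨_, hD.round i, rfl⟩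
  obtain ⟨a, ha, -⟩ := P.exists_far_on_sphere q q hs0.le hks
  obtain ⟨b, hb, hab⟩ := P.exists_far_on_sphere q a hs0.le hks
  refine ⟨{z | dist q z = s}, P.isPreconnected_setOf_dist_mem q (ordConnected_singleton (a := s)),
    hE', ⟨a, ha, (hqB a (ha ▸ hs.2)).le⟩, ⟨a, ha, b, hb, by linarith [hs.1], ?_⟩, ?_⟩
  · have : dist x₀ a ≤ 12 * m := by linarith [dist_triangle x₀ q a, hs.2]
    nlinarith
  · intro z hz y l hzy
    have hQ' : 10 * m / σ ≤ 10 * (3 + Q) := by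
      rw [div_le_iff₀ hσ]; linarith
    have hσm : 10 * m / σ * σ = 10 * m := by field_simp
    obtain ⟨e, he, z', hz', hl⟩ := (hS.mono le_rfl
      (by linarith : 2 * (28 + 10 * m / σ) ≤ _)).exists_link_sphere (by positivity) hB hE
      (Set.disjoint_left.2 fun u hu => (hEA hu).2 i hi) hx₀ hx₁ hσ hx (q := q)
      (fun y hy => not_le.2 (hm0.trans (hqB y hy))) (by rw [hσm]; linarith) hs
    have hl' : Link D ρ w (avoid D J T) e z' (ENNReal.ofReal η + ENNReal.ofReal η +
        ENNReal.ofReal η) := by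
      refine hl.mono ?_ le_rfl
      rintro u ⟨⟨hu, huB⟩, huT⟩
      refine ⟨huT, fun j hj => ?_⟩
      by_cases hji : j = i
      · subst hji; exact huB
      · refine hnear u ?_ j hj hji
        rw [Metric.mem_closedBall, dist_comm] at hu
        nlinarith
    have hlz : Link D ρ w (avoid D J T) z' z (ENNReal.ofReal η) :=
      (IsObstacle.link (P := P) (Or.inl rfl) hs0 hz' hz (notMem_empty _)
        (notMem_empty _)).mono (fun u hu => hE' u hu.1) hc
    refine ⟨e, he, ((hl'.trans hlz).trans hzy).mono subset_rfl (le_of_eq (by ring))⟩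

/-- Outside finitely many uniformly relatively separated discs, large connected sets are linked at
small cost if there are sufficiently many short circles. -/
theorem IsSeparated.exists_link {c : ℝ} (hc : 0 < c) (hD : P.IsSeparated D c) (n : ℕ) :
    ∀ Q η : ℝ, 0 ≤ Q → 0 < η → ∃ η' > 0, ∃ q > 0, ∀ (ρ : M → ℝ≥0∞) (w : ι → ℝ≥0∞) (T : Set M),
      P.ShortCircles D ρ w T η' q → ∀ J : Finset ι, J.card ≤ n →
      ∀ E F : Set M, IsPreconnected E → IsPreconnected F → E ⊆ avoid D J T → F ⊆ avoid D J T →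
      ∀ x₀ ∈ E, ∀ x₁ ∈ E, ∀ y₀ ∈ F, ∀ y₁ ∈ F, ∀ σ > 0, 200 * σ ≤ dist x₀ x₁ →
      200 * σ ≤ dist y₀ y₁ → dist x₀ y₀ ≤ Q * σ →
      ∃ e ∈ E, ∃ f ∈ F, Link D ρ w (avoid D J T) e f (ENNReal.ofReal η) := by
  classical
  have hempty : ∀ {ρ : M → ℝ≥0∞} {w : ι → ℝ≥0∞} {T : Set M} {Q η : ℝ}, 0 ≤ Q → 0 ≤ η →
      P.ShortCircles D ρ w T (η / 40) (2 * (48 + Q)) →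
      ∀ E F : Set M, IsPreconnected E → IsPreconnected F → E ⊆ avoid D ∅ T → F ⊆ avoid D ∅ T →
      ∀ x₀ ∈ E, ∀ x₁ ∈ E, ∀ y₀ ∈ F, ∀ y₁ ∈ F, ∀ σ > 0, 200 * σ ≤ dist x₀ x₁ →
      200 * σ ≤ dist y₀ y₁ → dist x₀ y₀ ≤ Q * σ →
      ∃ e ∈ E, ∃ f ∈ F, Link D ρ w (avoid D ∅ T) e f (ENNReal.ofReal η) := by
    intro ρ w T Q η hQ hη hS E F hE hF hEA hFA x₀ hx₀ x₁ hx₁ y₀ hy₀ y₁ hy₁ σ hσ hx hy hxy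
    obtain ⟨e, he, f, hf, h⟩ := hS.exists_link_local hQ (Or.inl rfl) hE hF (disjoint_empty _)
      (disjoint_empty _) hx₀ hx₁ hy₀ hy₁ hσ hx hy hxy
    refine ⟨e, he, f, hf, h.mono (fun z hz => ⟨hz.2, by simp⟩) ?_⟩
    rw [show (7 : ℝ≥0∞) = ENNReal.ofReal 7 by simp, ← ENNReal.ofReal_mul (by norm_num)]
    exact ENNReal.ofReal_le_ofReal (by linarith)
  induction n with
  | zero =>
    intro Q η hQ hη
    refine ⟨η / 40, by positivity, 2 * (48 + Q), by positivity, ?_⟩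
    intro ρ w T hS J hJ
    obtain rfl : J = ∅ := by simpa using hJ
    exact hempty hQ hη.le hS
  | succ n ih =>
    intro Q η hQ hη
    -- The relative width of a collar that the other discs of `J` do not meet when disc `i` is a
    -- smallest one.
    set κ := min (c / 200) (1 / 100) with hκdef
    have hκ0 : 0 < κ := lt_min (by positivity) (by norm_num)
    have hκ : κ ≤ 1 / 100 := min_le_right _ _
    have hκc : 200 * κ ≤ c := by linarith [min_le_left (c / 200) (1 / 100 : ℝ)]
    -- After the escape, points of each set are `σ₁ / 2 = 200 * (σ₁ / 400)` apart. The base points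
    -- have moved by at most `12 * (3 + Q) * σ₁` each and were at distance at most `Q * σ ≤ Q / κ *
    -- σ₁`; dividing the scale by `400` multiplies the relative distance accordingly.
    set Q' := 400 * (24 * (3 + Q) + Q / κ) with hQ'
    have hQκ : 0 ≤ Q / κ := by positivity
    have hQ'0 : 0 ≤ Q' := by positivity
    obtain ⟨η₀, hη₀, q₀, hq₀, ih⟩ := ih (Q + Q') (η / 4) (by positivity) (by positivity)
    refine ⟨min η₀ (η / 40), lt_min hη₀ (by positivity),
      max q₀ (200 + 20 * Q + 4 / κ), lt_max_of_lt_left hq₀, ?_⟩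
    intro ρ w T hS J hJ E F hE hF hEA hFA x₀ hx₀ x₁ hx₁ y₀ hy₀ y₁ hy₁ σ hσ hx hy hxy
    have h4κ : 0 < 4 / κ := by positivity
    have hSih : P.ShortCircles D ρ w T η₀ q₀ := hS.mono (min_le_left _ _) (le_max_left _ _)
    have hS' : P.ShortCircles D ρ w T (η / 40) (200 + 20 * Q + 4 / κ) :=
      hS.mono (min_le_right _ _) (le_max_right _ _)
    rcases J.eq_empty_or_nonempty with rfl | hne
    · exact hempty hQ hη.le (hS'.mono le_rfl (by linarith)) E F hE hF hEA hFA x₀ hx₀ x₁ hx₁ y₀ hy₀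
        y₁ hy₁ σ hσ hx hy hxy
    obtain ⟨i, hi, hmin⟩ := J.exists_min_image (fun j => (D j).radius) hne
    have hr := (hD.round i).pos
    set m := κ * (D i).radius with hm
    have hm0 : 0 < m := by positivity
    have hmr : m ≤ (D i).radius / 100 := by rw [hm]; nlinarith
    have ih' := ih ρ w T hSih (J.erase i) (by rw [Finset.card_erase_of_mem hi]; omega)
    have herase : avoid D J T ⊆ avoid D (J.erase i) T := fun z hz =>
      ⟨hz.1, fun j hj => hz.2 j (Finset.mem_of_mem_erase hj)⟩
    -- When one set lies in the collar and the scale `σ` is small against its width, only disc `i`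
    -- is relevant.
    have hlocal : ∀ {E F : Set M} {x₀ x₁ y₀ y₁ : M}, IsPreconnected E → IsPreconnected F →
        E ⊆ avoid D J T → F ⊆ avoid D J T → x₀ ∈ E → x₁ ∈ E → y₀ ∈ F → y₁ ∈ F →
        200 * σ ≤ dist x₀ x₁ → 200 * σ ≤ dist y₀ y₁ → dist x₀ y₀ ≤ Q * σ →
        (∀ p ∈ E, (D i).height p < m) → (120 + 3 * Q) * σ ≤ 50 * m →
        ∃ e ∈ E, ∃ f ∈ F, Link D ρ w (avoid D J T) e f (ENNReal.ofReal η) := by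
      intro E F x₀ x₁ y₀ y₁ hE hF hEA hFA hx₀ hx₁ hy₀ hy₁ hx hy hxy hcol hσm
      obtain ⟨e, he, f, hf, h⟩ := (hS'.mono le_rfl (by linarith)).exists_link_local hQ
        (Or.inr ⟨_, hD.round i, rfl⟩) hE hF (Set.disjoint_left.2 fun u hu => (hEA hu).2 i hi)
        (Set.disjoint_left.2 fun u hu => (hFA hu).2 i hi) hx₀ hx₁ hy₀ hy₁ hσ hx hy hxy
      refine ⟨e, he, f, hf, h.mono ?_ ?_⟩
      · rintro u ⟨⟨hu, huB⟩, huT⟩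
        refine ⟨huT, fun j hj => ?_⟩
        by_cases hji : j = i
        · subst hji; exact huB
        · rw [Metric.mem_closedBall, dist_comm] at hu
          exact hD.notMem_of_near hji (hmin j hj) hκ hκc
            (not_le.1 ((hEA hx₀).2 i hi)).le (hcol _ hx₀).le (by rw [mul_assoc]; linarith)
      · rw [show (7 : ℝ≥0∞) = ENNReal.ofReal 7 by simp, ← ENNReal.ofReal_mul (by norm_num)]
        exact ENNReal.ofReal_le_ofReal (by linarith)
    have hdetour : ∀ {E F : Set M} {x₀ x₁ y₀ y₁ : M} {σ : ℝ}, IsPreconnected E → IsPreconnected F →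
        E ⊆ avoid D J T → F ⊆ avoid D J T → (∃ p ∈ E, m ≤ (D i).height p) →
        (∃ p ∈ F, m ≤ (D i).height p) → x₀ ∈ E → x₁ ∈ E → y₀ ∈ F → y₁ ∈ F → 0 < σ →
        200 * σ ≤ dist x₀ x₁ → 200 * σ ≤ dist y₀ y₁ → dist x₀ y₀ ≤ (Q + Q') * σ →
        ∃ e ∈ E, ∃ f ∈ F, Link D ρ w (avoid D J T) e f
          (2 * ENNReal.ofReal (η / 4) + 3 * ENNReal.ofReal (η / 40)) := by
      rintro E F x₀ x₁ y₀ y₁ σ hE hF hEA hFA ⟨p, hp, hpm⟩ ⟨p', hp', hpm'⟩ hx₀ hx₁ hy₀ hy₁ hσ hx hy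
        hxy
      obtain ⟨e, he, f, hf, h⟩ := ih' E F hE hF (hEA.trans herase) (hFA.trans herase) x₀ hx₀ x₁ hx₁
        y₀ hy₀ y₁ hy₁ σ hσ hx hy hxy
      exact hD.exists_detour hS' hκ0 hκ hκc (by linarith) hmin hE hF hEA hFA hp hp' hpm hpm' he hf h
    have hcost : 8 * ENNReal.ofReal (η / 40) + (2 * ENNReal.ofReal (η / 4) +
        3 * ENNReal.ofReal (η / 40)) ≤ ENNReal.ofReal η := by
      rw [show (8 : ℝ≥0∞) = ENNReal.ofReal 8 by simp, show (2 : ℝ≥0∞) = ENNReal.ofReal 2 by simp,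
        show (3 : ℝ≥0∞) = ENNReal.ofReal 3 by simp, ← ENNReal.ofReal_mul (by norm_num),
        ← ENNReal.ofReal_mul (by norm_num), ← ENNReal.ofReal_mul (by norm_num),
        ← ENNReal.ofReal_add (by positivity) (by positivity),
        ← ENNReal.ofReal_add (by positivity) (by positivity)]
      exact ENNReal.ofReal_le_ofReal (by linarith)
    by_cases hcol : (∃ p ∈ E, m ≤ (D i).height p) ∧ ∃ p ∈ F, m ≤ (D i).height p
    · obtain ⟨e, he, f, hf, h⟩ := hdetour hE hF hEA hFA hcol.1 hcol.2 hx₀ hx₁ hy₀ hy₁ hσ hx hy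
        (hxy.trans (by gcongr; linarith))
      exact ⟨e, he, f, hf, h.mono subset_rfl (le_trans le_add_self hcost)⟩
    have hcol' : (∀ p ∈ E, (D i).height p < m) ∨ ∀ p ∈ F, (D i).height p < m := by
      by_contra hcon
      push Not at hcon
      exact hcol hcon
    by_cases hσm : (120 + 3 * Q) * σ ≤ 50 * m
    · rcases hcol' with h | h
      · exact hlocal hE hF hEA hFA hx₀ hx₁ hy₀ hy₁ hx hy hxy h hσm
      · obtain ⟨f, hf, e, he, h⟩ := hlocal hF hE hFA hEA hy₀ hy₁ hx₀ hx₁ hy hx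
          (by rwa [dist_comm]) h hσm
        exact ⟨e, he, f, hf, h.symm⟩
    rw [not_le] at hσm
    -- A set inside the collar of a disc or of an exterior disc has diameter at most about twice the
    -- radius, which bounds the scale.
    have hsize : ∀ {E : Set M} {x₀ x₁ : M}, E ⊆ avoid D J T → x₀ ∈ E → x₁ ∈ E →
        200 * σ ≤ dist x₀ x₁ → (∀ p ∈ E, (D i).height p < m) → σ ≤ (D i).radius := by
      intro E x₀ x₁ hEA hx₀ hx₁ hx hcol
      have h1 := dist_triangle_right x₀ x₁ (D i).center
      have h2 : 0 < (D i).height x₀ := not_le.1 ((hEA hx₀).2 i hi)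
      have h3 : 0 < (D i).height x₁ := not_le.1 ((hEA hx₁).2 i hi)
      have h4 := hcol _ hx₀
      have h5 := hcol _ hx₁
      simp only [Disk.height] at h2 h3 h4 h5
      rcases (hD.round i).sign with hs | hs <;> rw [hs] at h2 h3 h4 h5 <;> linarith
    have hσr : σ ≤ (D i).radius := by
      rcases hcol' with h | h
      · exact hsize hEA hx₀ hx₁ hx h
      · exact hsize hFA hy₀ hy₁ hy h
    -- The remaining case, with `σ` not small against `m` and `σ` at most the radius. Then `σ₁` is
    -- comparable with both `σ` and `m`, with constants depending only on `Q` and `κ`.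
    set σ₁ := min σ m with hσ₁
    have hσ₁0 : 0 < σ₁ := lt_min hσ hm0
    have hσ₁σ : σ₁ ≤ σ := min_le_left _ _
    have hσ₁m : σ₁ ≤ m := min_le_right _ _
    have hmσ₁ : m ≤ (3 + Q) * σ₁ := by
      rcases min_choice σ m with h | h
      · rw [hσ₁, h]; nlinarith
      · rw [hσ₁, h]; nlinarith
    have hκσ : κ * σ ≤ σ₁ := le_min (by nlinarith) (by rw [hm]; gcongr)
    have hS'' : P.ShortCircles D ρ w T (η / 40) (2 * (58 + 10 * Q)) :=
      hS'.mono le_rfl (by linarith)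
    obtain ⟨E', hE', hEA', hEm, ⟨a₀, ha₀, a₁, ha₁, ha, hxa⟩, hlE⟩ := hD.exists_escape hQ hS'' hκ0 hκ
      hκc hi hmin hE hEA hx₀ hx₁ hσ₁0 (by linarith) hσ₁m hmσ₁
    obtain ⟨F', hF', hFA', hFm, ⟨b₀, hb₀, b₁, hb₁, hb, hyb⟩, hlF⟩ := hD.exists_escape hQ hS'' hκ0 hκ
      hκc hi hmin hF hFA hy₀ hy₁ hσ₁0 (by linarith) hσ₁m hmσ₁
    obtain ⟨e, he, f, hf, h⟩ := hdetour (σ := σ₁ / 400) hE' hF' hEA' hFA' hEm hFm ha₀ ha₁ hb₀ hb₁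
      (by positivity) (by linarith) (by linarith) (by
        have h1 := dist_triangle4 a₀ x₀ y₀ b₀
        rw [dist_comm a₀ x₀] at h1
        have h2 : Q * σ ≤ Q / κ * σ₁ := by
          rw [div_mul_eq_mul_div, le_div_iff₀ hκ0]
          nlinarith
        have h3 : (Q + Q') * (σ₁ / 400) = Q * (σ₁ / 400) + (24 * (3 + Q) + Q / κ) * σ₁ := by
          rw [hQ']; ring
        have h4 : 0 ≤ Q * (σ₁ / 400) := by positivity
        linarith)
    obtain ⟨e', he', h'⟩ := hlE e he f _ h
    obtain ⟨f', hf', h''⟩ := hlF f hf e' _ h'.symm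
    refine ⟨e', he', f', hf', h''.symm.mono subset_rfl (le_trans (le_of_eq ?_) hcost)⟩
    ring

end PolarSpace


/-! ### Line integrals along Lipschitz curves -/

section LineIntegral

variable {M : Type*} [MetricSpace M]

lemma eVariationOn_Icc_le {γ : ℝ → M} {K : ℝ≥0} {a b : ℝ} (h : LipschitzOnWith K γ (Icc a b))
    (hab : a ≤ b) : eVariationOn γ (Icc a b) ≤ K * ENNReal.ofReal (b - a) := by
  have h1 := h.comp_eVariationOn_le (g := id) (s := Icc a b) (mapsTo_id _)
  have h2 := (monotoneOn_id (s := Icc a b)).eVariationOn_eq (left_mem_Icc.2 hab)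
    (right_mem_Icc.2 hab)
  rw [inter_self] at h2
  rw [h2] at h1
  exact h1

lemma variationOnFromTo_sub_le {γ : ℝ → M} {K : ℝ≥0} {a b : ℝ} (h : LipschitzOnWith K γ (Icc a b))
    {s t : ℝ} (hs : s ∈ Icc a b) (ht : t ∈ Icc a b) (hst : s ≤ t) :
    variationOnFromTo γ (Icc a b) a t - variationOnFromTo γ (Icc a b) a s ≤ K * (t - s) := by
  have ha : a ∈ Icc a b := left_mem_Icc.2 (hs.1.trans hs.2)
  rw [variationOnFromTo.sub_right h.locallyBoundedVariationOn ha ht hs,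
    variationOnFromTo.eq_of_le _ _ hst]
  have hsub : Icc s t ⊆ Icc a b := Icc_subset_Icc hs.1 ht.2
  have := eVariationOn_Icc_le (h.mono hsub) hst
  rw [inter_eq_right.2 hsub]
  refine ENNReal.toReal_le_of_le_ofReal (mul_nonneg K.2 (by linarith)) ?_
  rwa [ENNReal.ofReal_mul K.coe_nonneg, ENNReal.ofReal_coe_nnreal]

lemma lipschitzOnWith_variationOnFromTo {γ : ℝ → M} {K : ℝ≥0} {a b : ℝ}
    (h : LipschitzOnWith K γ (Icc a b)) (hab : a ≤ b) :
    LipschitzOnWith K (variationOnFromTo γ (Icc a b) a) (Icc a b) := by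
  refine LipschitzOnWith.of_dist_le_mul fun x hx y hy => ?_
  have hmono := variationOnFromTo.monotoneOn h.locallyBoundedVariationOn (left_mem_Icc.2 hab)
  rcases le_total x y with hxy | hxy
  · rw [dist_comm, Real.dist_eq, abs_of_nonneg (sub_nonneg.2 (hmono hx hy hxy)), dist_comm,
      Real.dist_eq, abs_of_nonneg (sub_nonneg.2 hxy)]
    exact variationOnFromTo_sub_le h hx hy hxy
  · rw [Real.dist_eq, abs_of_nonneg (sub_nonneg.2 (hmono hy hx hxy)),
      Real.dist_eq, abs_of_nonneg (sub_nonneg.2 hxy)]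
    exact variationOnFromTo_sub_le h hy hx hxy

/-- Substitution in an integral by a Lipschitz function. -/
lemma setLIntegral_image_le {V : ℝ → ℝ} {K : ℝ≥0} {a b : ℝ}
    (hV : LipschitzOnWith K V (Icc a b)) (g : ℝ → ℝ≥0∞) :
    ∫⁻ s in V '' Icc a b, g s ≤ K * ∫⁻ t in Icc a b, g (V t) := by
  have hVm : AEMeasurable V (volume.restrict (Icc a b)) :=
    hV.continuousOn.aemeasurable measurableSet_Icc
  -- A Lipschitz map increases one-dimensional measure at most by the factor `K`. Comparing measures
  -- first leaves no measurability condition on `g`.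
  have hle : volume.restrict (V '' Icc a b) ≤
      (K : ℝ≥0∞) • Measure.map V (volume.restrict (Icc a b)) := by
    refine Measure.le_iff.2 fun S hS => ?_
    rw [Measure.restrict_apply hS, Measure.smul_apply, smul_eq_mul,
      Measure.map_apply_of_aemeasurable hVm hS]
    calc volume (S ∩ V '' Icc a b) ≤ volume (V '' (V ⁻¹' S ∩ Icc a b)) := by
          refine measure_mono ?_
          rintro _ ⟨hs, t, ht, rfl⟩
          exact ⟨t, ⟨hs, ht⟩, rfl⟩
      _ ≤ K * volume (V ⁻¹' S ∩ Icc a b) := by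
          have := (hV.mono (inter_subset_right (s := V ⁻¹' S))).hausdorffMeasure_image_le
            (zero_le_one (α := ℝ))
          rwa [ENNReal.rpow_one, hausdorffMeasure_real] at this
      _ ≤ K * volume.restrict (Icc a b) (V ⁻¹' S) :=
          mul_le_mul_right (Measure.le_restrict_apply _ _) _
  calc ∫⁻ s in V '' Icc a b, g s
      ≤ ∫⁻ s, g s ∂((K : ℝ≥0∞) • Measure.map V (volume.restrict (Icc a b))) :=
        lintegral_mono' hle le_rfl
    _ = K * ∫⁻ s, g s ∂(Measure.map V (volume.restrict (Icc a b))) := lintegral_smul_measure _ _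
    _ ≤ K * ∫⁻ t in Icc a b, g (V t) := mul_le_mul_right (lintegral_map_le _ _) _

lemma naturalParameterization_variationOnFromTo {γ : ℝ → M} {a b t : ℝ}
    (h : LocallyBoundedVariationOn γ (Icc a b)) (ht : t ∈ Icc a b) :
    naturalParameterization γ (Icc a b) a (variationOnFromTo γ (Icc a b) a t) = γ t :=
  edist_eq_zero.1 (edist_naturalParameterization_eq_zero h (left_mem_Icc.2 (ht.1.trans ht.2)) ht)

/-- The variation `V` is `K`-Lipschitz and the natural parametrization at `V t` is `γ t`, so the
arclength integral is estimated by substituting `V`. -/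
lemma compactLineIntegral_le {γ : ℝ → M} {K : ℝ≥0} {a b : ℝ} (h : LipschitzOnWith K γ (Icc a b))
    (hab : a ≤ b) (ρ : M → ℝ≥0∞) :
    compactLineIntegral ρ γ a b ≤ K * ∫⁻ t in Icc a b, ρ (γ t) := by
  have hV := lipschitzOnWith_variationOnFromTo h hab
  have hsub : Icc 0 (variationOnFromTo γ (Icc a b) a b) ⊆
      variationOnFromTo γ (Icc a b) a '' Icc a b := by
    have := intermediate_value_Icc hab hV.continuousOn
    rwa [variationOnFromTo.self] at this
  refine (lintegral_mono_set hsub).trans ((setLIntegral_image_le hV _).trans (le_of_eq ?_))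
  congr 1
  exact setLIntegral_congr_fun measurableSet_Icc fun t ht => by
    rw [naturalParameterization_variationOnFromTo h.locallyBoundedVariationOn ht]

lemma lineIntegral_le {γ : ℝ → M} {K : ℝ≥0} {J : Set ℝ} (hJ : J.OrdConnected)
    (h : LipschitzOnWith K γ J) (ρ : M → ℝ≥0∞) :
    lineIntegral ρ γ J ≤ K * ∫⁻ t in J, ρ (γ t) := by
  refine iSup_le fun a => iSup_le fun b => iSup_le fun ha => iSup_le fun hb => iSup_le fun hab => ?_
  have hsub := hJ.out ha hb
  refine (compactLineIntegral_le (h.mono hsub) hab ρ).trans ?_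
  gcongr

/-- The pieces are disjoint intervals, so their integrals add up to one over a subset of `[0, 1]`;
finite sums suffice. -/
lemma tsum_lineIntegral_le {γ : ℝ → M} {K : ℝ≥0} (h : LipschitzOnWith K γ (Icc 0 1))
    (Ω : Set M) (ρ : M → ℝ≥0∞) :
    ∑' J : pieces Ω γ, lineIntegral ρ γ J ≤ K * ∫⁻ t in Icc 0 1, Ω.indicator ρ (γ t) := by
  have hsub : ∀ J : pieces Ω γ, (J : Set ℝ) ⊆ Icc 0 1 ∩ γ ⁻¹' Ω := fun J =>
    subset_of_mem_componentsOf J.2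
  have hord : ∀ J : pieces Ω γ, (J : Set ℝ).OrdConnected := fun J =>
    (isConnected_of_mem_componentsOf J.2).isPreconnected.ordConnected
  rw [ENNReal.tsum_eq_iSup_sum]
  refine iSup_le fun S => ?_
  calc ∑ J ∈ S, lineIntegral ρ γ J ≤ ∑ J ∈ S, K * ∫⁻ t in (J : Set ℝ), Ω.indicator ρ (γ t) := by
        refine Finset.sum_le_sum fun J _ => ?_
        refine (lineIntegral_le (hord J) (h.mono ((hsub J).trans inter_subset_left)) ρ).trans ?_
        gcongr 1
        refine (setLIntegral_congr_fun (hord J).measurableSet fun t ht => ?_).le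
        exact (indicator_of_mem (s := Ω) (hsub J ht).2 ρ).symm
    _ = K * ∫⁻ t in ⋃ J ∈ S, (J : Set ℝ), Ω.indicator ρ (γ t) := by
        rw [← Finset.mul_sum, lintegral_biUnion_finset _ (fun J _ => (hord J).measurableSet)]
        intro J _ J' _ hne
        rw [Function.onFun, disjoint_left]
        exact fun t ht ht' => hne (Subtype.ext (eq_of_mem_componentsOf J.2 J'.2 ht ht'))
    _ ≤ K * ∫⁻ t in Icc 0 1, Ω.indicator ρ (γ t) := by
        gcongr 1
        exact lintegral_mono_set (iUnion₂_subset fun J _ => (hsub J).trans inter_subset_left)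

end LineIntegral

/-! ### Pushing paths out of the discs -/

section Excursions

variable {M : Type*} [MetricSpace M]

/-- Replacing a path on the components of an open set of parameters. -/
lemma exists_replace {γ : ℝ → M} {C : ℝ≥0} {L : ℝ}
    (hγ : LipschitzOnWith C γ (Icc 0 L)) {U : Set ℝ} (hU : IsOpen U) (hUL : U ⊆ Ioo 0 L)
    {Z : ℝ → M → Prop}
    (hg : ∀ a b, a < b → a ∈ Icc 0 L → b ∈ Icc 0 L → Ioo a b ⊆ U → a ∉ U → b ∉ U →
      ∃ g : ℝ → M, LipschitzOnWith C g (Icc a b) ∧ g a = γ a ∧ g b = γ b ∧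
        ∀ t ∈ Ioo a b, Z t (g t)) :
    ∃ γ' : ℝ → M, LipschitzOnWith C γ' (Icc 0 L) ∧ (∀ t, t ∉ U → γ' t = γ t) ∧
      ∀ t ∈ U, Z t (γ' t) := by
  classical
  -- the end points of the component of a parameter
  have hlow : ∀ t ∈ Icc 0 L, ∃ a, IsGreatest (Icc 0 t \ U) a := fun t ht =>
    (isCompact_Icc.diff hU).exists_isGreatest
      ⟨0, left_mem_Icc.2 ht.1, fun h => lt_irrefl _ (hUL h).1⟩
  have hupp : ∀ t ∈ Icc 0 L, ∃ b, IsLeast (Icc t L \ U) b := fun t ht =>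
    (isCompact_Icc.diff hU).exists_isLeast
      ⟨L, right_mem_Icc.2 ht.2, fun h => lt_irrefl _ (hUL h).2⟩
  choose! A hA using hlow
  choose! B hB using hupp
  let good : ℝ → ℝ → Prop := fun a b =>
    a < b ∧ a ∈ Icc 0 L ∧ b ∈ Icc 0 L ∧ Ioo a b ⊆ U ∧ a ∉ U ∧ b ∉ U
  -- The replacement is chosen as a function of the end points, so all parameters of one component
  -- share it.
  have hg' : ∀ a b, ∃ g : ℝ → M, good a b → LipschitzOnWith C g (Icc a b) ∧ g a = γ a ∧
      g b = γ b ∧ ∀ t ∈ Ioo a b, Z t (g t) := by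
    intro a b
    by_cases h : good a b
    · obtain ⟨g, hg⟩ := hg a b h.1 h.2.1 h.2.2.1 h.2.2.2.1 h.2.2.2.2.1 h.2.2.2.2.2
      exact ⟨g, fun _ => hg⟩
    · exact ⟨γ, fun h' => absurd h' h⟩
  choose G hG using hg'
  have hgood : ∀ t ∈ U, good (A t) (B t) ∧ t ∈ Ioo (A t) (B t) := by
    intro t ht
    have ht' : t ∈ Icc 0 L := Ioo_subset_Icc_self (hUL ht)
    obtain ⟨⟨ha, haU⟩, hagr⟩ := hA t ht'
    obtain ⟨⟨hb, hbU⟩, hble⟩ := hB t ht'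
    have hat : A t < t := lt_of_le_of_ne ha.2 fun h => haU (h.symm ▸ ht)
    have htb : t < B t := lt_of_le_of_ne hb.1 fun h => hbU (h ▸ ht)
    refine ⟨⟨hat.trans htb, ⟨ha.1, ha.2.trans ht'.2⟩, ⟨ht'.1.trans hb.1, hb.2⟩, ?_, haU, hbU⟩,
      hat, htb⟩
    intro s hs
    by_contra hsU
    rcases le_total s t with h | h
    · exact absurd (hagr ⟨⟨ha.1.trans hs.1.le, h⟩, hsU⟩) (not_le.2 hs.1)
    · exact absurd (hble ⟨⟨h, hs.2.le.trans hb.2⟩, hsU⟩) (not_le.2 hs.2)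
  let γ' : ℝ → M := fun t => if t ∈ U then G (A t) (B t) t else γ t
  have hγ'n : ∀ t, t ∉ U → γ' t = γ t := fun t ht => if_neg ht
  have hγ'U : ∀ t ∈ U, γ' t = G (A t) (B t) t := fun t ht => if_pos ht
  refine ⟨γ', ?_, hγ'n, fun t ht => ?_⟩
  swap
  · rw [hγ'U t ht]
    exact (hG _ _ (hgood t ht).1).2.2.2 t (hgood t ht).2
  have hlip : ∀ {f : ℝ → M} {I : Set ℝ}, LipschitzOnWith C f I → ∀ s ∈ I, ∀ t ∈ I, s ≤ t →
      dist (f s) (f t) ≤ C * (t - s) := by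
    intro f I hf s hs t ht hst
    have := hf.dist_le_mul s hs t ht
    rwa [Real.dist_eq, abs_sub_comm, abs_of_nonneg (sub_nonneg.2 hst)] at this
  have hright : ∀ s ∈ Icc 0 L, ∃ b, IsLeast (Icc s L \ U) b ∧ dist (γ' s) (γ b) ≤ C * (b - s) := by
    intro s hs
    refine ⟨B s, hB s hs, ?_⟩
    by_cases hsU : s ∈ U
    · obtain ⟨h1, h2⟩ := hgood s hsU
      obtain ⟨k1, -, k3, -⟩ := hG _ _ h1
      rw [hγ'U s hsU, ← k3]
      exact hlip k1 s (Ioo_subset_Icc_self h2) _ (right_mem_Icc.2 h1.1.le) h2.2.le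
    · have : B s = s := le_antisymm ((hB s hs).2 ⟨left_mem_Icc.2 hs.2, hsU⟩) (hB s hs).1.1.1
      rw [this, hγ'n s hsU, dist_self, sub_self, mul_zero]
  have hleft : ∀ t ∈ Icc 0 L, ∃ a, IsGreatest (Icc 0 t \ U) a ∧ dist (γ a) (γ' t) ≤ C * (t - a) := by
    intro t ht
    refine ⟨A t, hA t ht, ?_⟩
    by_cases htU : t ∈ U
    · obtain ⟨h1, h2⟩ := hgood t htU
      obtain ⟨k1, k2, -, -⟩ := hG _ _ h1
      rw [hγ'U t htU, ← k2]
      exact hlip k1 _ (left_mem_Icc.2 h1.1.le) t (Ioo_subset_Icc_self h2) h2.1.le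
    · have : A t = t := le_antisymm (hA t ht).1.1.2 ((hA t ht).2 ⟨right_mem_Icc.2 ht.1, htU⟩)
      rw [this, hγ'n t htU, dist_self, sub_self, mul_zero]
  -- If some parameter between `s` and `t` is outside `U`, go from `s` to the first such `b`, along
  -- `γ` from `b` to the last such `a`, and from `a` to `t`. Otherwise `s` and `t` belong to the
  -- same component.
  have key : ∀ s ∈ Icc 0 L, ∀ t ∈ Icc 0 L, s ≤ t → dist (γ' s) (γ' t) ≤ C * (t - s) := by
    intro s hs t ht hst
    by_cases hp : ∃ p ∈ Icc s t, p ∉ U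
    · obtain ⟨p, hp, hpU⟩ := hp
      obtain ⟨b, hb, hb'⟩ := hright s hs
      obtain ⟨a, ha, ha'⟩ := hleft t ht
      have h1 : b ≤ p := hb.2 ⟨⟨hp.1, hp.2.trans ht.2⟩, hpU⟩
      have h2 : p ≤ a := ha.2 ⟨⟨hs.1.trans hp.1, hp.2⟩, hpU⟩
      have h3 := hlip hγ b ⟨hs.1.trans hb.1.1.1, hb.1.1.2⟩ a ⟨ha.1.1.1, ha.1.1.2.trans ht.2⟩
        (h1.trans h2)
      have h4 := dist_triangle4 (γ' s) (γ b) (γ a) (γ' t)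
      linarith
    · push Not at hp
      have hsU := hp s (left_mem_Icc.2 hst)
      have htU := hp t (right_mem_Icc.2 hst)
      have hAeq : A s = A t := by
        apply le_antisymm
        · exact (hA t ht).2 ⟨⟨(hA s hs).1.1.1, (hA s hs).1.1.2.trans hst⟩, (hA s hs).1.2⟩
        · refine (hA s hs).2 ⟨⟨(hA t ht).1.1.1, ?_⟩, (hA t ht).1.2⟩
          by_contra hcon
          exact (hA t ht).1.2 (hp _ ⟨(not_le.1 hcon).le, (hA t ht).1.1.2⟩)
      have hBeq : B s = B t := by
        apply le_antisymm
        · exact (hB s hs).2 ⟨⟨hst.trans (hB t ht).1.1.1, (hB t ht).1.1.2⟩, (hB t ht).1.2⟩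
        · refine (hB t ht).2 ⟨⟨?_, (hB s hs).1.1.2⟩, (hB s hs).1.2⟩
          by_contra hcon
          exact (hB s hs).1.2 (hp _ ⟨(hB s hs).1.1.1, (not_le.1 hcon).le⟩)
      obtain ⟨h1, h2⟩ := hgood s hsU
      have h2' := (hgood t htU).2
      rw [hγ'U s hsU, hγ'U t htU, ← hAeq, ← hBeq]
      rw [← hAeq, ← hBeq] at h2'
      exact hlip (hG _ _ h1).1 s (Ioo_subset_Icc_self h2) t (Ioo_subset_Icc_self h2') hst
  refine LipschitzOnWith.of_dist_le_mul fun x hx y hy => ?_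
  rcases le_total x y with hxy | hxy
  · rw [dist_comm x y, Real.dist_eq, abs_of_nonneg (sub_nonneg.2 hxy)]
    exact key x hx y hy hxy
  · rw [dist_comm, Real.dist_eq, abs_of_nonneg (sub_nonneg.2 hxy)]
    exact key y hy x hx hxy

/-- Two points of a circle are joined by an arc whose length is comparable with their distance. -/
lemma PolarSpace.exists_short_arc (P : PolarSpace M) {x u v : M} {r a b : ℝ} (hab : a < b)
    (hu : dist x u = r) (hv : dist x v = r) (huv : dist u v ≤ b - a) :
    ∃ g : ℝ → M, LipschitzOnWith 2 g (Icc a b) ∧ g a = u ∧ g b = v ∧ ∀ t, dist x (g t) = r := by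
  have hr : 0 ≤ r := hu ▸ dist_nonneg
  have hk : P.k * r ^ 2 ≤ 4 := hu ▸ P.dist_bound x u
  obtain ⟨θ, -, hθ⟩ := P.exists_angle x u 0
  -- An angle within `π` of `θ` gives the shorter arc, of length at most `π / 2 ≤ 2` times the
  -- chord.
  obtain ⟨φ, hφ, hφ'⟩ := P.exists_angle x v (θ - Real.pi)
  rw [hu] at hθ
  rw [hv] at hφ'
  have hdiff : |θ - φ| ≤ Real.pi := abs_le.2 ⟨by linarith [hφ.2], by linarith [hφ.1]⟩
  have hba : 0 < b - a := sub_pos.2 hab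
  have harc := P.arc_le_dist x hr hk hdiff
  rw [hθ, hφ'] at harc
  refine ⟨fun t => P.Φ x r (θ + (t - a) / (b - a) * (φ - θ)), ?_, by simp [hθ],
    by simp [div_self hba.ne', hφ'], fun t => P.dist_polar x _ hr hk⟩
  refine LipschitzOnWith.of_dist_le_mul fun s _ t _ => ?_
  refine (P.dist_same_le x _ _ hr hk).trans ?_
  have e : θ + (s - a) / (b - a) * (φ - θ) - (θ + (t - a) / (b - a) * (φ - θ)) =
      (s - t) / (b - a) * -(θ - φ) := by ring
  rw [e, abs_mul, abs_neg, abs_div, abs_of_pos hba, Real.dist_eq]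
  have hpi := Real.pi_lt_four
  calc P.rad r * (|s - t| / (b - a) * |θ - φ|) = |s - t| / (b - a) * (P.rad r * |θ - φ|) := by ring
    _ ≤ |s - t| / (b - a) * (2 * (b - a)) := by
        refine mul_le_mul_of_nonneg_left (harc.trans ?_) (by positivity)
        gcongr
        linarith
    _ = _ := by
        push_cast
        field_simp

end Excursions

namespace HullSystem

variable {M : Type*} [MetricSpace M] {P : PolarSpace M} {Ω : Set M}

/-- A path can be pushed out of the complementary discs. -/
lemma exists_pushout (H : HullSystem P Ω) {γ : ℝ → M} {L : ℝ} (hL : 0 ≤ L)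
    (hγ : LipschitzOnWith 1 γ (Icc 0 L)) (h0 : γ 0 ∈ Ω) (h1 : γ L ∈ Ω)
    (hpt : ∀ t ∈ Icc 0 L, {γ t} ∉ boundaryComponents Ω) :
    ∃ γ' : ℝ → M, LipschitzOnWith 2 γ' (Icc 0 L) ∧ ∀ t ∈ Icc 0 L,
      (γ t ∈ Ω ∧ γ' t = γ t) ∨ (γ t ∉ Ω ∧ ∃ K : boundaryCircles Ω, γ' t ∈ (K : Set M) ∧
        (γ '' Icc 0 L ∩ (H.disk K).carrier).Nonempty) := by
  -- The parameters at which the path is in the interior of disc `K`. These open sets are disjoint,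
  -- and parameters on a circle are left alone.
  let U : boundaryCircles Ω → Set ℝ := fun K =>
    Ioo 0 L ∩ (fun t => (H.disk K).height (γ t)) ⁻¹' Iio 0
  have hUo : ∀ K, IsOpen (U K) := fun K =>
    ((H.disk K).continuous_height.comp_continuousOn
      (hγ.continuousOn.mono Ioo_subset_Icc_self)).isOpen_inter_preimage isOpen_Ioo isOpen_Iio
  have hmemU : ∀ K t, t ∈ Icc 0 L → (H.disk K).height (γ t) < 0 → t ∈ U K := by
    intro K t ht h
    refine ⟨⟨lt_of_le_of_ne ht.1 ?_, lt_of_le_of_ne ht.2 ?_⟩, h⟩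
    · rintro rfl
      exact lt_asymm h (H.height_pos K _ h0)
    · rintro rfl
      exact lt_asymm h (H.height_pos K _ h1)
  have hUd : ∀ K K' t, t ∈ U K → t ∈ U K' → K = K' := by
    intro K K' t ht ht'
    by_contra hne
    exact (H.disjoint hne).le_bot ⟨(show (H.disk K).height (γ t) ≤ 0 from le_of_lt ht.2),
      (show (H.disk K').height (γ t) ≤ 0 from le_of_lt ht'.2)⟩
  have hcirc : ∀ (K : boundaryCircles Ω) z, z ∈ (K : Set M) ↔ (H.disk K).height z = 0 := by
    intro K z
    rw [H.sphere_eq K, (H.round K).height_eq_zero]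
  refine Exists.elim (exists_replace (C := 2) (Z := fun t z => ∃ K, t ∈ U K ∧
      z ∈ (K : Set M)) (hγ.weaken one_le_two) (isOpen_iUnion hUo)
    (iUnion_subset fun K => inter_subset_left) ?hg) ?main
  case main =>
    rintro γ' ⟨hγ', hn, hy⟩
    refine ⟨γ', hγ', fun t ht => ?_⟩
    by_cases htU : t ∈ ⋃ K, U K
    · obtain ⟨K, hK, hK'⟩ := hy t htU
      refine Or.inr ⟨fun htΩ => lt_asymm hK.2 (H.height_pos K _ htΩ), K, hK', γ t, ⟨t, ht, rfl⟩,
        (show (H.disk K).height (γ t) ≤ 0 from le_of_lt hK.2)⟩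
    · rw [hn t htU]
      by_cases htΩ : γ t ∈ Ω
      · exact Or.inl ⟨htΩ, rfl⟩
      · refine Or.inr ⟨htΩ, ?_⟩
        rcases H.cover _ htΩ with h | ⟨K, hK⟩
        · exact absurd h (hpt t ht)
        · refine ⟨K, ?_, γ t, ⟨t, ht, rfl⟩, hK⟩
          rw [hcirc]
          refine le_antisymm hK (not_lt.1 fun h => htU (mem_iUnion.2 ⟨K, hmemU K t ht h⟩))
  case hg =>
    intro a b hab ha hb hsub haU hbU
    obtain ⟨c, hc⟩ := exists_between hab
    obtain ⟨K, hK⟩ := mem_iUnion.1 (hsub hc)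
    -- By connectedness an excursion stays in one disc. Its end points then lie on the circle of
    -- that disc, so an arc of the circle can replace it.
    have hIoo : Ioo a b ⊆ U K := by
      refine isPreconnected_Ioo.subset_left_of_subset_union (hUo K)
        (isOpen_iUnion fun K' : {K' // K' ≠ K} => hUo K') ?_ ?_ ⟨c, hc, hK⟩
      · rw [disjoint_left]
        intro t ht ht'
        obtain ⟨K', hK'⟩ := mem_iUnion.1 ht'
        exact K'.2 (hUd _ _ t hK' ht)
      · intro t ht
        obtain ⟨K', hK'⟩ := mem_iUnion.1 (hsub ht)
        by_cases h : K' = K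
        · subst h; exact Or.inl hK'
        · exact Or.inr (mem_iUnion.2 ⟨⟨K', h⟩, hK'⟩)
    have hcont : ContinuousOn (fun t => (H.disk K).height (γ t)) (Icc a b) :=
      (H.disk K).continuous_height.comp_continuousOn
        (hγ.continuousOn.mono (Icc_subset_Icc ha.1 hb.2))
    have hle : ∀ t ∈ Icc a b, (H.disk K).height (γ t) ≤ 0 := by
      intro t ht
      rw [← closure_Ioo hab.ne] at ht hcont
      exact closure_minimal (s := (fun t => (H.disk K).height (γ t)) '' Ioo a b) (t := Iic 0)
        (by rintro _ ⟨t, ht, rfl⟩; exact mem_Iic.2 (mem_Iio.1 (hIoo ht).2).le) isClosed_Iic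
        (hcont.image_closure ⟨t, ht, rfl⟩)
    have hend : ∀ t ∈ Icc a b, t ∈ Icc 0 L → t ∉ (⋃ K, U K) →
        dist (H.disk K).center (γ t) = (H.disk K).radius := by
      intro t ht htL htU
      have : (H.disk K).height (γ t) = 0 :=
        le_antisymm (hle t ht) (not_lt.1 fun h => htU (mem_iUnion.2 ⟨K, hmemU K t htL h⟩))
      rw [(H.round K).height_eq_zero, Metric.mem_sphere] at this
      rwa [dist_comm]
    have hd : dist (γ a) (γ b) ≤ b - a := by
      have := hγ.dist_le_mul a ha b hb
      rwa [NNReal.coe_one, one_mul, Real.dist_eq, abs_sub_comm,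
        abs_of_nonneg (sub_nonneg.2 hab.le)] at this
    obtain ⟨g, hg1, hg2, hg3, hg4⟩ := P.exists_short_arc hab
      (hend a (left_mem_Icc.2 hab.le) ha haU) (hend b (right_mem_Icc.2 hab.le) hb hbU) hd
    refine ⟨g, hg1, hg2, hg3, fun t ht => ⟨K, hIoo ht, ?_⟩⟩
    rw [H.sphere_eq K, Metric.mem_sphere, dist_comm, hg4]

end HullSystem


/-! ### Separation implies the Loewner property -/

variable {M : Type*} [MetricSpace M] {P : PolarSpace M} {Ω : Set M}

lemma setDist_le {E F : Set M} {x y : M} (hx : x ∈ E) (hy : y ∈ F) : setDist E F ≤ dist x y :=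
  csInf_le ⟨0, by rintro _ ⟨a, _, b, _, rfl⟩; exact dist_nonneg⟩ ⟨x, hx, y, hy, rfl⟩

lemma exists_dist_lt {E F : Set M} (hE : E.Nonempty) (hF : F.Nonempty) {d : ℝ}
    (h : setDist E F < d) : ∃ x ∈ E, ∃ y ∈ F, dist x y < d := by
  obtain ⟨_, ⟨x, hx, y, hy, rfl⟩, hlt⟩ := exists_lt_of_csInf_lt (hE.image2 hF) h
  exact ⟨x, hx, y, hy, hlt⟩

/-- The triangle inequality would give half the diameter only in the limit; a third needs no
compactness. -/
lemma exists_diam_le_dist {E : Set M} (x : M) (h : 0 < Metric.diam E) :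
    ∃ y ∈ E, Metric.diam E / 3 ≤ dist x y := by
  by_contra! hcon
  have : Metric.diam E ≤ 2 * (Metric.diam E / 3) := by
    refine Metric.diam_le_of_forall_dist_le (by positivity) fun y hy z hz => ?_
    linarith [dist_triangle_left y z x, hcon y hy, hcon z hz]
  linarith

lemma IsNondegenerateContinuum.diam_pos {E : Set M} (hE : IsNondegenerateContinuum E) :
    0 < Metric.diam E :=
  Metric.diam_pos hE.nontrivial hE.isCompact.isBounded

lemma PolarSpace.radius_le_diam_sphere (P : PolarSpace M) (x : M) {r : ℝ} (hr : 0 ≤ r)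
    (hk : P.k * r ^ 2 ≤ 2) : r ≤ Metric.diam (Metric.sphere x r) := by
  have hk4 : P.k * r ^ 2 ≤ 4 := by linarith
  have h1 := P.dist_sq_same x Real.pi 0 hr hk4
  rw [sub_zero, Real.sin_pi_div_two] at h1
  have h2 := P.half_le_rad hr (by linarith)
  have h3 : r ≤ dist (P.Φ x r Real.pi) (P.Φ x r 0) :=
    le_of_sq_le_sq_of_nonneg (by nlinarith) dist_nonneg
  exact h3.trans (Metric.dist_le_diam_of_mem Metric.isBounded_sphere
    (P.dist_polar' x _ hr hk4) (P.dist_polar' x _ hr hk4))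

namespace HullSystem

lemma radius_le_diam (H : HullSystem P Ω) (K : boundaryCircles Ω) :
    (H.disk K).radius ≤ Metric.diam (K : Set M) := by
  rw [H.sphere_eq K]
  exact P.radius_le_diam_sphere _ (H.round K).pos.le (H.round K).le

lemma isSeparated (H : HullSystem P Ω) {c : ℝ} (hc : 0 < c)
    (h : ∀ A ∈ boundaryCircles Ω, ∀ B ∈ boundaryCircles Ω, A ≠ B → c < relDist A B) :
    P.IsSeparated H.disk c := by
  refine ⟨H.round, H.disjoint, fun K K' hne u v hu hv => ?_⟩
  rw [(H.round _).height_eq_zero, ← H.sphere_eq] at hu hv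
  have h1 := h K K.2 K' K'.2 fun e => hne (Subtype.ext e)
  have hmin : min (H.disk K).radius (H.disk K').radius ≤
      min (Metric.diam (K : Set M)) (Metric.diam (K' : Set M)) :=
    min_le_min (H.radius_le_diam K) (H.radius_le_diam K')
  have hpos : 0 < min (H.disk K).radius (H.disk K').radius :=
    lt_min (H.round K).pos (H.round K').pos
  rw [relDist, lt_div_iff₀ (hpos.trans_le hmin)] at h1
  calc c * min (H.disk K).radius (H.disk K').radius
      ≤ c * min (Metric.diam (K : Set M)) (Metric.diam (K' : Set M)) := by gcongr
    _ ≤ setDist (K : Set M) K' := h1.le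
    _ ≤ dist u v := setDist_le hu hv

/-- The length of a link bounds the transboundary length of a curve in the closure of `Ω`. -/
lemma exists_curve (H : HullSystem P Ω) (hΩ : IsOpen Ω) {ρ : M → ℝ≥0∞}
    {w : boundaryComponents Ω → ℝ≥0∞} {J : Finset (boundaryCircles Ω)} {E F : Set M} {e f : M}
    (he : e ∈ E) (hf : f ∈ F) (heΩ : e ∈ Ω) (hfΩ : f ∈ Ω) {𝒥 : Set (Set M)}
    (h𝒥 : 𝒥 ⊆ boundaryComponents Ω)
    (hJ : ∀ K : boundaryCircles Ω, (K : Set M) ∈ 𝒥 → K ∈ J) {l : ℝ≥0∞}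
    (h : Link H.disk (Ω.indicator ρ) (fun K => w ⟨K, K.2.1⟩)
      (PolarSpace.avoid H.disk J {z | {z} ∈ boundaryComponents Ω}) e f l) :
    ∃ γ ∈ connectingCurves E F (closure Ω \ ⋃₀ 𝒥), LocallyRectifiableRel Ω γ ∧
      transboundaryLength Ω ρ w γ ≤ 2 * l := by
  obtain ⟨L, β, hL, hβ, hA, rfl, rfl, hl⟩ := h
  obtain ⟨γ, hγ, hγβ⟩ := H.exists_pushout hL hβ heΩ hfΩ fun t ht => (hA ht).1
  have hfr : ∀ K ∈ boundaryComponents Ω, K ⊆ frontier Ω := fun K hK =>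
    subset_of_mem_componentsOf hK
  have hfrΩ : Disjoint Ω (frontier Ω) := by
    rw [hΩ.frontier_eq]; exact disjoint_sdiff_right
  have hscale : ∀ s ∈ Icc (0 : ℝ) 1, L * s ∈ Icc 0 L := fun s hs =>
    ⟨mul_nonneg hL hs.1, mul_le_of_le_one_right hL hs.2⟩
  -- the boundary components that are met
  have hhit : ∀ s ∈ Icc (0 : ℝ) 1, ∀ K ∈ boundaryComponents Ω, γ (L * s) ∈ K →
      ∃ hK : K ∈ boundaryCircles Ω, (β '' Icc 0 L ∩ (H.disk ⟨K, hK⟩).carrier).Nonempty := by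
    intro s hs K hK hsK
    rcases hγβ _ (hscale s hs) with ⟨h1, h2⟩ | ⟨-, K', hK', hne⟩
    · exact absurd (hfr K hK hsK) (fun h3 => hfrΩ.le_bot ⟨h2 ▸ h1, h3⟩)
    · obtain rfl := eq_of_mem_componentsOf hK K'.2.1 hsK hK'
      exact ⟨K'.2, hne⟩
  have hlip : LipschitzOnWith (2 * L.toNNReal) (fun s => γ (L * s)) (Icc 0 1) := by
    refine LipschitzOnWith.of_dist_le_mul fun s hs t ht => ?_
    have := hγ.dist_le_mul _ (hscale s hs) _ (hscale t ht)
    rw [Real.dist_eq, ← mul_sub, abs_mul, abs_of_nonneg hL, ← Real.dist_eq] at this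
    push_cast at this ⊢
    rw [Real.coe_toNNReal L hL]
    linarith
  refine ⟨fun s => γ (L * s), ⟨hlip.continuousOn, ?_, ?_, ?_⟩, ?_, ?_⟩
  · intro s hs
    refine ⟨?_, ?_⟩
    · rcases hγβ _ (hscale s hs) with ⟨h1, h2⟩ | ⟨-, K', hK', -⟩
      · exact subset_closure (h2.symm ▸ h1 : γ (L * s) ∈ Ω)
      · exact frontier_subset_closure (hfr _ K'.2.1 hK')
    -- Only circles are met, and only those whose discs the original path met; discs of circles in
    -- `𝒥` were avoided.
    · rintro ⟨K, hK, hsK⟩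
      obtain ⟨hK', z, ⟨t, ht, rfl⟩, hz⟩ := hhit s hs K (h𝒥 hK) hsK
      exact (hA ht).2 _ (hJ ⟨K, hK'⟩ hK) hz
  · rcases hγβ 0 (left_mem_Icc.2 hL) with ⟨-, h2⟩ | ⟨h1, -⟩
    · simpa [h2] using he
    · exact absurd heΩ h1
  · rcases hγβ L (right_mem_Icc.2 hL) with ⟨-, h2⟩ | ⟨h1, -⟩
    · simpa [h2] using hf
    · exact absurd hfΩ h1
  · intro I hI
    exact (hlip.mono ((subset_of_mem_componentsOf hI).trans
      inter_subset_left)).locallyBoundedVariationOn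
  · refine le_trans ?_ (mul_le_mul_right hl 2)
    unfold transboundaryLength pathCost
    rw [mul_add]
    refine add_le_add ((tsum_lineIntegral_le hlip Ω ρ).trans ?_) ?_
    · have hsub : ∫⁻ t in (fun s : ℝ => L * s) '' Icc 0 1, Ω.indicator ρ (γ t) ≤
          ∫⁻ t in Icc 0 L, Ω.indicator ρ (β t) := by
        refine (lintegral_mono_set (show (fun s : ℝ => L * s) '' Icc 0 1 ⊆ Icc 0 L by
          rintro _ ⟨s, hs, rfl⟩; exact hscale s hs)).trans ?_
        refine setLIntegral_mono' measurableSet_Icc fun t ht => ?_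
        rcases hγβ t ht with ⟨h1, h2⟩ | ⟨-, K', hK', -⟩
        · rw [h2]
        · rw [indicator_of_notMem fun h => hfrΩ.le_bot ⟨h, hfr _ K'.2.1 hK'⟩]
          exact zero_le
      rcases hL.eq_or_lt with rfl | hL'
      · simp
      -- Rescaling the parameter to `[0, 1]` makes the Lipschitz constant `2 * L`; the substitution
      -- `t = L * s` absorbs `L` and leaves the factor `2`.
      rw [lintegral_image_eq_lintegral_abs_deriv_mul measurableSet_Icc
        (fun s _ => by simpa using ((hasDerivAt_id s).const_mul L).hasDerivWithinAt)
        (fun s _ t _ h => mul_left_cancel₀ hL'.ne' h), abs_of_pos hL',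
        lintegral_const_mul' _ _ ENNReal.ofReal_ne_top] at hsub
      rw [ENNReal.coe_mul, mul_assoc]
      exact mul_le_mul_right hsub 2
    · rw [two_mul]
      refine le_trans ?_ le_self_add
      have hcirc : ∀ K : {K : boundaryComponents Ω |
          ((fun s => γ (L * s)) '' Icc 0 1 ∩ (K : Set M)).Nonempty}, ∃ hK : (K.1 : Set M) ∈
          boundaryCircles Ω, (β '' Icc 0 L ∩ (H.disk ⟨K.1, hK⟩).carrier).Nonempty := by
        rintro ⟨K, z, ⟨s, hs, rfl⟩, hz⟩
        exact hhit s hs K K.2 hz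
      choose hK hKne using hcirc
      calc _ = ∑' K : {K : boundaryComponents Ω |
              ((fun s => γ (L * s)) '' Icc 0 1 ∩ (K : Set M)).Nonempty},
              indicator {i | (β '' Icc 0 L ∩ (H.disk i).carrier).Nonempty}
                (fun K : boundaryCircles Ω => w ⟨K, K.2.1⟩) ⟨K.1, hK K⟩ := by
            refine tsum_congr fun K => ?_
            rw [indicator_of_mem (show _ ∈ {i | (β '' Icc 0 L ∩ (H.disk i).carrier).Nonempty} from
              hKne K)]
        _ ≤ _ := ENNReal.tsum_comp_le_tsum_of_injective
            (f := fun K : {K : boundaryComponents Ω |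
              ((fun s => γ (L * s)) '' Icc 0 1 ∩ (K : Set M)).Nonempty} =>
              (⟨K.1, hK K⟩ : boundaryCircles Ω))
            (fun K K' h => Subtype.ext (Subtype.ext (Subtype.mk.inj h))) _

variable [MeasurableSpace M] [BorelSpace M] {μ : Measure M} {C : ℝ≥0}

/-- A distribution of mass below `ε` admits short circles everywhere, hence a link of cost `1 / 4`
outside the excluded discs. Pushed into the closure of `Ω` it has length at most `1 / 2`, so the
distribution is not admissible. -/
lemma exists_le_transboundaryModulus (H : HullSystem P Ω) (hΩ : IsOpen Ω) (hμ : IsComparable μ C)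
    {c : ℝ} (hc : 0 < c) (hsep : P.IsSeparated H.disk c) (N : ℕ) {τ : ℝ} (hτ : 0 < τ) :
    ∃ ε > 0, ∀ E F : Set M, IsNondegenerateContinuum E → IsNondegenerateContinuum F →
      E ⊆ Ω → F ⊆ Ω → ∀ 𝒥 : Set (Set M), 𝒥 ⊆ boundaryComponents Ω → 𝒥.encard ≤ N →
      relDist E F ≤ τ → ENNReal.ofReal ε ≤
          transboundaryModulus μ Ω (connectingCurves E F (closure Ω \ ⋃₀ 𝒥)) := by
  obtain ⟨η, hη, q, hq, hlink⟩ := hsep.exists_link hc N (600 * (τ + 1)) (1 / 4) (by positivity)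
    (by norm_num)
  obtain ⟨ε, hε, hshort⟩ := PolarSpace.exists_short_circle C hη hq
  refine ⟨ε, hε, fun E F hE hF hEΩ hFΩ 𝒥 h𝒥 hcard hEF => ?_⟩
  refine le_iInf fun ρ => le_iInf fun w => le_iInf fun hadm => ?_
  by_contra! hlt
  have hcount : (boundaryComponents Ω).Countable := H.countable
  have : Countable (boundaryCircles Ω) := (hcount.mono fun K hK => hK.1).to_subtype
  have hT : {z | {z} ∈ boundaryComponents Ω}.Countable := by
    have := hcount.preimage (f := fun z : M => ({z} : Set M)) singleton_injective
    exact this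
  have hmass : ∫⁻ z, Ω.indicator ρ z ^ 2 ∂μ +
      ∑' K : boundaryCircles Ω, w ⟨K, K.2.1⟩ ^ 2 ≤ ENNReal.ofReal ε := by
    refine le_trans (add_le_add (le_of_eq ?_) ?_) hlt.le
    · rw [← lintegral_indicator hΩ.measurableSet]
      congr 1 with z
      by_cases hz : z ∈ Ω <;> simp [hz]
    · exact ENNReal.tsum_comp_le_tsum_of_injective
        (f := fun K : boundaryCircles Ω => (⟨K, K.2.1⟩ : boundaryComponents Ω))
        (fun K K' h => Subtype.ext (Subtype.mk.inj h)) (fun K => w K ^ 2)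
  have hS : P.ShortCircles H.disk (Ω.indicator ρ) (fun K => w ⟨K, K.2.1⟩)
      {z | {z} ∈ boundaryComponents Ω} η q := by
    intro x s₁ s₂ h0 h1 h2 h3 h4
    exact hshort P μ H.disk _ _ hμ H.round H.disjoint (hadm.1.indicator hΩ.measurableSet) hmass x
      s₁ s₂ _ h0 h2 h3 h1 h4 hT
  have hfin : 𝒥.Finite := finite_of_encard_le_coe hcard
  have hpre : ((fun K : boundaryCircles Ω => (K : Set M)) ⁻¹' 𝒥).Finite :=
    hfin.preimage Subtype.val_injective.injOn
  set J := hpre.toFinset with hJdef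
  have hJmem : ∀ K : boundaryCircles Ω, K ∈ J ↔ (K : Set M) ∈ 𝒥 := by
    intro K; rw [hJdef, Finite.mem_toFinset]; rfl
  have hJcard : J.card ≤ N := by
    have h1 : (J : Set (boundaryCircles Ω)).encard ≤ 𝒥.encard := by
      rw [← Subtype.val_injective.encard_image]
      refine encard_le_encard ?_
      rintro _ ⟨K, hK, rfl⟩
      exact (hJmem K).1 hK
    have h2 := h1.trans hcard
    rw [encard_coe_eq_coe_finsetCard] at h2
    exact_mod_cast h2
  have havoid : Ω ⊆ PolarSpace.avoid H.disk J {z | {z} ∈ boundaryComponents Ω} := by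
    intro z hz
    refine ⟨fun hz' => ?_, fun K _ => not_le.2 (H.height_pos K z hz)⟩
    have h1 : z ∈ frontier Ω := subset_of_mem_componentsOf (mem_ofPred_eq.mp hz') rfl
    rw [hΩ.frontier_eq] at h1
    exact h1.2 hz
  have hdE := hE.diam_pos
  have hdF := hF.diam_pos
  set δ := min (Metric.diam E) (Metric.diam F) with hδ
  have hδ0 : 0 < δ := lt_min hdE hdF
  have hdist : setDist E F < (τ + 1) * δ := by
    rw [relDist, div_le_iff₀ hδ0] at hEF
    linarith
  obtain ⟨x₀, hx₀, y₀, hy₀, hxy⟩ := exists_dist_lt hE.isConnected.nonempty hF.isConnected.nonempty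
    hdist
  obtain ⟨x₁, hx₁, hx⟩ := exists_diam_le_dist x₀ hdE
  obtain ⟨y₁, hy₁, hy⟩ := exists_diam_le_dist y₀ hdF
  have hδE : δ ≤ Metric.diam E := min_le_left _ _
  have hδF : δ ≤ Metric.diam F := min_le_right _ _
  -- At scale `δ / 600`, the required size `200 * σ` is `δ / 3`, a third of the smaller diameter,
  -- and the distance is below `(τ + 1) * δ = 600 * (τ + 1) * σ`.
  obtain ⟨e, he, f, hf, hl⟩ := hlink _ _ _ hS J hJcard E F hE.isConnected.isPreconnected
    hF.isConnected.isPreconnected (hEΩ.trans havoid) (hFΩ.trans havoid) x₀ hx₀ x₁ hx₁ y₀ hy₀ y₁ hy₁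
    (δ / 600) (by positivity) (by linarith) (by linarith) (by linarith)
  obtain ⟨γ, hγ, hrect, hlen⟩ := H.exists_curve hΩ he hf (hEΩ he) (hFΩ hf) h𝒥
    (fun K hK => (hJmem K).2 hK) hl
  have h1 := (hadm.2 γ hγ hrect).trans hlen
  rw [show (2 : ℝ≥0∞) = ENNReal.ofReal 2 by simp, ← ENNReal.ofReal_mul (by norm_num),
    ENNReal.one_le_ofReal] at h1
  norm_num at h1

/-- Circle domains with uniformly relatively separated boundary circles are transboundary
Loewner. -/
theorem isTransboundaryLoewner (H : HullSystem P Ω) (hΩ : IsOpen Ω) (hμ : IsComparable μ C)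
    (hsep : UniformlyRelativelySeparated (boundaryCircles Ω)) (N : ℕ) :
    IsTransboundaryLoewner μ Ω N := by
  obtain ⟨c, hc, hsep⟩ := hsep
  have hsep' := H.isSeparated hc hsep
  -- `Ψ t` is the infimum of the moduli over all data of relative distance at most `t`, which makes
  -- it decreasing; the cap at `1` keeps it finite.
  let S : ℝ → Set ℝ≥0∞ := fun t => {m | ∃ E F : Set M, IsNondegenerateContinuum E ∧
    IsNondegenerateContinuum F ∧ E ⊆ Ω ∧ F ⊆ Ω ∧ relDist E F ≤ t ∧ ∃ 𝒥 : Set (Set M),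
      𝒥 ⊆ boundaryComponents Ω ∧ 𝒥.encard ≤ N ∧
      m = transboundaryModulus μ Ω (connectingCurves E F (closure Ω \ ⋃₀ 𝒥))}
  have hfin : ∀ t, min 1 (sInf (S t)) ≠ ⊤ := fun t =>
    ((min_le_left _ _).trans_lt ENNReal.one_lt_top).ne
  refine ⟨fun t => (min 1 (sInf (S t))).toReal, fun s _ t _ hst => ?_, fun t ht => ?_, ?_⟩
  · refine ENNReal.toReal_mono (hfin s) (min_le_min le_rfl (sInf_le_sInf ?_))
    rintro m ⟨E, F, hE, hF, hEΩ, hFΩ, hEF, h⟩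
    exact ⟨E, F, hE, hF, hEΩ, hFΩ, hEF.trans hst, h⟩
  · obtain ⟨ε, hε, h⟩ := H.exists_le_transboundaryModulus hΩ hμ hc hsep' N ht
    refine ENNReal.toReal_pos (ne_of_gt ?_) (hfin t)
    refine lt_min one_pos ((ENNReal.ofReal_pos.2 hε).trans_le (le_sInf ?_))
    rintro m ⟨E, F, hE, hF, hEΩ, hFΩ, hEF, 𝒥, h𝒥, hcard, rfl⟩
    exact h E F hE hF hEΩ hFΩ 𝒥 h𝒥 hcard hEF
  · intro E F hE hF hEΩ hFΩ _ 𝒥 h𝒥 hcard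
    dsimp only
    rw [ENNReal.ofReal_toReal (hfin _)]
    exact (min_le_right _ _).trans (sInf_le ⟨E, F, hE, hF, hEΩ, hFΩ, le_rfl, 𝒥, h𝒥, hcard, rfl⟩)

end HullSystem


/-! ### The gap between two discs that almost touch -/

namespace PolarSpace

variable {M : Type*} [MetricSpace M] (P : PolarSpace M)

/-- In polar coordinates around a point near its boundary, a disc is almost a half-plane. -/
lemma IsRound.exists_halfplane {P : PolarSpace M} {d : Disk M} (hd : P.IsRound d) {a : M}
    {r ε : ℝ} (hr : 0 < r) (hr' : r ≤ 2 * d.radius) (hε : 0 < ε) (hε' : ε ≤ 1 / 1000)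
    (ha : |dist a d.center - d.radius| ≤ ε ^ 2 * r) :
    ∃ ψ, ∀ s ∈ Icc (ε * r / 2) (3 * (ε * r)), ∀ θ, 48 * ε ≤ Real.cos (θ - ψ) →
      P.Φ a s θ ∈ d.carrier := by
  have hdr := hd.pos
  have hdk := hd.le
  have hk0 := P.k_nonneg
  set R := dist a d.center with hR
  set t := d.radius with ht
  have hεr : ε ^ 2 * r ≤ t / 100 := by
    have : ε ^ 2 ≤ 1 / 1000 * (1 / 1000) := by rw [sq]; gcongr
    nlinarith
  have hRt := abs_le.1 ha
  have hR0 : 0 ≤ R := dist_nonneg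
  have hkR : P.k * R ^ 2 ≤ 3 := by
    have : P.k * R ^ 2 ≤ P.k * (101 / 100 * t) ^ 2 := by gcongr; linarith
    linarith
  obtain ⟨θ₀, -, hθ₀⟩ := P.exists_angle a d.center 0
  rw [← hR] at hθ₀
  -- Near the circle the terms `s ^ 2` and `R ^ 2 - t ^ 2` are at most `6 * ε * s * t` each, whereas
  -- the cosine term is at least `12 * ε * s * t` once the cosine is `48 * ε`. The curvature term
  -- helps for a disc and is absorbed by `s ^ 2` for an exterior disc.
  have hgen : ∀ s ∈ Icc (ε * r / 2) (3 * (ε * r)), ∀ θ,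
      dist (P.Φ a s θ) d.center ^ 2 = s ^ 2 + R ^ 2 - P.k * s ^ 2 * R ^ 2 / 2 -
        2 * P.rad s * P.rad R * Real.cos (θ - θ₀) ∧
      12 * s * t * ε ≤ 48 * ε * (2 * P.rad s * P.rad R) ∧ |R ^ 2 - t ^ 2| ≤ 6 * ε * s * t ∧
      s ^ 2 ≤ 6 * s * ε * t ∧ 0 ≤ 2 * P.rad s * P.rad R ∧ 0 < s := by
    intro s hs θ
    have hεr0 : 0 < ε * r := by positivity
    have hs0 : 0 < s := by linarith [hs.1]
    have hst : s ≤ 6 * ε * t := by nlinarith [hs.2]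
    have hks : P.k * s ^ 2 ≤ 3 := by
      have : P.k * s ^ 2 ≤ P.k * (1 * t) ^ 2 := by gcongr; nlinarith
      linarith
    have h1 := P.dist_sq a θ θ₀ hs0.le hR0 (by linarith) (by linarith)
    rw [hθ₀] at h1
    have h2 := P.half_le_rad hs0.le hks
    have h3 := P.half_le_rad hR0 hkR
    have h4 := P.rad_nonneg hR0
    have h5 : s / 2 * (t / 4) ≤ P.rad s * P.rad R := by
      gcongr
      · exact P.rad_nonneg hs0.le
      · linarith
    refine ⟨h1, by nlinarith, ?_, by nlinarith, ?_, hs0⟩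
    · rw [show R ^ 2 - t ^ 2 = (R - t) * (R + t) by ring, abs_mul, abs_of_nonneg (by linarith :
        0 ≤ R + t)]
      calc |R - t| * (R + t) ≤ ε ^ 2 * r * (3 * t) :=
            mul_le_mul ha (by linarith) (by linarith) (by positivity)
        _ = 3 * ε * t * (ε * r) := by ring
        _ ≤ 3 * ε * t * (2 * s) :=
            mul_le_mul_of_nonneg_left (by linarith [hs.1]) (by positivity)
        _ = _ := by ring
    · have := P.rad_nonneg hs0.le
      positivity
  rcases hd.sign with hs | hs
  · refine ⟨θ₀, fun s hs' θ hθ => ?_⟩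
    obtain ⟨h1, h2, h3, h4, h5, h6⟩ := hgen s hs' θ
    have h3' := abs_le.1 h3
    have h7 := mul_le_mul_of_nonneg_right hθ h5
    have h8 : 0 ≤ P.k * s ^ 2 * R ^ 2 := by positivity
    have : dist (P.Φ a s θ) d.center ≤ t := le_of_sq_le_sq_of_nonneg (by nlinarith) hdr.le
    show d.height _ ≤ 0
    rw [Disk.height, hs]
    linarith
  · refine ⟨θ₀ + Real.pi, fun s hs' θ hθ => ?_⟩
    obtain ⟨h1, h2, h3, h4, h5, h6⟩ := hgen s hs' θ
    rw [← sub_sub, Real.cos_sub_pi] at hθ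
    have h3' := abs_le.1 h3
    have h7 := mul_le_mul_of_nonneg_right hθ h5
    have h8 : P.k * R ^ 2 * s ^ 2 ≤ 3 * s ^ 2 := by gcongr
    have : t ≤ dist (P.Φ a s θ) d.center := le_of_sq_le_sq_of_nonneg (by nlinarith) dist_nonneg
    show d.height _ ≤ 0
    rw [Disk.height, hs]
    linarith

/-- Jordan's inequality for the sine of the deviation from a right angle. -/
lemma abs_sub_half_pi_le {x δ : ℝ} (hx : |x| ≤ Real.pi) (h : |Real.cos x| ≤ δ) :
    abs (|x| - Real.pi / 2) ≤ 2 * δ := by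
  have hp := Real.pi_pos
  have hp4 := Real.pi_lt_four
  have hy : abs (|x| - Real.pi / 2) ≤ Real.pi / 2 :=
    abs_le.2 ⟨by linarith [abs_nonneg x], by linarith⟩
  have h1 := Real.mul_le_sin (abs_nonneg _) hy
  have h2 : Real.sin (abs (|x| - Real.pi / 2)) ≤ δ := by
    refine le_trans ?_ h
    rcases abs_cases (|x| - Real.pi / 2) with ⟨e, -⟩ | ⟨e, -⟩
    · rw [e, Real.sin_sub_pi_div_two, Real.cos_abs]; exact neg_le_abs _
    · rw [e, neg_sub, Real.sin_pi_div_two_sub, Real.cos_abs]; exact le_abs_self _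
  have h3 : 2 / Real.pi * abs (|x| - Real.pi / 2) = 2 * abs (|x| - Real.pi / 2) / Real.pi := by ring
  rw [h3, div_le_iff₀ hp] at h1
  have h4 : 0 ≤ δ := (abs_nonneg _).trans h
  nlinarith

variable [MeasurableSpace M] [BorelSpace M] {P} {μ : Measure M} {C : ℝ≥0}

/-- The set between two disjoint discs that almost touch each other is small. -/
lemma measure_gap_le (hμ : IsComparable μ C) {d d' : Disk M} (hd : P.IsRound d)
    (hd' : P.IsRound d') (hdisj : Disjoint d.carrier d'.carrier) {a : M} {ε : ℝ}
    (hr : d.radius ≤ 2 * d'.radius) (hε : 0 < ε) (hε' : ε ≤ 1 / 1000) (ha : d.height a = 0)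
    (ha' : |dist a d'.center - d'.radius| ≤ ε ^ 2 * d.radius) :
    μ {z | dist a z ∈ Icc (ε * d.radius / 2) (3 * (ε * d.radius)) ∧ 0 < d.height z ∧
      0 < d'.height z} ≤ C * ENNReal.ofReal (10 ^ 5 * ε * (ε * d.radius) ^ 2) := by
  have hr0 := hd.pos
  have hrk := hd.le
  have hp := Real.pi_pos
  have hk0 := P.k_nonneg
  have had : dist a d.center = d.radius := hd.height_eq_zero.1 ha
  obtain ⟨ψ, hψ⟩ := hd.exists_halfplane (a := a) hr0 (by linarith) hε hε'
    (by rw [had, sub_self, abs_zero]; positivity)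
  obtain ⟨ψ', hψ'⟩ := hd'.exists_halfplane (a := a) hr0 hr hε hε' ha'
  set L := ε * d.radius with hL
  have hL0 : 0 < L := by positivity
  have hmem : L ∈ Icc (L / 2) (3 * L) := ⟨by linarith, by linarith⟩
  -- Disjoint discs share no direction. Testing the bisector of `ψ` and `ψ'`, or its opposite, shows
  -- that `ψ` and `ψ'` are almost opposite.
  have hmid : |Real.cos ((ψ' - ψ) / 2)| < 48 * ε := by
    by_contra! hcon
    have key : ∀ θ, 48 * ε ≤ Real.cos (θ - ψ) → ¬ 48 * ε ≤ Real.cos (θ - ψ') := fun θ h1 h2 =>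
      hdisj.le_bot ⟨hψ L hmem θ h1, hψ' L hmem θ h2⟩
    rcases le_abs'.1 hcon with h | h
    · refine key ((ψ + ψ') / 2 + Real.pi) ?_ ?_
      · rw [show (ψ + ψ') / 2 + Real.pi - ψ = (ψ' - ψ) / 2 + Real.pi by ring, Real.cos_add_pi]
        linarith
      · rw [show (ψ + ψ') / 2 + Real.pi - ψ' = -((ψ' - ψ) / 2) + Real.pi by ring, Real.cos_add_pi,
          Real.cos_neg]
        linarith
    · refine key ((ψ + ψ') / 2) ?_ ?_
      · rwa [show (ψ + ψ') / 2 - ψ = (ψ' - ψ) / 2 by ring]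
      · rwa [show (ψ + ψ') / 2 - ψ' = -((ψ' - ψ) / 2) by ring, Real.cos_neg]
  -- Outside both discs both cosines are below `48 * ε`, and their sum is small because `ψ` and `ψ'`
  -- are almost opposite. So both are small in absolute value, and the direction is almost
  -- perpendicular to `ψ`: two thin sectors.
  have hsub : {z | dist a z ∈ Icc (L / 2) (3 * L) ∧ 0 < d.height z ∧ 0 < d'.height z} ⊆
      (fun p : ℝ × ℝ => P.Φ a p.1 p.2) '' (Icc (L / 2) (3 * L) ×ˢ
        Icc (ψ + Real.pi / 2 - 288 * ε) (ψ + Real.pi / 2 + 288 * ε)) ∪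
      (fun p : ℝ × ℝ => P.Φ a p.1 p.2) '' (Icc (L / 2) (3 * L) ×ˢ
        Icc (ψ - Real.pi / 2 - 288 * ε) (ψ - Real.pi / 2 + 288 * ε)) := by
    rintro z ⟨hz, hz1, hz2⟩
    obtain ⟨θ, hθ, hθz⟩ := P.exists_angle a z (ψ - Real.pi)
    have h1 : Real.cos (θ - ψ) < 48 * ε := by
      by_contra! hcon
      have h3 : d.height (P.Φ a (dist a z) θ) ≤ 0 := hψ _ hz θ hcon
      rw [hθz] at h3
      linarith
    have h2 : Real.cos (θ - ψ') < 48 * ε := by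
      by_contra! hcon
      have h3 : d'.height (P.Φ a (dist a z) θ) ≤ 0 := hψ' _ hz θ hcon
      rw [hθz] at h3
      linarith
    have h3 : Real.cos (θ - ψ) + Real.cos (θ - ψ') =
        2 * Real.cos (θ - (ψ + ψ') / 2) * Real.cos ((ψ' - ψ) / 2) := by
      rw [Real.cos_add_cos]
      ring_nf
    have h4 : |2 * Real.cos (θ - (ψ + ψ') / 2) * Real.cos ((ψ' - ψ) / 2)| ≤ 96 * ε := by
      rw [abs_mul, abs_mul, abs_two]
      have := Real.abs_cos_le_one (θ - (ψ + ψ') / 2)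
      nlinarith [abs_nonneg (Real.cos (θ - (ψ + ψ') / 2)), abs_nonneg (Real.cos ((ψ' - ψ) / 2))]
    have h5 : |Real.cos (θ - ψ)| ≤ 144 * ε := by
      have := abs_le.1 h4
      exact abs_le.2 ⟨by linarith, by linarith⟩
    have h6 := abs_le.1 (abs_sub_half_pi_le
      (abs_le.2 ⟨by linarith [hθ.1], by linarith [hθ.2]⟩) h5)
    rcases abs_cases (θ - ψ) with ⟨e, -⟩ | ⟨e, -⟩ <;> rw [e] at h6
    · exact Or.inl ⟨(dist a z, θ), ⟨hz, by constructor <;> linarith⟩, hθz⟩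
    · exact Or.inr ⟨(dist a z, θ), ⟨hz, by constructor <;> linarith⟩, hθz⟩
  have hk : P.k * (3 * L) ^ 2 ≤ 3 := by
    have h3 : 3 * L ≤ d.radius := by rw [hL]; nlinarith
    have := mul_le_mul_of_nonneg_left (pow_le_pow_left₀ (by positivity) h3 2) hk0
    linarith
  have hsec : ∀ φ, μ ((fun p : ℝ × ℝ => P.Φ a p.1 p.2) '' (Icc (L / 2) (3 * L) ×ˢ
      Icc (φ - 288 * ε) (φ + 288 * ε))) ≤ C * ENNReal.ofReal (5 * 10 ^ 4 * ε * L ^ 2) := by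
    intro φ
    refine (P.measure_sector_le hμ a (by linarith) le_rfl (by positivity) hk).trans ?_
    gcongr
    rw [show (9 : ℝ≥0∞) = ENNReal.ofReal 9 by simp, ← ENNReal.ofReal_mul (by linarith),
      ← ENNReal.ofReal_mul (by norm_num)]
    refine ENNReal.ofReal_le_ofReal ?_
    have : 0 ≤ ε * L ^ 2 := by positivity
    nlinarith
  refine (measure_mono hsub).trans ((measure_union_le _ _).trans ((add_le_add (hsec _)
    (hsec _)).trans (le_of_eq ?_)))
  rw [← mul_add, ← ENNReal.ofReal_add (by positivity) (by positivity)]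
  congr 2
  ring

end PolarSpace

/-! ### A criterion for admissibility -/

section LowerBound

variable {M : Type*} [MetricSpace M]

/-- The one-sided jumps of the variation equal those of the curve, which are zero. -/
lemma continuousOn_variationOnFromTo {γ : ℝ → M} {a b : ℝ} (hγ : ContinuousOn γ (Icc a b))
    (h : LocallyBoundedVariationOn γ (Icc a b)) :
    ContinuousOn (variationOnFromTo γ (Icc a b) a) (Icc a b) := by
  intro t ht
  have ha : a ∈ Icc a b := left_mem_Icc.2 (ht.1.trans ht.2)
  have hl := variationOnFromTo.tendsto_left ha ht h ((hγ t ht).mono inter_subset_left).tendsto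
  have hr := variationOnFromTo.tendsto_right ha ht h ((hγ t ht).mono inter_subset_left).tendsto
  rw [dist_self, sub_zero] at hl
  rw [dist_self, add_zero] at hr
  have h1 : ContinuousWithinAt (variationOnFromTo γ (Icc a b) a)
      (insert t (Icc a b ∩ Iio t ∪ Icc a b ∩ Ioi t)) t :=
    continuousWithinAt_insert_self.2 (ContinuousWithinAt.union hl hr)
  refine h1.mono fun s hs => ?_
  rcases lt_trichotomy s t with h | h | h
  · exact Or.inr (Or.inl ⟨hs, h⟩)
  · exact Or.inl h
  · exact Or.inr (Or.inr ⟨hs, h⟩)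

/-- The oscillation of a Lipschitz function along a curve is bounded by the integral of the
Lipschitz constant over the part of the curve where the function is not constant. -/
lemma edist_le_compactLineIntegral {u : M → ℝ} {K : ℝ≥0} (hu : LipschitzWith K u)
    (hu01 : ∀ z, u z ∈ Icc 0 1) {A : Set M} (hA : IsClosed A) (huA : ∀ z, u z ∈ Ioo 0 1 → z ∈ A)
    {γ : ℝ → M} {a b : ℝ} (hab : a ≤ b) (hγ : ContinuousOn γ (Icc a b))
    (h : LocallyBoundedVariationOn γ (Icc a b)) :
    edist (u (γ a)) (u (γ b)) ≤ compactLineIntegral (A.indicator fun _ => K) γ a b := by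
  set V := variationOnFromTo γ (Icc a b) a with hV
  set f := naturalParameterization γ (Icc a b) a with hf
  have ha : a ∈ Icc a b := left_mem_Icc.2 hab
  have hb : b ∈ Icc a b := right_mem_Icc.2 hab
  have hVa : V a = 0 := variationOnFromTo.self _ _ _
  have hVb : 0 ≤ V b := variationOnFromTo.nonneg_of_le _ _ hab
  have hfV : ∀ t ∈ Icc a b, f (V t) = γ t := fun t ht =>
    naturalParameterization_variationOnFromTo h ht
  have himg : Icc 0 (V b) ⊆ V '' Icc a b := by
    have := intermediate_value_Icc hab (continuousOn_variationOnFromTo hγ h)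
    rwa [← hV, hVa] at this
  have hmono : MonotoneOn V (Icc a b) := variationOnFromTo.monotoneOn h ha
  have hdist : ∀ s ∈ Icc a b, ∀ t ∈ Icc a b, s ≤ t → dist (γ s) (γ t) ≤ V t - V s := by
    intro s hs t ht hst
    rw [hV, variationOnFromTo.sub_right h ha ht hs, variationOnFromTo.eq_of_le _ _ hst, dist_edist]
    exact ENNReal.toReal_mono (h s t hs ht) (eVariationOn.edist_le _
      ⟨hs, left_mem_Icc.2 hst⟩ ⟨ht, right_mem_Icc.2 hst⟩)
  have hlip : LipschitzOnWith 1 f (Icc 0 (V b)) := by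
    refine LipschitzOnWith.of_dist_le_mul fun x hx y hy => ?_
    obtain ⟨s, hs, rfl⟩ := himg hx
    obtain ⟨t, ht, rfl⟩ := himg hy
    rw [hfV s hs, hfV t ht, NNReal.coe_one, one_mul]
    rcases le_total s t with hst | hst
    · rw [dist_comm (V s), Real.dist_eq, abs_of_nonneg (sub_nonneg.2 (hmono hs ht hst))]
      exact hdist s hs t ht hst
    · rw [dist_comm, Real.dist_eq, abs_of_nonneg (sub_nonneg.2 (hmono ht hs hst))]
      exact hdist t ht s hs hst
  have hlip' : LipschitzOnWith K (fun s => u (f s)) (Icc 0 (V b)) := by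
    have := hu.comp_lipschitzOnWith hlip
    rwa [mul_one] at this
  set S := Icc 0 (V b) ∩ f ⁻¹' A with hS
  have hSm : MeasurableSet S :=
    (hlip.continuousOn.preimage_isClosed_of_isClosed isClosed_Icc hA).measurableSet
  -- Every value strictly between the two end values is attained at an arclength parameter in `A`.
  -- Hence the oscillation is at most `K` times the length of that parameter set.
  have hsub : Ioo (min (u (γ a)) (u (γ b))) (max (u (γ a)) (u (γ b))) ⊆ (fun s => u (f s)) '' S := by
    intro y hy
    have h1 := intermediate_value_uIcc (f := fun s => u (f s)) (a := 0) (b := V b)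
      (by rw [uIcc_of_le hVb]; exact hlip'.continuousOn)
    have e0 : f 0 = γ a := by rw [← hVa]; exact hfV a ha
    simp only [e0, hfV b hb] at h1
    obtain ⟨s, hs, hsy⟩ := h1 (Ioo_subset_Icc_self hy)
    rw [uIcc_of_le hVb] at hs
    refine ⟨s, ⟨hs, huA _ ?_⟩, hsy⟩
    dsimp only at hsy
    rw [hsy]
    exact ⟨lt_of_le_of_lt (le_min (hu01 _).1 (hu01 _).1) hy.1,
      lt_of_lt_of_le hy.2 (max_le (hu01 _).2 (hu01 _).2)⟩
  calc edist (u (γ a)) (u (γ b)) = volume (Ioo (min (u (γ a)) (u (γ b)))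
        (max (u (γ a)) (u (γ b)))) := by
        rw [Real.volume_Ioo, max_sub_min_eq_abs', edist_dist, Real.dist_eq]
    _ ≤ volume ((fun s => u (f s)) '' S) := measure_mono hsub
    _ ≤ K * volume S := by
        have := (hlip'.mono (inter_subset_left (t := f ⁻¹' A))).hausdorffMeasure_image_le
          (zero_le_one (α := ℝ))
        rwa [ENNReal.rpow_one, hausdorffMeasure_real] at this
    _ = ∫⁻ s in S, A.indicator (fun _ => (K : ℝ≥0∞)) (f s) := by
        rw [setLIntegral_congr_fun hSm (g := fun _ => (K : ℝ≥0∞))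
          (fun s hs => indicator_of_mem (s := A) hs.2 _), setLIntegral_const]
    _ ≤ ∫⁻ s in Icc 0 (V b), A.indicator (fun _ => (K : ℝ≥0∞)) (f s) :=
        lintegral_mono_set inter_subset_left

/-- Pieces are disjoint and have non-empty interior; a piece containing `0` or `1` is open only
relative to `[0, 1]`. -/
lemma countable_pieces {Ω : Set M} (hΩ : IsOpen Ω) {γ : ℝ → M} (hγ : ContinuousOn γ (Icc 0 1)) :
    (pieces Ω γ).Countable := by
  have hdisj : (pieces Ω γ).PairwiseDisjoint id := by
    intro J hJ J' hJ' hne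
    rw [Function.onFun, disjoint_left]
    exact fun t ht ht' => hne (eq_of_mem_componentsOf hJ hJ' ht ht')
  refine hdisj.countable_of_nonempty_interior fun J hJ => ?_
  obtain ⟨t, ht, rfl⟩ := hJ
  obtain ⟨U, hU, hU'⟩ := (continuousOn_iff'.1 hγ) Ω hΩ
  rw [inter_comm] at hU'
  have htU : t ∈ U := (hU'.subset ht).1
  obtain ⟨δ, hδ, hball⟩ := Metric.isOpen_iff.1 hU t htU
  rw [Real.ball_eq_Ioo] at hball
  have hsub : Icc 0 1 ∩ Ioo (t - δ) (t + δ) ⊆ connectedComponentIn (Icc 0 1 ∩ γ ⁻¹' Ω) t := by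
    refine (ordConnected_Icc.inter ordConnected_Ioo).isPreconnected.subset_connectedComponentIn
      ⟨ht.1, by linarith, by linarith⟩ fun s hs => ?_
    rw [hU']
    exact ⟨hball hs.2, hs.1⟩
  have hne : max 0 (t - δ) < min 1 (t + δ) :=
    max_lt (lt_min one_pos (by linarith [ht.1.1])) (lt_min (by linarith [ht.1.2]) (by linarith))
  refine (nonempty_Ioo.2 hne).mono (interior_maximal (fun s hs => hsub ?_) isOpen_Ioo)
  exact ⟨⟨((le_max_left _ _).trans_lt hs.1).le, (hs.2.trans_le (min_le_left _ _)).le⟩,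
    (le_max_right _ _).trans_lt hs.1, hs.2.trans_le (min_le_right _ _)⟩

/-- Along the curve `u` takes all values in `[0, 1]`. These are covered by the images of the pieces,
whose diameters are bounded by line integrals, and of the components met, whose diameters are
bounded by weights; countability allows adding the lengths. -/
lemma one_le_transboundaryLength {Ω : Set M} (hΩ : IsOpen Ω)
    (hcount : (boundaryComponents Ω).Countable) {u : M → ℝ} {K : ℝ≥0} (hu : LipschitzWith K u)
    (hu01 : ∀ z, u z ∈ Icc 0 1) {A : Set M} (hA : IsClosed A) (huA : ∀ z, u z ∈ Ioo 0 1 → z ∈ A)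
    {w : boundaryComponents Ω → ℝ≥0∞} {γ : ℝ → M} (hγ : ContinuousOn γ (Icc 0 1))
    (hγΩ : MapsTo γ (Icc 0 1) (closure Ω)) (h0 : u (γ 0) = 0) (h1 : u (γ 1) = 1)
    (hrect : LocallyRectifiableRel Ω γ)
    (hw : ∀ K : boundaryComponents Ω, (γ '' Icc 0 1 ∩ (K : Set M)).Nonempty →
      Metric.ediam (u '' (K : Set M)) ≤ w K) :
    1 ≤ transboundaryLength Ω (A.indicator fun _ => K) w γ := by
  have : Countable (pieces Ω γ) := (countable_pieces hΩ hγ).to_subtype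
  have : Countable (boundaryComponents Ω) := hcount.to_subtype
  have hcover : Icc (0 : ℝ) 1 ⊆ (⋃ J : pieces Ω γ, (fun t => u (γ t)) '' J) ∪
      ⋃ K : {K : boundaryComponents Ω | (γ '' Icc 0 1 ∩ (K : Set M)).Nonempty},
        u '' ((K : boundaryComponents Ω) : Set M) := by
    intro y hy
    obtain ⟨t, ht, hty⟩ := intermediate_value_Icc zero_le_one
      (hu.continuous.comp_continuousOn hγ) (by simpa only [Function.comp, h0, h1] using hy)
    by_cases htΩ : γ t ∈ Ω
    · obtain ⟨J, hJ, htJ⟩ := exists_mem_componentsOf (A := Icc 0 1 ∩ γ ⁻¹' Ω) ⟨ht, htΩ⟩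
      exact Or.inl (mem_iUnion.2 ⟨⟨J, hJ⟩, t, htJ, hty⟩)
    · have hfr : γ t ∈ frontier Ω := by rw [hΩ.frontier_eq]; exact ⟨hγΩ ht, htΩ⟩
      obtain ⟨K, hK, htK⟩ := exists_mem_componentsOf hfr
      exact Or.inr (mem_iUnion.2 ⟨⟨⟨K, hK⟩, γ t, ⟨t, ht, rfl⟩, htK⟩, γ t, htK, hty⟩)
  calc (1 : ℝ≥0∞) = volume (Icc (0 : ℝ) 1) := by simp
    _ ≤ _ := (measure_mono hcover).trans (measure_union_le _ _)
    _ ≤ _ := by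
      refine add_le_add ((measure_iUnion_le _).trans (ENNReal.tsum_le_tsum fun J => ?_))
        ((measure_iUnion_le _).trans (ENNReal.tsum_le_tsum fun K => ?_))
      · refine (Real.volume_le_diam _).trans (Metric.ediam_le ?_)
        have hord : (J : Set ℝ).OrdConnected :=
          (isConnected_of_mem_componentsOf J.2).isPreconnected.ordConnected
        have key : ∀ s ∈ (J : Set ℝ), ∀ t ∈ (J : Set ℝ), s ≤ t → edist (u (γ s)) (u (γ t)) ≤
            lineIntegral (A.indicator fun _ => (K : ℝ≥0∞)) γ J := by
          intro s hs t ht hst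
          have hsub := hord.out hs ht
          refine (edist_le_compactLineIntegral hu hu01 hA huA hst (hγ.mono (hsub.trans
            ((subset_of_mem_componentsOf J.2).trans inter_subset_left)))
            (fun a b ha hb => (hrect J J.2 a b (hsub ha) (hsub hb)).mono
              (inter_subset_inter_left _ hsub))).trans ?_
          exact le_iSup_of_le s (le_iSup_of_le t (le_iSup_of_le hs (le_iSup_of_le ht
            (le_iSup_of_le hst le_rfl))))
        rintro _ ⟨s, hs, rfl⟩ _ ⟨t, ht, rfl⟩
        rcases le_total s t with hst | hst
        · exact key s hs t ht hst
        · rw [edist_comm]; exact key t ht s hs hst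
      · exact (Real.volume_le_diam _).trans (hw K K.2)

end LowerBound


/-! ### The Loewner property implies separation -/

variable {M : Type*} [MetricSpace M] {P : PolarSpace M} {Ω : Set M}

/-- The function that increases from `0` to `1` across the annulus `{L ≤ dist a z ≤ 2 * L}`. -/
noncomputable def ramp (a : M) (L : ℝ) (z : M) : ℝ := max 0 (min 1 (dist a z / L - 1))

lemma ramp_mem (a : M) (L : ℝ) (z : M) : ramp a L z ∈ Icc 0 1 :=
  ⟨le_max_left _ _, max_le zero_le_one (min_le_left _ _)⟩

lemma ramp_of_le {a : M} {L : ℝ} (hL : 0 < L) {z : M} (h : dist a z ≤ L) : ramp a L z = 0 := by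
  have : dist a z / L ≤ 1 := (div_le_one hL).2 h
  exact max_eq_left ((min_le_right _ _).trans (by linarith))

lemma ramp_of_ge {a : M} {L : ℝ} (hL : 0 < L) {z : M} (h : 2 * L ≤ dist a z) : ramp a L z = 1 := by
  have : 2 ≤ dist a z / L := (le_div_iff₀ hL).2 h
  rw [ramp, min_eq_left (by linarith), max_eq_right zero_le_one]

lemma lipschitzWith_ramp (a : M) {L : ℝ} (hL : 0 < L) :
    LipschitzWith (L⁻¹).toNNReal (ramp a L) := by
  have h1 : LipschitzWith (L⁻¹).toNNReal fun z : M => dist a z / L - 1 := by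
    refine LipschitzWith.of_dist_le_mul fun x y => ?_
    rw [Real.coe_toNNReal _ (by positivity), Real.dist_eq, sub_sub_sub_cancel_right, ← sub_div,
      abs_div, abs_of_pos hL, div_eq_inv_mul]
    gcongr
    rw [dist_comm a x, dist_comm a y]
    exact abs_dist_sub_le x y a
  exact (h1.const_min 1).const_max 0

lemma setDist_comm (E F : Set M) : setDist E F = setDist F E := by
  rw [setDist, setDist, image2_swap]
  simp only [dist_comm]

/-- There are continua at both sides of an annulus around a boundary point. -/
lemma exists_continua (P : PolarSpace M) (hΩ : IsOpen Ω) (hΩc : IsConnected Ω) {a : M} {L : ℝ}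
    (hL : 0 < L) (ha : a ∈ closure Ω) (hfar : ∃ b ∈ closure Ω, 4 * L ≤ dist a b) :
    ∃ E F : Set M, IsNondegenerateContinuum E ∧ IsNondegenerateContinuum F ∧ E ⊆ Ω ∧ F ⊆ Ω ∧
      (∀ z ∈ E, dist a z ≤ L) ∧ (∀ z ∈ F, 2 * L ≤ dist a z) ∧ relDist E F ∈ Ioc 0 4 := by
  have := P.locallyPathConnectedSpace
  obtain ⟨b, hb, hab⟩ := hfar
  obtain ⟨x, hxΩ, hx⟩ := Metric.mem_closure_iff.1 ha (L / 10) (by positivity)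
  obtain ⟨y, hyΩ, hy⟩ := Metric.mem_closure_iff.1 hb (L / 10) (by positivity)
  have hy' : 39 / 10 * L ≤ dist a y := by
    have := dist_triangle_right a b y
    linarith
  obtain ⟨p, hp⟩ := (hΩ.isConnected_iff_isPathConnected.1 hΩc).joinedIn x hxΩ y hyΩ
  have hcont : Continuous fun t : unitInterval => dist a (p t) := by fun_prop
  -- `E` is the path up to its first arrival at distance `L`, and `F` the path after its last visit
  -- to distance `2 * L`. Both have diameter at least `9 / 10 * L`, and they are at most `3 * L`
  -- apart.
  obtain ⟨t₁, ht₁, ht₁'⟩ := (isClosed_le continuous_const hcont :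
    IsClosed {t | L ≤ dist a (p t)}).isCompact.exists_isLeast
    ⟨1, show L ≤ dist a (p 1) by rw [p.target]; linarith⟩
  obtain ⟨t₂, ht₂, ht₂'⟩ := (isClosed_le hcont continuous_const :
    IsClosed {t | dist a (p t) ≤ 2 * L}).isCompact.exists_isGreatest
    ⟨0, show dist a (p 0) ≤ 2 * L by rw [p.source]; linarith⟩
  replace ht₁ : L ≤ dist a (p t₁) := ht₁
  replace ht₂ : dist a (p t₂) ≤ 2 * L := ht₂
  have hE : ∀ z ∈ p '' Iic t₁, dist a z ≤ L := by
    rintro _ ⟨t, ht, rfl⟩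
    by_contra! hcon
    obtain ⟨s, hs, hsL⟩ := PolarSpace.exists_dist_eq (isPreconnected_Icc.image p
      p.continuous.continuousOn) a (a := p 0) (b := p t) (E := p '' Icc 0 t) ⟨0, left_mem_Icc.2
        unitInterval.nonneg', rfl⟩ ⟨t, right_mem_Icc.2 unitInterval.nonneg', rfl⟩ (s := L)
      (by rw [p.source]; linarith) hcon.le
    obtain ⟨s, hs, rfl⟩ := hs
    have h1 : t₁ ≤ s := ht₁' hsL.ge
    have h2 : s = t := le_antisymm hs.2 (le_trans ht h1)
    rw [h2] at hsL
    linarith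
  have hF : ∀ z ∈ p '' Ici t₂, 2 * L ≤ dist a z := by
    rintro _ ⟨t, ht, rfl⟩
    by_contra! hcon
    obtain ⟨s, hs, hsL⟩ := PolarSpace.exists_dist_eq (isPreconnected_Icc.image p
      p.continuous.continuousOn) a (a := p t) (b := p 1) (E := p '' Icc t 1) ⟨t, left_mem_Icc.2
        unitInterval.le_one', rfl⟩ ⟨1, right_mem_Icc.2 unitInterval.le_one', rfl⟩ (s := 2 * L)
      hcon.le (by rw [p.target]; linarith)
    obtain ⟨s, hs, rfl⟩ := hs
    have h1 : s ≤ t₂ := ht₂' hsL.le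
    have h2 : s = t := le_antisymm (le_trans h1 ht) hs.1
    rw [h2] at hsL
    linarith
  have hxE : x ∈ p '' Iic t₁ := ⟨0, unitInterval.nonneg', p.source⟩
  have hyF : y ∈ p '' Ici t₂ := ⟨1, unitInterval.le_one', p.target⟩
  have h1E : p t₁ ∈ p '' Iic t₁ := ⟨t₁, mem_Iic.2 le_rfl, rfl⟩
  have h2F : p t₂ ∈ p '' Ici t₂ := ⟨t₂, mem_Ici.2 le_rfl, rfl⟩
  have hcE : IsCompact (p '' Iic t₁) := isClosed_Iic.isCompact.image p.continuous
  have hcF : IsCompact (p '' Ici t₂) := isClosed_Ici.isCompact.image p.continuous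
  have hdE : 9 / 10 * L ≤ dist x (p t₁) := by
    have := dist_triangle a x (p t₁)
    linarith
  have hdF : 9 / 10 * L ≤ dist (p t₂) y := by
    have := dist_triangle a (p t₂) y
    linarith
  refine ⟨p '' Iic t₁, p '' Ici t₂, ⟨hcE, ⟨⟨x, hxE⟩, isPreconnected_Iic.image p
    p.continuous.continuousOn⟩, x, hxE, p t₁, h1E, fun h => ?_⟩, ⟨hcF, ⟨⟨y, hyF⟩,
    isPreconnected_Ici.image p p.continuous.continuousOn⟩, p t₂, h2F, y, hyF, fun h => ?_⟩, ?_, ?_,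
    hE, hF, ?_⟩
  · linarith [dist_eq_zero.2 h]
  · linarith [dist_eq_zero.2 h]
  · rintro _ ⟨t, -, rfl⟩
    exact hp t
  · rintro _ ⟨t, -, rfl⟩
    exact hp t
  · have hmin : 9 / 10 * L ≤ min (Metric.diam (p '' Iic t₁)) (Metric.diam (p '' Ici t₂)) :=
      le_min (hdE.trans (Metric.dist_le_diam_of_mem hcE.isBounded hxE h1E))
        (hdF.trans (Metric.dist_le_diam_of_mem hcF.isBounded h2F hyF))
    have hmin0 : 0 < min (Metric.diam (p '' Iic t₁)) (Metric.diam (p '' Ici t₂)) := by linarith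
    constructor
    · refine div_pos (hL.trans_le (le_csInf ⟨_, x, hxE, y, hyF, rfl⟩ ?_)) hmin0
      rintro _ ⟨z, hz, z', hz', rfl⟩
      linarith [dist_triangle a z z', hE z hz, hF z' hz']
    · rw [relDist, div_le_iff₀ hmin0]
      have h1 := setDist_le h1E h2F
      have h2 := dist_triangle_left (p t₁) (p t₂) a
      have h3 := hE _ h1E
      linarith

namespace HullSystem

lemma diam_le (H : HullSystem P Ω) (K : boundaryCircles Ω) :
    Metric.diam (K : Set M) ≤ 2 * (H.disk K).radius := by
  have := (H.round K).pos
  refine Metric.diam_le_of_forall_dist_le (by positivity) fun z hz z' hz' => ?_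
  rw [H.sphere_eq K, Metric.mem_sphere] at hz hz'
  linarith [dist_triangle_right z z' (H.disk K).center]

lemma subset_closure (K : boundaryCircles Ω) : (K : Set M) ⊆ closure Ω :=
  (subset_of_mem_componentsOf K.2.1).trans frontier_subset_closure

variable [MeasurableSpace M] [BorelSpace M] {μ : Measure M} {C : ℝ≥0}

/-- A circle that crosses an annulus bounds a disc that covers a part of the annulus. -/
lemma ediam_ramp_sq_le (H : HullSystem P Ω) (hμ : IsComparable μ C) {a : M} {L : ℝ} (hL : 0 < L)
    (hk : P.k * L ^ 2 ≤ 1) (K : boundaryCircles Ω) :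
    Metric.ediam (ramp a L '' (K : Set M)) ^ 2 ≤ ENNReal.ofReal (576 / L ^ 2) * (1875 * (C *
      μ ((H.disk K).carrier ∩ {z | dist a z ∈ Icc (L / 2) (3 * L)}))) := by
  have hbdd : Bornology.IsBounded (ramp a L '' (K : Set M)) :=
    (Metric.isBounded_Icc 0 1).subset (by rintro _ ⟨z, -, rfl⟩; exact ramp_mem a L z)
  set W := Metric.diam (ramp a L '' (K : Set M)) with hW
  have hWe : Metric.ediam (ramp a L '' (K : Set M)) = ENNReal.ofReal W := by
    rw [hW, Metric.diam, ENNReal.ofReal_toReal hbdd.ediam_ne_top]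
  have hW0 : 0 ≤ W := Metric.diam_nonneg
  rw [hWe]
  rcases hW0.eq_or_lt with h0 | hpos
  · rw [← h0]; simp
  have hW1 : W ≤ 1 := by
    refine Metric.diam_le_of_forall_dist_le zero_le_one ?_
    rintro _ ⟨z, -, rfl⟩ _ ⟨z', -, rfl⟩
    have := Real.dist_le_of_mem_Icc_01 (ramp_mem a L z) (ramp_mem a L z')
    exact this
  have hr := (H.round K).pos
  have hWr : W * L ≤ 2 * (H.disk K).radius := by
    have : W ≤ 2 * (H.disk K).radius / L := by
      refine Metric.diam_le_of_forall_dist_le (by positivity) ?_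
      rintro _ ⟨z, hz, rfl⟩ _ ⟨z', hz', rfl⟩
      refine ((lipschitzWith_ramp a hL).dist_le_mul z z').trans ?_
      rw [Real.coe_toNNReal _ (by positivity), div_eq_inv_mul]
      gcongr
      rw [H.sphere_eq K, Metric.mem_sphere] at hz hz'
      linarith [dist_triangle_right z z' (H.disk K).center]
    rwa [le_div_iff₀ hL] at this
  -- A connected set that misses the open annulus lies on one side of it, where the ramp is
  -- constant.
  obtain ⟨z, hz, hzL⟩ : ∃ z ∈ (K : Set M), dist a z ∈ Ioo L (2 * L) := by
    by_contra! hcon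
    have hpre := (isConnected_of_mem_componentsOf K.2.1).isPreconnected
    have hconst : ∀ x ∈ (K : Set M), ∀ y ∈ (K : Set M), ramp a L x = ramp a L y := by
      intro x hx y hy
      have hcase : ∀ z ∈ (K : Set M), dist a z ≤ L ∨ 2 * L ≤ dist a z := by
        intro z hz
        by_contra! h
        exact hcon z hz h
      have hno : ∀ x ∈ (K : Set M), ∀ y ∈ (K : Set M), dist a x ≤ L → 2 * L ≤ dist a y → False := by
        intro x hx y hy hxL hyL
        obtain ⟨z, hz, hzL⟩ := PolarSpace.exists_dist_eq hpre a hx hy (s := 3 / 2 * L)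
          (by linarith) (by linarith)
        exact hcon z hz ⟨by linarith, by linarith⟩
      rcases hcase x hx with h | h <;> rcases hcase y hy with h' | h'
      · rw [ramp_of_le hL h, ramp_of_le hL h']
      · exact (hno x hx y hy h h').elim
      · exact (hno y hy x hx h' h).elim
      · rw [ramp_of_ge hL h, ramp_of_ge hL h']
    have : W ≤ 0 := by
      refine Metric.diam_le_of_forall_dist_le le_rfl ?_
      rintro _ ⟨z, hz, rfl⟩ _ ⟨z', hz', rfl⟩
      rw [hconst z hz z' hz', dist_self]
    linarith
  -- The radius is at least `W * L / 2 ≥ 4 * σ`, as fatness requires, and `3 * σ ≤ L / 8` keeps the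
  -- ball in the enlarged annulus. The factor `576` is `24 ^ 2`.
  set σ := W * L / 24 with hσ
  have hσ0 : 0 < σ := by positivity
  have hσL : σ ≤ L / 24 := by rw [hσ]; gcongr; nlinarith
  have hzc : z ∈ (H.disk K).carrier := by
    rw [H.sphere_eq K, ← (H.round K).height_eq_zero] at hz
    exact hz.le
  have hfat := (H.round K).le_measure_inter hμ hzc hσ0
    (by
      have : P.k * σ ^ 2 ≤ P.k * (L / 24) ^ 2 :=
        mul_le_mul_of_nonneg_left (pow_le_pow_left₀ hσ0.le hσL 2) P.k_nonneg
      linarith) (fun _ => by linarith)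
  have hsub : (H.disk K).carrier ∩ Metric.ball z (3 * σ) ⊆
      (H.disk K).carrier ∩ {z | dist a z ∈ Icc (L / 2) (3 * L)} := by
    refine inter_subset_inter_right _ fun y hy => ?_
    rw [Metric.mem_ball] at hy
    have h1 := dist_triangle a y z
    have h2 := dist_triangle_right a y z
    constructor <;> linarith [hzL.1, hzL.2, dist_triangle_right a z y, dist_comm z y]
  calc ENNReal.ofReal W ^ 2 = ENNReal.ofReal (576 / L ^ 2) * ENNReal.ofReal (σ ^ 2) := by
        rw [← ENNReal.ofReal_pow hW0, ← ENNReal.ofReal_mul (by positivity)]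
        congr 1
        rw [hσ]
        field_simp
        norm_num
    _ ≤ _ := by
        refine mul_le_mul_right (hfat.trans ?_) _
        gcongr

/-- The test distribution is `1 / L` on the annulus and the oscillation of the ramp on components
other than the two circles. Density and weights are both charged to the gap between the two discs,
of area `O(ε * L ^ 2)`, which makes the mass `O(ε)`. -/
lemma transboundaryModulus_le_of_close (H : HullSystem P Ω)
    (hΩ' : IsCountablyConnectedCircleDomain Ω) (hμ : IsComparable μ C) {ε : ℝ} (hε : 0 < ε)
    (hε' : ε ≤ 1 / 1000) {K K' : boundaryCircles Ω} (hne : K ≠ K') (hr : (H.disk K).radius ≤ 2 * (H.disk K').radius) {a a' : M}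
    (ha : a ∈ (K : Set M)) (ha' : a' ∈ (K' : Set M))
    (haa' : dist a a' ≤ ε ^ 2 * (H.disk K).radius) {E F : Set M}
    (hE : ∀ z ∈ E, dist a z ≤ ε * (H.disk K).radius)
    (hF : ∀ z ∈ F, 2 * (ε * (H.disk K).radius) ≤ dist a z) :
    transboundaryModulus μ Ω (connectingCurves E F (closure Ω \ ⋃₀ {(K : Set M), (K' : Set M)})) ≤
      (1 + 576 * 1875 * C) * C * ENNReal.ofReal (10 ^ 5 * ε) := by
  classical
  have hΩ := hΩ'.isOpen
  set L := ε * (H.disk K).radius with hLdef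
  have hr0 := (H.round K).pos
  have hL : 0 < L := by positivity
  have hkL : P.k * L ^ 2 ≤ 1 := by
    have h0 : L ≤ 1 / 1000 * (H.disk K).radius := mul_le_mul_of_nonneg_right hε' hr0.le
    have h1 := mul_le_mul_of_nonneg_left (pow_le_pow_left₀ hL.le h0 2) P.k_nonneg
    have := (H.round K).le
    linarith
  have := H.countable.to_subtype
  set G := {z | dist a z ∈ Icc (L / 2) (3 * L) ∧ 0 < (H.disk K).height z ∧
    0 < (H.disk K').height z} with hG
  have hμG : μ G ≤ C * ENNReal.ofReal (10 ^ 5 * ε * L ^ 2) := by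
    refine PolarSpace.measure_gap_le hμ (H.round K) (H.round K') (H.disjoint hne) hr hε hε' ?_ ?_
    · rwa [(H.round K).height_eq_zero, ← H.sphere_eq]
    · rw [H.sphere_eq, Metric.mem_sphere] at ha'
      rw [← ha']
      exact (abs_dist_sub_le a a' _).trans haa'
  have hGm : MeasurableSet G := by
    have h1 : IsClosed {z | dist a z ∈ Icc (L / 2) (3 * L)} :=
      isClosed_Icc.preimage (continuous_const.dist continuous_id)
    have h2 : ∀ K, IsOpen {z | 0 < (H.disk K).height z} := fun K =>
      isOpen_lt continuous_const (H.disk K).continuous_height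
    exact h1.measurableSet.inter ((h2 K).measurableSet.inter (h2 K').measurableSet)
  have hLc : ENNReal.ofReal (L⁻¹) = ((L⁻¹).toNNReal : ℝ≥0∞) := rfl
  let A : Set M := {z | dist a z ∈ Icc L (2 * L)}
  have hA : IsClosed A := isClosed_Icc.preimage (continuous_const.dist continuous_id)
  let ρ : M → ℝ≥0∞ := A.indicator fun _ => ((L⁻¹).toNNReal : ℝ≥0∞)
  let w : boundaryComponents Ω → ℝ≥0∞ := fun Q =>
    if (Q : Set M) = K ∨ (Q : Set M) = K' then 0 else Metric.ediam (ramp a L '' (Q : Set M))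
  have hadm : IsAdmissible Ω (connectingCurves E F (closure Ω \ ⋃₀ {(K : Set M), (K' : Set M)}))
      ρ w := by
    refine ⟨measurable_const.indicator hA.measurableSet, ?_⟩
    rintro γ ⟨hγ, hmaps, hγ0, hγ1⟩ hrect
    refine one_le_transboundaryLength hΩ H.countable (lipschitzWith_ramp a hL) (ramp_mem a L) hA
      (fun z hz => ?_) hγ (fun t ht => (hmaps ht).1) (ramp_of_le hL (hE _ hγ0))
      (ramp_of_ge hL (hF _ hγ1)) hrect ?_
    · by_contra hcon
      have : dist a z < L ∨ 2 * L < dist a z := by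
        by_contra! h
        exact hcon h
      rcases this with h | h
      · rw [ramp_of_le hL h.le] at hz
        exact lt_irrefl _ hz.1
      · rw [ramp_of_ge hL h.le] at hz
        exact lt_irrefl _ hz.2
    · rintro Q ⟨_, ⟨t, ht, rfl⟩, htQ⟩
      have h1 := (hmaps ht).2
      rw [show w Q = _ from if_neg ?_]
      rintro (h | h)
      · exact h1 ⟨Q, Or.inl h, htQ⟩
      · exact h1 ⟨Q, Or.inr h, htQ⟩
  have hmass : ∫⁻ z in Ω, ρ z ^ 2 ∂μ ≤ ENNReal.ofReal (1 / L ^ 2) * μ G := by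
    calc ∫⁻ z in Ω, ρ z ^ 2 ∂μ ≤ ∫⁻ z in Ω, G.indicator (fun _ => ENNReal.ofReal (1 / L ^ 2)) z ∂μ := by
          refine setLIntegral_mono' hΩ.measurableSet fun z hz => ?_
          by_cases hzA : z ∈ A
          · have hzG : z ∈ G := ⟨⟨by linarith [hzA.1], by linarith [hzA.2]⟩, H.height_pos K z hz,
              H.height_pos K' z hz⟩
            rw [indicator_of_mem hzG, show ρ z = _ from indicator_of_mem hzA _, ← hLc,
              ← ENNReal.ofReal_pow (by positivity), one_div, inv_pow]
          · rw [show ρ z = 0 from indicator_of_notMem hzA _]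
            simp
      _ ≤ ∫⁻ z, G.indicator (fun _ => ENNReal.ofReal (1 / L ^ 2)) z ∂μ :=
          setLIntegral_le_lintegral _ _
      _ = _ := lintegral_indicator_const hGm _
  -- The part of the gap in the disc bounded by `Q`, and empty for a point. These sets are disjoint,
  -- so their areas add up to at most that of the gap.
  let S : boundaryComponents Ω → Set M := fun Q =>
    {z | z ∈ G ∧ ∃ h : (Q : Set M) ∈ boundaryCircles Ω, z ∈ (H.disk ⟨Q, h⟩).carrier}
  have hSm : ∀ Q, MeasurableSet (S Q) := by
    intro Q
    by_cases h : (Q : Set M) ∈ boundaryCircles Ω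
    · have : S Q = G ∩ (H.disk ⟨Q, h⟩).carrier := by
        ext z; exact ⟨fun hz => ⟨hz.1, hz.2.2⟩, fun hz => ⟨hz.1, h, hz.2⟩⟩
      rw [this]
      exact hGm.inter (H.disk _).isClosed_carrier.measurableSet
    · have : S Q = ∅ := by
        ext z; exact ⟨fun hz => (h hz.2.1).elim, fun hz => hz.elim⟩
      rw [this]
      exact MeasurableSet.empty
  have hwS : ∀ Q, w Q ^ 2 ≤ ENNReal.ofReal (576 / L ^ 2) * (1875 * (C * μ (S Q))) := by
    intro Q
    by_cases hQ : (Q : Set M) = K ∨ (Q : Set M) = K'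
    · rw [show w Q = 0 from if_pos hQ]
      simp
    · rw [show w Q = _ from if_neg hQ]
      by_cases hc : (Q : Set M) ∈ boundaryCircles Ω
      · refine (H.ediam_ramp_sq_le hμ hL hkL ⟨Q, hc⟩).trans ?_
        have hsub : (H.disk ⟨Q, hc⟩).carrier ∩ {z | dist a z ∈ Icc (L / 2) (3 * L)} ⊆ S Q := by
          rintro z ⟨hz, hzL⟩
          refine ⟨⟨hzL, ?_, ?_⟩, hc, hz⟩
          · by_contra! hcon
            exact (H.disjoint (fun e => hQ (Or.inl (congrArg (fun K : boundaryCircles Ω =>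
              (K : Set M)) e)) : (⟨Q, hc⟩ : boundaryCircles Ω) ≠ K)).le_bot ⟨hz, hcon⟩
          · by_contra! hcon
            exact (H.disjoint (fun e => hQ (Or.inr (congrArg (fun K : boundaryCircles Ω =>
              (K : Set M)) e)) : (⟨Q, hc⟩ : boundaryCircles Ω) ≠ K')).le_bot ⟨hz, hcon⟩
        gcongr
      · have hpt : (Q : Set M).Subsingleton := by
          rcases hΩ'.point_or_circle Q Q.2 with ⟨x, hx⟩ | h
          · rw [hx]; exact subsingleton_singleton
          · exact (hc ⟨Q.2, h⟩).elim
        rw [Metric.ediam_subsingleton (hpt.image _)]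
        simp
  have hsum : ∑' Q, μ (S Q) ≤ μ G := by
    rw [← measure_iUnion ?_ hSm]
    · exact measure_mono (iUnion_subset fun Q z hz => hz.1)
    · intro Q Q' hQQ'
      rw [Function.onFun, disjoint_left]
      rintro z ⟨-, h, hz⟩ ⟨-, h', hz'⟩
      exact (H.disjoint (fun e => hQQ' (Subtype.ext (Subtype.mk.inj e)) :
        (⟨Q, h⟩ : boundaryCircles Ω) ≠ ⟨Q', h'⟩)).le_bot ⟨hz, hz'⟩
  calc transboundaryModulus μ Ω (connectingCurves E F (closure Ω \ ⋃₀ {(K : Set M), (K' : Set M)}))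
      ≤ (∫⁻ z in Ω, ρ z ^ 2 ∂μ) + ∑' Q, w Q ^ 2 :=
        iInf_le_of_le ρ (iInf_le_of_le w (iInf_le_of_le hadm le_rfl))
    _ ≤ ENNReal.ofReal (1 / L ^ 2) * μ G +
        ∑' Q, ENNReal.ofReal (576 / L ^ 2) * (1875 * (C * μ (S Q))) :=
        add_le_add hmass (ENNReal.tsum_le_tsum hwS)
    _ = ENNReal.ofReal (1 / L ^ 2) * μ G +
        ENNReal.ofReal (576 / L ^ 2) * (1875 * (C * ∑' Q, μ (S Q))) := by
        rw [ENNReal.tsum_mul_left, ENNReal.tsum_mul_left, ENNReal.tsum_mul_left]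
    _ ≤ ENNReal.ofReal (1 / L ^ 2) * μ G + ENNReal.ofReal (576 / L ^ 2) * (1875 * (C * μ G)) := by
        gcongr
    _ = (1 + 576 * 1875 * C) * (ENNReal.ofReal (1 / L ^ 2) * μ G) := by
        rw [show 576 / L ^ 2 = 576 * (1 / L ^ 2) by ring, ENNReal.ofReal_mul (by norm_num),
          show ENNReal.ofReal 576 = 576 by simp]
        ring
    _ ≤ (1 + 576 * 1875 * C) * (ENNReal.ofReal (1 / L ^ 2) *
        (C * ENNReal.ofReal (10 ^ 5 * ε * L ^ 2))) := by gcongr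
    _ = (1 + 576 * 1875 * C) * (C * (ENNReal.ofReal (1 / L ^ 2) *
        ENNReal.ofReal (10 ^ 5 * ε * L ^ 2))) := by ring
    _ = _ := by
        rw [← ENNReal.ofReal_mul (by positivity),
          show 1 / L ^ 2 * (10 ^ 5 * ε * L ^ 2) = 10 ^ 5 * ε by field_simp]
        ring

/-- The boundary circles of a `2`-transboundary Loewner circle domain are uniformly relatively
separated. -/
theorem uniformlyRelativelySeparated (H : HullSystem P Ω)
    (hΩ : IsCountablyConnectedCircleDomain Ω) (hμ : IsComparable μ C)
    (h : IsTransboundaryLoewner μ Ω 2) :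
    UniformlyRelativelySeparated (boundaryCircles Ω) := by
  obtain ⟨Ψ, hanti, hpos, hΨ⟩ := h
  have hΨ4 := hpos 4 (by norm_num)
  set B : ℝ := (1 + 576 * 1875 * C) * C * 10 ^ 5 with hB
  have hB0 : 0 ≤ B := by positivity
  -- With this choice the modulus bound `B * ε` is below `Ψ 4`.
  set ε := min (1 / 1000) (Ψ 4 / (2 * (B + 1))) with hεdef
  have hε : 0 < ε := lt_min (by norm_num) (by positivity)
  have hε' : ε ≤ 1 / 1000 := min_le_left _ _
  have hεB : B * ε < Ψ 4 := by
    have h1 : ε ≤ Ψ 4 / (2 * (B + 1)) := min_le_right _ _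
    rw [le_div_iff₀ (by positivity)] at h1
    nlinarith
  have key : ∀ K K' : boundaryCircles Ω, K ≠ K' →
      Metric.diam (K : Set M) ≤ Metric.diam (K' : Set M) →
      ε ^ 2 / 4 * Metric.diam (K : Set M) < setDist (K : Set M) K' := by
    intro K K' hne hdiam
    by_contra! hcon
    have hr := (H.round K).pos
    have hd := H.radius_le_diam K
    have hd' := H.diam_le K
    have hd'' := H.diam_le K'
    have hlt : setDist (K : Set M) K' < ε ^ 2 * (H.disk K).radius := by
      have : 0 < ε ^ 2 * (H.disk K).radius := by positivity
      nlinarith [sq_nonneg ε]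
    obtain ⟨a, ha, a', ha', haa'⟩ := exists_dist_lt K.2.2.1.nonempty K'.2.2.1.nonempty hlt
    obtain ⟨b, hb, hab⟩ := exists_diam_le_dist (E := (K : Set M)) a (by linarith)
    obtain ⟨E, F, hE, hF, hEΩ, hFΩ, hEL, hFL, hrel⟩ := exists_continua P hΩ.isOpen hΩ.isConnected
      (L := ε * (H.disk K).radius) (by positivity) (subset_closure K ha)
      ⟨b, subset_closure K hb, by nlinarith⟩
    have hdisj : Disjoint E F := by
      rw [disjoint_left]
      intro z hz hz'
      have : 0 < ε * (H.disk K).radius := by positivity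
      linarith [hEL z hz, hFL z hz']
    have h1 := hΨ E F hE hF hEΩ hFΩ hdisj {(K : Set M), (K' : Set M)}
      (by rintro Q (rfl | rfl); exacts [K.2.1, K'.2.1])
      ((encard_insert_le _ _).trans (by rw [encard_singleton]; norm_num))
    have h2 := H.transboundaryModulus_le_of_close hΩ hμ hε hε' hne (by linarith) ha ha' haa'.le
      hEL hFL
    have h3 : (1 + 576 * 1875 * C) * C * ENNReal.ofReal (10 ^ 5 * ε) = ENNReal.ofReal (B * ε) := by
      rw [show B * ε = (((1 + 576 * 1875 * C) * C : ℝ≥0) : ℝ) * (10 ^ 5 * ε) by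
        rw [hB]; push_cast; ring, ENNReal.ofReal_mul (NNReal.coe_nonneg _),
        ENNReal.ofReal_coe_nnreal]
      push_cast
      rfl
    have h4 := (h1.trans h2).trans_eq h3
    have h5 : Ψ 4 ≤ Ψ (relDist E F) := hanti hrel.1 (by norm_num) hrel.2
    rw [ENNReal.ofReal_le_ofReal_iff (by positivity)] at h4
    linarith
  refine ⟨ε ^ 2 / 4, by positivity, fun A hA A' hA' hne => ?_⟩
  have hpd : ∀ K : boundaryCircles Ω, 0 < Metric.diam (K : Set M) := fun K =>
    (H.round K).pos.trans_le (H.radius_le_diam K)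
  have hne' : (⟨A, hA⟩ : boundaryCircles Ω) ≠ ⟨A', hA'⟩ := fun e => hne (Subtype.mk.inj e)
  rw [relDist, lt_div_iff₀ (lt_min (hpd ⟨A, hA⟩) (hpd ⟨A', hA'⟩))]
  rcases le_total (Metric.diam A) (Metric.diam A') with hle | hle
  · rw [min_eq_left hle]
    exact key ⟨A, hA⟩ ⟨A', hA'⟩ hne' hle
  · rw [min_eq_right hle, setDist_comm]
    exact key ⟨A', hA'⟩ ⟨A, hA⟩ hne'.symm hle

end HullSystem


/-! ### The two model spaces -/

section Plane

/-- Polar coordinates in the plane. -/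
noncomputable def planePolar : PolarSpace ℂ where
  k := 0
  k_eq := Or.inl rfl
  Φ a r θ := a + r * Complex.exp (θ * Complex.I)
  continuous_polar a := by fun_prop
  exists_angle' a z := by
    refine ⟨(z - a).arg, ?_⟩
    rw [dist_comm, Complex.dist_eq, Complex.norm_mul_exp_arg_mul_I]
    ring
  dist_bound a z := by norm_num
  law a r s θ φ hr hs _ _ := by
    rw [Complex.dist_eq, ← Complex.normSq_eq_norm_sq, Complex.normSq_apply, Real.cos_sub]
    simp only [Complex.sub_re, Complex.add_re, Complex.mul_re, Complex.ofReal_re,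
      Complex.ofReal_im, Complex.exp_ofReal_mul_I_re, Complex.exp_ofReal_mul_I_im, Complex.sub_im,
      Complex.add_im, Complex.mul_im]
    have h1 := Real.sin_sq_add_cos_sq θ
    have h2 := Real.sin_sq_add_cos_sq φ
    norm_num
    linear_combination r ^ 2 * h1 + s ^ 2 * h2

/-- Hausdorff measure of `ℝ × ℝ` with the maximum metric is Lebesgue measure. Passing to it from `ℂ`
is `1`-Lipschitz with `2`-Lipschitz inverse, hence `4 = 2 ^ 2`. -/
lemma isComparable_volume_complex : IsComparable (volume : Measure ℂ) 4 := by
  let e := Complex.measurableEquivRealProd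
  have hvol : ∀ A : Set ℂ, volume (e '' A) = volume A := by
    intro A
    rw [e.image_eq_preimage_symm]
    exact (Complex.volume_preserving_equiv_real_prod.symm e).measure_preimage_equiv A
  have hlip : LipschitzWith 1 e := by
    refine LipschitzWith.of_dist_le_mul fun z z' => ?_
    rw [NNReal.coe_one, one_mul, Prod.dist_eq, Complex.dist_eq]
    refine max_le ?_ ?_
    · exact (Real.dist_eq _ _).le.trans (Complex.abs_re_le_norm (z - z'))
    · exact (Real.dist_eq _ _).le.trans (Complex.abs_im_le_norm (z - z'))
  have hlip' : LipschitzWith 2 e.symm := by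
    refine LipschitzWith.of_dist_le_mul fun p q => ?_
    obtain ⟨z, rfl⟩ := e.surjective p
    obtain ⟨z', rfl⟩ := e.surjective q
    rw [e.symm_apply_apply, e.symm_apply_apply, Prod.dist_eq, Complex.dist_eq]
    refine (Complex.norm_le_abs_re_add_abs_im _).trans ?_
    have h1 : |(z - z').re| ≤ max (dist (e z).1 (e z').1) (dist (e z).2 (e z').2) :=
      le_max_of_le_left (Real.dist_eq _ _).ge
    have h2 : |(z - z').im| ≤ max (dist (e z).1 (e z').1) (dist (e z).2 (e z').2) :=
      le_max_of_le_right (Real.dist_eq _ _).ge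
    push_cast
    linarith
  refine ⟨fun A => ?_, fun A => ?_⟩
  · have h := hlip'.hausdorffMeasure_image_le (d := 2) (by norm_num) (e '' A)
    rw [← image_comp, e.symm_comp_self, image_id, hausdorffMeasure_prod_real, hvol] at h
    refine h.trans (le_of_eq ?_)
    congr 1
    norm_num
  · have h := hlip.hausdorffMeasure_image_le (d := 2) (by norm_num) A
    rw [hausdorffMeasure_prod_real, hvol] at h
    refine h.trans ?_
    gcongr
    norm_num

end Plane

section Sphere

/-- An orthonormal basis whose first vector is a given unit vector. -/
lemma exists_frame (x : RiemannSphere) :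
    ∃ b : OrthonormalBasis (Fin 3) ℝ (EuclideanSpace ℝ (Fin 3)), b 0 = x := by
  have hx : ‖(x : EuclideanSpace ℝ (Fin 3))‖ = 1 := by simp
  have ho : Orthonormal ℝ (({0} : Set (Fin 3)).domRestrict
      fun _ : Fin 3 => (x : EuclideanSpace ℝ (Fin 3))) := by
    refine ⟨fun _ => hx, fun i j hij => ?_⟩
    exact absurd (Subsingleton.elim i j) hij
  obtain ⟨b, hb⟩ := ho.exists_orthonormalBasis_extension_of_card_eq (by simp)
  exact ⟨b, hb 0 rfl⟩

/-- An orthonormal basis whose first vector is a given unit vector. -/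
noncomputable def frame (x : RiemannSphere) :
    OrthonormalBasis (Fin 3) ℝ (EuclideanSpace ℝ (Fin 3)) := (exists_frame x).choose

lemma frame_zero (x : RiemannSphere) : frame x 0 = x := (exists_frame x).choose_spec

/-- The combination of the vectors of a frame with coefficients that depend on polar
coordinates. -/
noncomputable def spherePoint (x : RiemannSphere) (c θ : ℝ) : EuclideanSpace ℝ (Fin 3) :=
  (1 - c ^ 2 / 2) • frame x 0 + (c * √(1 - c ^ 2 / 4)) • (Real.cos θ • frame x 1 +
    Real.sin θ • frame x 2)

lemma inner_spherePoint (x : RiemannSphere) (c d θ φ : ℝ) :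
    inner ℝ (spherePoint x c θ) (spherePoint x d φ) = (1 - c ^ 2 / 2) * (1 - d ^ 2 / 2) +
      (c * √(1 - c ^ 2 / 4)) * (d * √(1 - d ^ 2 / 4)) * Real.cos (θ - φ) := by
  have h := (orthonormal_iff_ite.1 (frame x).orthonormal)
  simp only [spherePoint, inner_add_left, inner_add_right, inner_smul_left, inner_smul_right, h]
  simp [Real.cos_sub]
  ring

lemma norm_spherePoint (x : RiemannSphere) {c : ℝ} (hc : c ^ 2 ≤ 4) (θ : ℝ) :
    ‖spherePoint x c θ‖ = 1 := by
  have h := inner_spherePoint x c c θ θ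
  rw [real_inner_self_eq_norm_sq, sub_self, Real.cos_zero] at h
  have h1 := Real.sq_sqrt (show 0 ≤ 1 - c ^ 2 / 4 by linarith)
  have h2 : ‖spherePoint x c θ‖ ^ 2 = 1 := by
    rw [h]
    linear_combination c ^ 2 * h1
  exact (pow_eq_one_iff_of_nonneg (norm_nonneg _) two_ne_zero).1 h2

lemma dist_sq_sphere (p q : RiemannSphere) : dist p q ^ 2 =
    2 - 2 * inner ℝ (p : EuclideanSpace ℝ (Fin 3)) q := by
  have hp : ‖(p : EuclideanSpace ℝ (Fin 3))‖ = 1 := by simp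
  have hq : ‖(q : EuclideanSpace ℝ (Fin 3))‖ = 1 := by simp
  rw [Subtype.dist_eq, dist_eq_norm, norm_sub_sq_real, hp, hq]
  ring

/-- Polar coordinates in the sphere with its chordal metric. -/
noncomputable def spherePolar : PolarSpace RiemannSphere where
  k := 1
  k_eq := Or.inr rfl
  -- Clamping `r` to `[0, 2]` keeps the point on the sphere and the map continuous for all real `r`.
  Φ x r θ := ⟨spherePoint x (max 0 (min r 2)) θ, by
    rw [mem_sphere_zero_iff_norm]
    refine norm_spherePoint x ?_ θ
    have h1 : max 0 (min r 2) ≤ 2 := max_le (by norm_num) (min_le_right _ _)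
    nlinarith [le_max_left 0 (min r 2)]⟩
  continuous_polar x := by
    refine Continuous.subtype_mk ?_ _
    unfold spherePoint
    fun_prop
  exists_angle' x z := by
    have hz : ‖(z : EuclideanSpace ℝ (Fin 3))‖ = 1 := by simp
    have hsq := dist_sq_sphere x z
    have hsum := (frame x).sum_repr' (z : EuclideanSpace ℝ (Fin 3))
    have hnorm := (frame x).sum_sq_norm_inner_right (z : EuclideanSpace ℝ (Fin 3))
    rw [Fin.sum_univ_three] at hsum hnorm
    simp only [Real.norm_eq_abs, sq_abs, hz] at hnorm
    set α := inner ℝ (frame x 1) (z : EuclideanSpace ℝ (Fin 3)) with hα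
    set β := inner ℝ (frame x 2) (z : EuclideanSpace ℝ (Fin 3)) with hβ
    rw [frame_zero] at hsum hnorm
    set R := dist x z with hR
    have hR0 : 0 ≤ R := dist_nonneg
    have hin : inner ℝ (x : EuclideanSpace ℝ (Fin 3)) z = 1 - R ^ 2 / 2 := by linarith
    rw [hin] at hsum hnorm
    have hR4 : R ^ 2 ≤ 4 := by nlinarith [sq_nonneg α, sq_nonneg β]
    have hR2 : R ≤ 2 := by nlinarith
    -- The components of `z` along the two vectors orthogonal to `x`, read as a complex number: its
    -- argument is the angle, and its modulus is forced by `‖z‖ = 1`.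
    let c : ℂ := ⟨α, β⟩
    have hc : ‖c‖ = R * √(1 - R ^ 2 / 4) := by
      have h1 := Real.sq_sqrt (show 0 ≤ 1 - R ^ 2 / 4 by linarith)
      have h2 : ‖c‖ ^ 2 = (R * √(1 - R ^ 2 / 4)) ^ 2 := by
        rw [← Complex.normSq_eq_norm_sq, Complex.normSq_apply, mul_pow, h1]
        show α * α + β * β = _
        linear_combination hnorm
      exact (pow_left_inj₀ (norm_nonneg _) (by positivity) two_ne_zero).1 h2
    refine ⟨c.arg, Subtype.ext ?_⟩
    show spherePoint x (max 0 (min R 2)) c.arg = z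
    rw [min_eq_left hR2, max_eq_right hR0, spherePoint, ← hc, smul_add, smul_smul, smul_smul,
      Complex.norm_mul_cos_arg, Complex.norm_mul_sin_arg, frame_zero, ← add_assoc]
    exact hsum
  dist_bound x z := by
    have h1 := dist_triangle_right (x : EuclideanSpace ℝ (Fin 3)) z 0
    have hx : dist (x : EuclideanSpace ℝ (Fin 3)) 0 = 1 := x.2
    have hz : dist (z : EuclideanSpace ℝ (Fin 3)) 0 = 1 := z.2
    have h2 : dist x z ≤ 2 := by rw [Subtype.dist_eq]; linarith
    nlinarith [dist_nonneg (x := x) (y := z)]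
  law x r s θ φ hr hs hr4 hs4 := by
    have hr2 : r ≤ 2 := by nlinarith
    have hs2 : s ≤ 2 := by nlinarith
    rw [dist_sq_sphere]
    simp only [min_eq_left hr2, max_eq_right hr, min_eq_left hs2, max_eq_right hs,
      inner_spherePoint, one_mul]
    ring

lemma isComparable_hausdorffMeasure {M : Type*} [MetricSpace M] [MeasurableSpace M]
    [BorelSpace M] : IsComparable (Measure.hausdorffMeasure 2 : Measure M) 1 :=
  ⟨fun A => by simp, fun A => by simp⟩

end Sphere

/-- The characterization of the transboundary Loewner property in spaces with polar
coordinates. -/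
theorem PolarSpace.tfae {M : Type*} [MetricSpace M] [MeasurableSpace M] [BorelSpace M]
    (P : PolarSpace M) {μ : Measure M} {C : ℝ≥0} (hμ : IsComparable μ C) {Ω : Set M}
    (hΩ : IsCountablyConnectedCircleDomain Ω) :
    List.TFAE [∀ N : ℕ, IsTransboundaryLoewner μ Ω N, IsTransboundaryLoewner μ Ω 2,
      UniformlyRelativelySeparated (boundaryCircles Ω)] := by
  obtain ⟨H⟩ := hΩ.exists_hullSystem P
  tfae_have 1 → 2 := fun h => h 2
  tfae_have 2 → 3 := H.uniformlyRelativelySeparated hΩ hμ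
  tfae_have 3 → 1 := H.isTransboundaryLoewner hΩ.isOpen hμ
  tfae_finish

end CircleDomain

theorem mainTheorem8 :
    (∀ Ω : Set ℂ, CircleDomain.IsCountablyConnectedCircleDomain Ω →
      List.TFAE [
        ∀ N : ℕ, CircleDomain.IsTransboundaryLoewner MeasureTheory.volume Ω N,
        CircleDomain.IsTransboundaryLoewner MeasureTheory.volume Ω 2,
        CircleDomain.UniformlyRelativelySeparated (CircleDomain.boundaryCircles Ω)]) ∧
    (∀ Ω : Set CircleDomain.RiemannSphere, CircleDomain.IsCountablyConnectedCircleDomain Ω →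
      List.TFAE [
        ∀ N : ℕ, CircleDomain.IsTransboundaryLoewner (MeasureTheory.Measure.hausdorffMeasure 2) Ω N,
        CircleDomain.IsTransboundaryLoewner (MeasureTheory.Measure.hausdorffMeasure 2) Ω 2,
        CircleDomain.UniformlyRelativelySeparated (CircleDomain.boundaryCircles Ω)]) :=
  ⟨fun _ hΩ => CircleDomain.planePolar.tfae CircleDomain.isComparable_volume_complex hΩ,
    fun _ hΩ => CircleDomain.spherePolar.tfae CircleDomain.isComparable_hausdorffMeasure hΩ⟩
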